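/- Let $0<q<1$, let $n$ be a natural number, and let $\alpha_1,\alpha_2,\beta_1,\beta_2,\tau\in\mathbb{C}$. Put $a_l=q^{\alpha_l}$, $b_l=q^{\beta_l}$ $(l=1,2)$, $t=q^{\tau}$, $(u)_\infty=\prod_{i\ge 0}(1-q^iu)$, $\theta(u)=(u)_\infty(q/u)_\infty$, and assume $$|qt^{2i-2}|<1,\qquad q<|a_1a_2b_1b_2t^{2i-2}|\quad(1\le i\le n),\qquad t\notin\{q,q^2,q^3,\ldots\}.$$ For $x_1,x_2\in\mathbb{C}^*$ and $0\le i\le n$ let $\zeta_i(x_1,x_2)=(x_1,x_1t,\ldots,x_1t^{i-1},x_2,x_2t,\ldots,x_2t^{n-i-1})$. For $x\in(\mathbb{C}^*)^n$ and a function $f$ on $(\mathbb{C}^*)^n$ write $\int_0^{x\infty}f\,\varpi_q=(1-q)^n\sum_{\nu\in\mathbb{Z}^n}f(x_1q^{\nu_1},\ldots,x_nq^{\nu_n})$, and let $\Delta(z)=\prod_{i<j}(z_i-z_j)$ and $s=1-\alpha_1-\alpha_2-\beta_1-\beta_2-2(n-1)\tau$. Define $$\bar\Phi(z)=\prod_{i=1}^n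 z_i^{s}\prod_{l=1}^2\frac{(qb_l^{-1}z_i)_\infty}{(a_lz_i)_\infty}\prod_{i<j}z_i^{2\tau-1}\frac{(qt^{-1}z_j/z_i)_\infty}{(tz_j/z_i)_\infty},\qquad \bar h(x)=\prod_{i=1}^n\frac{x_i^{s}}{\theta(a_1x_i)\theta(a_2x_i)}\prod_{i<j}x_i^{2\tau}\frac{\theta(x_j/x_i)}{\theta(tx_j/x_i)},$$ $$\bar J(x)=\int_0^{x\infty}\bar\Phi\,\Delta\,\varpi_q,\qquad \bar{\mathcal J}(x)=\bar J(x)/\bar h(x),$$ and $$\Phi(z)=\prod_{i=1}^n z_i\prod_{l=1}^2\frac{(qa_l^{-1}z_i)_\infty}{(b_lz_i)_\infty}\prod_{i<j}z_i^{2\tau-1}\frac{(qt^{-1}z_j/z_i)_\infty}{(tz_j/z_i)_\infty},\qquad h(x)=\prod_{i=1}^n\frac{x_i}{\theta(b_1x_i)\theta(b_2x_i)}\prod_{i<j}x_i^{2\tau}\frac{\theta(x_j/x_i)}{\theta(tx_j/x_i)},$$ $$J(x)=\int_0^{x\infty}\Phi\,\Delta\,\varpi_q,\qquad \mathcal J(x)=J(x)/h(x)$$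 (principal values of the powers). Put $$C_1=(1-q)^n\prod_{k=1}^n\frac{(q)_\infty(qt^{-k})_\infty\prod_{i=1}^2\prod_{j=1}^2(qa_i^{-1}b_j^{-1}t^{-(k-1)})_\infty}{(qt^{-1})_\infty(qa_1^{-1}a_2^{-1}b_1^{-1}b_2^{-1}t^{-(n+k-2)})_\infty}.$$ (1) For every $i=0,1,\ldots,n$ such that no theta function in the definition of $\bar h$ vanishes at $x=\zeta_i(b_1,b_2)$ (so that $\bar J(x)/\bar h(x)$ makes sense), the truncated dual Jackson integral $\bar J(\zeta_i(b_1,b_2))$ converges absolutely and $$\bar{\mathcal J}(\zeta_i(b_1,b_2))=C_1 .$$ In particular the value does not depend on $i$; the case $i=n$ is $\bar{\mathcal J}(b_1,b_1t,\ldots,b_1t^{n-1})=C_1$. (2) $C_1$ is the constant in the relation $$\sum_{i=0}^n\mathcal J(\zeta_i(x_1,x_2))\,H_i(x_1,x_2)=C_1,$$ where $$H_i(x_1,x_2)=\prod_{j=1}^{i}\frac{\theta(x_2b_1t^{n-j})\theta(x_2b_2t^{n-j})}{\theta(t^{j})\theta(x_2x_1^{-1}t^{n-i-j+1})}\prod_{k=1}^{n-i}\frac{\theta(x_1b_1t^{n-k})\theta(x_1b_2t^{n-k})}{\theta(t^{k})\theta(x_1x_2^{-1}t^{i-k+1})}\prod_{l=1}^n\frac{\theta(t^l)}{\theta(x_1x_2b_1b_2t^{n+l-2})}.$$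 This relation holds, with all the sums $J(\zeta_i(x_1,x_2))$ absolutely convergent, for all $x_1,x_2\in\mathbb{C}^*$ for which none of $\theta(t^m)$ $(1\le m\le n)$, $\theta(x_2x_1^{-1}t^m)$ $(|m|<n)$, $\theta(x_jb_lt^m)$ $(j,l\in\{1,2\},\ 0\le m<n)$, $\theta(x_1x_2b_1b_2t^{n+l-2})$ $(1\le l\le n)$ vanishes. -/

import Mathlib

noncomputable section

namespace QSelberg

/-- The infinite `q`-shifted factorial `(u)_∞ = ∏_{i ≥ 0} (1 - q^i u)`. -/
def qInf (q : ℝ) (u : ℂ) : ℂ := ∏' i : ℕ, (1 - (q : ℂ) ^ i * u)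

/-- The theta function `θ(u) = (u)_∞ (q/u)_∞`. -/
def theta (q : ℝ) (u : ℂ) : ℂ := qInf q u * qInf q ((q : ℂ) / u)

/-- The point `x q^ν = (x_1 q^{ν_1}, …, x_n q^{ν_n})` of the `q`-lattice through `x`. -/
def qShift (q : ℝ) {n : ℕ} (x : Fin n → ℂ) (ν : Fin n → ℤ) : Fin n → ℂ :=
  fun k => x k * (q : ℂ) ^ ν k

/-- The multiple bilateral sum
`∫_0^{x∞} f(z) d_q z_1/z_1 ∧ ⋯ ∧ d_q z_n/z_n = (1-q)^n ∑_{ν ∈ ℤ^n} f(x q^ν)`. -/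
def jackson (q : ℝ) {n : ℕ} (f : (Fin n → ℂ) → ℂ) (x : Fin n → ℂ) : ℂ :=
  (1 - (q : ℂ)) ^ n * ∑' ν : Fin n → ℤ, f (qShift q x ν)

/-- Absolute convergence of the bilateral sum at `x`. -/
def JacksonConverges (q : ℝ) {n : ℕ} (f : (Fin n → ℂ) → ℂ) (x : Fin n → ℂ) : Prop :=
  Summable fun ν : Fin n → ℤ => f (qShift q x ν)

/-- The difference product `Δ(z) = ∏_{i<j} (z_i - z_j)`. -/
def Delta {n : ℕ} (z : Fin n → ℂ) : ℂ := ∏ i, ∏ j ∈ Finset.Ioi i, (z i - z j)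

/-- The base `q` and the exponents `α_1, α_2, β_1, β_2, τ`. -/
structure Params where
  q : ℝ
  α : Fin 2 → ℂ
  β : Fin 2 → ℂ
  τ : ℂ

namespace Params

variable (P : Params) {n : ℕ}

/-- `a_l = q^{α_l}`. -/
def a (l : Fin 2) : ℂ := (P.q : ℂ) ^ P.α l

/-- `b_l = q^{β_l}`. -/
def b (l : Fin 2) : ℂ := (P.q : ℂ) ^ P.β l

/-- `t = q^τ`. -/
def t : ℂ := (P.q : ℂ) ^ P.τ

/-- The point `ζ_i(x₁, x₂) = (x₁, x₁ t, …, x₁ t^{i-1}, x₂, x₂ t, …, x₂ t^{n-i-1})`. -/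
def zeta (n i : ℕ) (x₁ x₂ : ℂ) : Fin n → ℂ := fun k =>
  if (k : ℕ) < i then x₁ * P.t ^ (k : ℕ) else x₂ * P.t ^ ((k : ℕ) - i)

/-- `Φ(z) = ∏_i z_i (q z_i/a_1)_∞ (q z_i/a_2)_∞ / ((b_1 z_i)_∞ (b_2 z_i)_∞)
  × ∏_{i<j} z_i^{2τ-1} (q t⁻¹ z_j/z_i)_∞ / (t z_j/z_i)_∞`. -/
def Phi (z : Fin n → ℂ) : ℂ :=
  (∏ i, z i * ∏ l : Fin 2,
    qInf P.q ((P.q : ℂ) * (P.a l)⁻¹ * z i) / qInf P.q (P.b l * z i)) *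
  ∏ i, ∏ j ∈ Finset.Ioi i, z i ^ (2 * P.τ - 1) *
    (qInf P.q ((P.q : ℂ) * P.t⁻¹ * (z j / z i)) / qInf P.q (P.t * (z j / z i)))

/-- The Jackson integral of Selberg type `J(x) = ∫_0^{x∞} Φ(z) Δ(z) ϖ_q`. -/
def J (x : Fin n → ℂ) : ℂ := jackson P.q (fun z => P.Phi z * Delta z) x

/-- `h(x) = ∏_i x_i / (θ(b_1 x_i) θ(b_2 x_i)) × ∏_{i<j} x_i^{2τ} θ(x_j/x_i) / θ(t x_j/x_i)`. -/
def h (x : Fin n → ℂ) : ℂ :=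
  (∏ i, x i / ∏ l : Fin 2, theta P.q (P.b l * x i)) *
  ∏ i, ∏ j ∈ Finset.Ioi i, x i ^ (2 * P.τ) *
    (theta P.q (x j / x i) / theta P.q (P.t * (x j / x i)))

/-- The regularization `𝒥(x) = J(x) / h(x)`. -/
def calJ (x : Fin n → ℂ) : ℂ := P.J x / P.h x

/-- The exponent `1 - α_1 - α_2 - β_1 - β_2 - 2(n-1)τ`. -/
def barExponent (n : ℕ) : ℂ :=
  1 - P.α 0 - P.α 1 - P.β 0 - P.β 1 - 2 * ((n : ℂ) - 1) * P.τ

/-- `Φ̄(z) = ∏_i z_i^{1-α_1-α_2-β_1-β_2-2(n-1)τ}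
    (q z_i/b_1)_∞ (q z_i/b_2)_∞ / ((a_1 z_i)_∞ (a_2 z_i)_∞)
  × ∏_{i<j} z_i^{2τ-1} (q t⁻¹ z_j/z_i)_∞ / (t z_j/z_i)_∞`. -/
def barPhi (z : Fin n → ℂ) : ℂ :=
  (∏ i, z i ^ P.barExponent n * ∏ l : Fin 2,
    qInf P.q ((P.q : ℂ) * (P.b l)⁻¹ * z i) / qInf P.q (P.a l * z i)) *
  ∏ i, ∏ j ∈ Finset.Ioi i, z i ^ (2 * P.τ - 1) *
    (qInf P.q ((P.q : ℂ) * P.t⁻¹ * (z j / z i)) / qInf P.q (P.t * (z j / z i)))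

/-- The dual Jackson integral `J̄(x) = ∫_0^{x∞} Φ̄(z) Δ(z) ϖ_q`. -/
def barJ (x : Fin n → ℂ) : ℂ := jackson P.q (fun z => P.barPhi z * Delta z) x

/-- `h̄(x) = ∏_i x_i^{1-α_1-α_2-β_1-β_2-2(n-1)τ} / (θ(a_1 x_i) θ(a_2 x_i))
  × ∏_{i<j} x_i^{2τ} θ(x_j/x_i) / θ(t x_j/x_i)`. -/
def barh (x : Fin n → ℂ) : ℂ :=
  (∏ i, x i ^ P.barExponent n / ∏ l : Fin 2, theta P.q (P.a l * x i)) *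
  ∏ i, ∏ j ∈ Finset.Ioi i, x i ^ (2 * P.τ) *
    (theta P.q (x j / x i) / theta P.q (P.t * (x j / x i)))

/-- The regularization `𝒥̄(x) = J̄(x) / h̄(x)`. -/
def barCalJ (x : Fin n → ℂ) : ℂ := P.barJ x / P.barh x

/-- None of the theta functions in the definition of `h̄` vanishes at `x`; equivalently, the
summands of `J̄(x)` have no pole on the `q`-lattice through `x`, and `h̄(x)` is finite and
nonzero. -/
def BarRegular (x : Fin n → ℂ) : Prop :=
  (∀ i, ∀ l : Fin 2, theta P.q (P.a l * x i) ≠ 0) ∧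
  ∀ i j, i < j → theta P.q (x j / x i) ≠ 0 ∧ theta P.q (P.t * (x j / x i)) ≠ 0

/-- The coefficient
`H_i(x₁,x₂) = ∏_{j=1}^{i} θ(x₂b_1t^{n-j}) θ(x₂b_2t^{n-j}) / (θ(t^j) θ(x₂x₁⁻¹t^{n-i-j+1}))
  × ∏_{k=1}^{n-i} θ(x₁b_1t^{n-k}) θ(x₁b_2t^{n-k}) / (θ(t^k) θ(x₁x₂⁻¹t^{i-k+1}))
  × ∏_{l=1}^{n} θ(t^l) / θ(x₁x₂b_1b_2t^{n+l-2})`. -/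
def H (n i : ℕ) (x₁ x₂ : ℂ) : ℂ :=
  (∏ j ∈ Finset.Icc 1 i,
    (theta P.q (x₂ * P.b 0 * P.t ^ ((n : ℤ) - j)) *
        theta P.q (x₂ * P.b 1 * P.t ^ ((n : ℤ) - j))) /
      (theta P.q (P.t ^ j) * theta P.q (x₂ * x₁⁻¹ * P.t ^ ((n : ℤ) - i - j + 1)))) *
  (∏ k ∈ Finset.Icc 1 (n - i),
    (theta P.q (x₁ * P.b 0 * P.t ^ ((n : ℤ) - k)) *
        theta P.q (x₁ * P.b 1 * P.t ^ ((n : ℤ) - k))) /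
      (theta P.q (P.t ^ k) * theta P.q (x₁ * x₂⁻¹ * P.t ^ ((i : ℤ) - k + 1)))) *
  ∏ l ∈ Finset.Icc 1 n,
    theta P.q (P.t ^ l) /
      theta P.q (x₁ * x₂ * P.b 0 * P.b 1 * P.t ^ ((n : ℤ) + l - 2))

/-- The infinite product
`(1-q)^n ∏_{k=1}^n (q)_∞ (qt^{-k})_∞ ∏_{i,j=1}^2 (q a_i⁻¹ b_j⁻¹ t^{-(k-1)})_∞
  / ((qt⁻¹)_∞ (q a_1⁻¹ a_2⁻¹ b_1⁻¹ b_2⁻¹ t^{-(n+k-2)})_∞)`. -/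
def productValue (n : ℕ) : ℂ :=
  (1 - (P.q : ℂ)) ^ n * ∏ k ∈ Finset.Icc 1 n,
    (qInf P.q P.q * qInf P.q ((P.q : ℂ) * P.t ^ (-(k : ℤ))) *
      ∏ i : Fin 2, ∏ j : Fin 2,
        qInf P.q ((P.q : ℂ) * (P.a i)⁻¹ * (P.b j)⁻¹ * P.t ^ (-((k : ℤ) - 1)))) /
    (qInf P.q ((P.q : ℂ) * P.t⁻¹) *
      qInf P.q ((P.q : ℂ) * (P.a 0)⁻¹ * (P.a 1)⁻¹ * (P.b 0)⁻¹ * (P.b 1)⁻¹ *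
        P.t ^ (-((n : ℤ) + k - 2))))

end Params

end QSelberg

end

/-!
Both parts are statements about a single function of `x`. The poles `1/(u q^k)_∞` of the summands
are traded, by `θ(u q^k) * thetaMult u k = θ(u)`, for entire factors, at the price of the quasi-constant
that `h` divides out (`summand_eq`). This identifies `𝒥(x)` with `(1-q)^n` times `symSum x`, a
symmetric function of `x`. The regularised summand of the dual integral at `x` is that of the
original integral at the inverse point (`term_inv`), so the dual `𝒥` at `x` is `(1-q)^n` times
`symSum (1/x)`. In particular the dual integral truncated at `ζ_n(b₁,b₂)` corresponds to the point
`(1/b₁, 1/(b₁t), …, 1/(b₁t^{n-1}))` (`truncPoint`).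

**Connection formula.** As a function of each single variable `symSum` is a theta function of degree
two (`Admissible.exists_slice`): the zeros of the denominator `∏ x_i θ(x_j/x_i)` are cancelled
because the numerator is antisymmetric. Such theta functions form a space of dimension two, so the
value at one point is a combination of the values at two others (`IsTheta.interpolation`). Starting
at the truncation point and replacing its entries one after the other by entries of the geometric
progressions from `x₁` and `x₂`, induction and Weierstrass's three-term relation give
`Admissible.connection`: the sum of `symSum (ζ_i(x₁,x₂)) H_i(x₁,x₂)` is the value of `symSum` at the
truncation point. It remains to evaluate `symSum` there, and at the points with two interlaced
progressions.

**Evaluation at the truncation point.** There the summand vanishes unless `ν ≤ 0`. This makes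
differences of the summand against low-degree polynomials summable after `b₂` is replaced by `b₂/q`,
and they sum to zero. Weighting them by products over subsets of the variables, the rational
identity `subset_telescoping` produces a two-term recurrence between the moments of consecutive
subset sums (`Admissible.subsetMoment_recurrence`), and hence the contiguity relation between the
parameters `b₂` and `b₂/q` (`Admissible.contiguity`). Iterating it, in the limit `b₂ → ∞` only the
term `ν = 0` survives, which gives the product value (`Admissible.symSum_truncPoint`).

**Interlaced truncation points.** A theta function of degree two is invariant under
`y ↦ 1/(b₁b₂t^{n-1}y)`, which moves the entries of the progression from `1/b₁` to those of the
progression from `1/b₂` one at a time (`Admissible.symList_pair_of_theta_ne_zero`). This needs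
generic parameters; the remaining ones are reached by continuity (`Admissible.symSum_pairPoint`).
For `n = 0` the convergence hypotheses are empty and everything is trivial.
-/

open Filter Topology Finset
open scoped BigOperators

noncomputable section

namespace QSelberg

theorem summable_norm_pow_mul {q : ℝ} (hq0 : 0 < q) (hq1 : q < 1) (u : ℂ) :
    Summable fun i : ℕ => ‖-((q : ℂ) ^ i * u)‖ := by
  have : Summable fun i : ℕ => q ^ i * ‖u‖ :=
    (summable_geometric_of_lt_one hq0.le hq1).mul_right _
  refine this.congr fun i => ?_
  rw [norm_neg, norm_mul, norm_pow, Complex.norm_real, Real.norm_of_nonneg hq0.le]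

theorem multipliable_one_sub_pow_mul {q : ℝ} (hq0 : 0 < q) (hq1 : q < 1) (u : ℂ) :
    Multipliable fun i : ℕ => (1 - (q : ℂ) ^ i * u) := by
  simpa only [sub_eq_add_neg] using
    multipliable_one_add_of_summable (summable_norm_pow_mul hq0 hq1 u)

theorem qInf_step {q : ℝ} (hq0 : 0 < q) (hq1 : q < 1) (u : ℂ) :
    qInf q u = (1 - u) * qInf q (q * u) := by
  have h : Multipliable fun i : ℕ => (1 - (q : ℂ) ^ (i + 1) * u) := by
    simpa only [pow_succ, mul_assoc] using multipliable_one_sub_pow_mul hq0 hq1 (q * u)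
  have h2 : ∏' i : ℕ, (1 - (q : ℂ) ^ i * u) =
      (1 - (q : ℂ) ^ 0 * u) * ∏' i : ℕ, (1 - (q : ℂ) ^ (i + 1) * u) := tprod_eq_zero_mul' h
  have h3 : ∏' i : ℕ, (1 - (q : ℂ) ^ (i + 1) * u) = qInf q (q * u) := by
    unfold qInf
    refine tprod_congr fun i => ?_
    rw [pow_succ, mul_assoc]
  rw [h3, pow_zero, one_mul] at h2
  unfold qInf at h2 ⊢
  exact h2

theorem qInf_zero (q : ℝ) : qInf q 0 = 1 := by simp [qInf]

theorem differentiable_qInf {q : ℝ} (hq0 : 0 < q) (hq1 : q < 1) :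
    Differentiable ℂ (qInf q) := by
  intro u
  have hu : Summable fun i : ℕ => q ^ i * (‖u‖ + 1) :=
    (summable_geometric_of_lt_one hq0.le hq1).mul_right _
  have h := (Summable.hasProdLocallyUniformlyOn_nat_one_add (K := Metric.ball (0 : ℂ) (‖u‖ + 1))
    (f := fun (i : ℕ) (v : ℂ) => -((q : ℂ) ^ i * v)) Metric.isOpen_ball hu
    (.of_forall fun i v hv => by
      rw [norm_neg, norm_mul, norm_pow, Complex.norm_real, Real.norm_of_nonneg hq0.le]
      have : ‖v‖ ≤ ‖u‖ + 1 := by simpa using (Metric.mem_ball.1 hv).le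
      gcongr) (fun i => by fun_prop)).differentiableOn
      (.of_forall fun _ => by
        simpa [Finset.prod_fn] using DifferentiableOn.finsetProd (fun _ _ => by fun_prop))
      Metric.isOpen_ball
  have h2 : DifferentiableAt ℂ (fun v : ℂ => ∏' i : ℕ, (1 + -((q : ℂ) ^ i * v))) u :=
    h.differentiableAt (Metric.isOpen_ball.mem_nhds (by simp))
  have h3 : qInf q = fun v : ℂ => ∏' i : ℕ, (1 + -((q : ℂ) ^ i * v)) := by
    funext v
    simp only [← sub_eq_add_neg, qInf]
  rw [h3]
  exact h2

theorem continuous_qInf {q : ℝ} (hq0 : 0 < q) (hq1 : q < 1) : Continuous (qInf q) :=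
  (differentiable_qInf hq0 hq1).continuous

theorem qInf_ne_zero {q : ℝ} (hq0 : 0 < q) (hq1 : q < 1) {u : ℂ}
    (hu : ∀ i : ℕ, (q : ℂ) ^ i * u ≠ 1) : qInf q u ≠ 0 := by
  have := tprod_one_add_ne_zero_of_summable (f := fun i : ℕ => -((q : ℂ) ^ i * u))
    (fun i h => hu i (by linear_combination -h)) (summable_norm_pow_mul hq0 hq1 u)
  simpa only [← sub_eq_add_neg, qInf] using this

theorem qInf_shift {q : ℝ} (hq0 : 0 < q) (hq1 : q < 1) (u : ℂ) (m : ℕ) :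
    qInf q u = (∏ i ∈ range m, (1 - (q : ℂ) ^ i * u)) * qInf q ((q : ℂ) ^ m * u) := by
  induction m with
  | zero => simp
  | succ m ih =>
    rw [ih, prod_range_succ, qInf_step hq0 hq1 ((q : ℂ) ^ m * u), pow_succ]
    ring_nf

theorem qInf_eq_zero_iff {q : ℝ} (hq0 : 0 < q) (hq1 : q < 1) {u : ℂ} :
    qInf q u = 0 ↔ ∃ i : ℕ, (q : ℂ) ^ i * u = 1 := by
  constructor
  · intro h
    by_contra! hc
    exact qInf_ne_zero hq0 hq1 hc h
  · rintro ⟨i, hi⟩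
    rw [qInf_shift hq0 hq1 u (i + 1), prod_range_succ, hi]
    simp

theorem qInf_ne_zero_of_norm_lt_one {q : ℝ} (hq0 : 0 < q) (hq1 : q < 1) {u : ℂ}
    (hu : ‖u‖ < 1) : qInf q u ≠ 0 := by
  refine qInf_ne_zero hq0 hq1 fun i h => ?_
  have h1 : ‖(q : ℂ) ^ i * u‖ = 1 := by rw [h]; simp
  rw [norm_mul, norm_pow, Complex.norm_real, Real.norm_of_nonneg hq0.le] at h1
  have : q ^ i ≤ 1 := pow_le_one₀ hq0.le hq1.le
  nlinarith [norm_nonneg u]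

theorem norm_prod_one_sub_le_exp {q : ℝ} (hq0 : 0 < q) (hq1 : q < 1) (u : ℂ) (m : ℕ) :
    ‖∏ i ∈ range m, (1 - (q : ℂ) ^ i * u)‖ ≤ Real.exp (‖u‖ / (1 - q)) := by
  have h1 : ‖∏ i ∈ range m, (1 - (q : ℂ) ^ i * u)‖ ≤ ∏ i ∈ range m, Real.exp (q ^ i * ‖u‖) := by
    rw [norm_prod]
    refine prod_le_prod (fun _ _ => norm_nonneg _) fun i _ => ?_
    calc ‖1 - (q : ℂ) ^ i * u‖ ≤ ‖(1 : ℂ)‖ + ‖(q : ℂ) ^ i * u‖ := norm_sub_le _ _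
      _ = q ^ i * ‖u‖ + 1 := by
        rw [norm_one, norm_mul, norm_pow, Complex.norm_real, Real.norm_of_nonneg hq0.le]; ring
      _ ≤ _ := Real.add_one_le_exp _
  refine h1.trans ?_
  rw [← Real.exp_sum, ← sum_mul]
  refine Real.exp_le_exp.2 ?_
  rw [div_eq_inv_mul]
  refine mul_le_mul_of_nonneg_right ?_ (norm_nonneg _)
  rw [← tsum_geometric_of_lt_one hq0.le hq1]
  exact (summable_geometric_of_lt_one hq0.le hq1).sum_le_tsum _ fun i _ => by positivity

theorem norm_qInf_le {q : ℝ} (hq0 : 0 < q) (hq1 : q < 1) (u : ℂ) :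
    ‖qInf q u‖ ≤ Real.exp (‖u‖ / (1 - q)) := by
  have h := (multipliable_one_sub_pow_mul hq0 hq1 u).hasProd.tendsto_prod_nat.norm
  exact le_of_tendsto h (.of_forall fun m => norm_prod_one_sub_le_exp hq0 hq1 u m)

/-! ### The theta function -/

/-- The automorphy factor `(-u)^k q^{k(k-1)/2}` of the theta function, so that
`θ(u q^k) (-u)^k q^{k(k-1)/2} = θ(u)`. -/
def thetaMult (q : ℝ) (u : ℂ) (k : ℤ) : ℂ := (-u) ^ k * (q : ℂ) ^ (k * (k - 1) / 2)

theorem tri_succ (k : ℤ) : (k + 1) * (k + 1 - 1) / 2 = k * (k - 1) / 2 + k := by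
  have : (k + 1) * (k + 1 - 1) = k * (k - 1) + k * 2 := by ring
  rw [this, Int.add_mul_ediv_right _ _ (by norm_num)]

@[simp] theorem thetaMult_zero (q : ℝ) (u : ℂ) : thetaMult q u 0 = 1 := by simp [thetaMult]

theorem thetaMult_succ {q : ℝ} (hq0 : 0 < q) {u : ℂ} (hu : u ≠ 0) (k : ℤ) :
    thetaMult q u (k + 1) = thetaMult q u k * (-(u * (q : ℂ) ^ k)) := by
  have hq : (q : ℂ) ≠ 0 := by exact_mod_cast hq0.ne'
  rw [thetaMult, thetaMult, tri_succ, zpow_add₀ hq, zpow_add₀ (neg_ne_zero.2 hu), zpow_one]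
  ring

theorem thetaMult_ne_zero {q : ℝ} (hq0 : 0 < q) {u : ℂ} (hu : u ≠ 0) (k : ℤ) :
    thetaMult q u k ≠ 0 := by
  have hq : (q : ℂ) ≠ 0 := by exact_mod_cast hq0.ne'
  exact mul_ne_zero (zpow_ne_zero _ (neg_ne_zero.2 hu)) (zpow_ne_zero _ hq)

theorem thetaMult_mul (q : ℝ) (c u : ℂ) (k : ℤ) :
    thetaMult q (c * u) k = c ^ k * thetaMult q u k := by
  rw [thetaMult, thetaMult, ← mul_neg, mul_zpow, mul_assoc]

theorem theta_q_mul {q : ℝ} (hq0 : 0 < q) (hq1 : q < 1) {u : ℂ} (hu : u ≠ 0) :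
    theta q (q * u) = -(theta q u / u) := by
  have hq : (q : ℂ) ≠ 0 := by exact_mod_cast hq0.ne'
  have h1 : (q : ℂ) / (q * u) = 1 / u := by field_simp
  rw [theta, theta, h1, qInf_step hq0 hq1 u, qInf_step hq0 hq1 (1 / u), mul_one_div]
  field_simp
  ring

theorem theta_inv {q : ℝ} (hq0 : 0 < q) (hq1 : q < 1) {u : ℂ} (hu : u ≠ 0) :
    theta q u⁻¹ = -(theta q u / u) := by
  have hq : (q : ℂ) ≠ 0 := by exact_mod_cast hq0.ne'
  rw [← theta_q_mul hq0 hq1 hu, theta, theta, mul_comm]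
  congr 2 <;> field_simp

theorem theta_mul_thetaMult {q : ℝ} (hq0 : 0 < q) (hq1 : q < 1) {u : ℂ} (hu : u ≠ 0) (k : ℤ) :
    theta q (u * (q : ℂ) ^ k) * thetaMult q u k = theta q u := by
  have hq : (q : ℂ) ≠ 0 := by exact_mod_cast hq0.ne'
  have step : ∀ k : ℤ, theta q (u * (q : ℂ) ^ (k + 1)) * thetaMult q u (k + 1) =
      theta q (u * (q : ℂ) ^ k) * thetaMult q u k := fun k => by
    have hk : u * (q : ℂ) ^ k ≠ 0 := mul_ne_zero hu (zpow_ne_zero _ hq)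
    rw [thetaMult_succ hq0 hu, zpow_add₀ hq, zpow_one,
      show u * ((q : ℂ) ^ k * q) = q * (u * (q : ℂ) ^ k) by ring, theta_q_mul hq0 hq1 hk]
    field_simp
  induction k using Int.induction_on with
  | zero => simp
  | succ k ih => rw [step, ih]
  | pred k ih => rw [← ih, ← step, sub_add_cancel]

theorem theta_eq_zero_iff {q : ℝ} (hq0 : 0 < q) (hq1 : q < 1) {u : ℂ} (hu : u ≠ 0) :
    theta q u = 0 ↔ ∃ k : ℤ, u = (q : ℂ) ^ k := by
  have hq : (q : ℂ) ≠ 0 := by exact_mod_cast hq0.ne'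
  constructor
  · intro h
    rcases mul_eq_zero.1 h with h | h
    · obtain ⟨i, hi⟩ := (qInf_eq_zero_iff hq0 hq1).1 h
      refine ⟨-i, ?_⟩
      rw [zpow_neg, zpow_natCast]
      exact (eq_inv_of_mul_eq_one_right hi)
    · obtain ⟨i, hi⟩ := (qInf_eq_zero_iff hq0 hq1).1 h
      refine ⟨i + 1, ?_⟩
      rw [zpow_add₀ hq, zpow_natCast, zpow_one]
      field_simp at hi
      exact hi.symm
  · rintro ⟨k, rfl⟩
    have h := theta_mul_thetaMult hq0 hq1 one_ne_zero k
    have h1 : theta q 1 = 0 := by rw [theta, qInf_step hq0 hq1 1]; simp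
    rw [one_mul, h1] at h
    exact (mul_eq_zero.1 h).resolve_right (thetaMult_ne_zero hq0 one_ne_zero k)

theorem theta_inv_eq_zero_iff {q : ℝ} (hq0 : 0 < q) (hq1 : q < 1) {u : ℂ} (hu : u ≠ 0) :
    theta q u⁻¹ = 0 ↔ theta q u = 0 := by
  rw [theta_inv hq0 hq1 hu, neg_eq_zero, div_eq_zero_iff, or_iff_left hu]

theorem theta_one {q : ℝ} (hq0 : 0 < q) (hq1 : q < 1) : theta q 1 = 0 := by
  rw [theta, qInf_step hq0 hq1 1]; simp

theorem differentiableAt_theta {q : ℝ} (hq0 : 0 < q) (hq1 : q < 1) {u : ℂ} (hu : u ≠ 0) :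
    DifferentiableAt ℂ (theta q) u := by
  have h := differentiable_qInf hq0 hq1
  unfold theta
  exact (h _).mul ((h _).comp u ((differentiableAt_const _).div differentiableAt_id hu))

/-! ### Theta functions on the punctured plane -/

/-- `f` is a theta function of degree `d` with multiplier `c`: it is holomorphic on `ℂ ∖ {0}` and
`f(qy) = c y^{-d} f(y)` there. The value at `0` is irrelevant. -/
structure IsTheta (q : ℝ) (d : ℤ) (c : ℂ) (f : ℂ → ℂ) : Prop where
  diff : ∀ y ≠ 0, DifferentiableAt ℂ f y
  quasi : ∀ y ≠ 0, f (q * y) = c * y ^ (-d) * f y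

theorem IsTheta.zpow_zero_of_zero {q : ℝ} (hq0 : 0 < q) {d : ℤ} {c : ℂ} {f : ℂ → ℂ}
    (hc : c ≠ 0) (hf : IsTheta q d c f) {y : ℂ} (hy : y ≠ 0) (h : f y = 0) (k : ℤ) :
    f (y * (q : ℂ) ^ k) = 0 := by
  have hq : (q : ℂ) ≠ 0 := by exact_mod_cast hq0.ne'
  have step : ∀ k : ℤ, f (y * (q : ℂ) ^ (k + 1)) =
      c * (y * (q : ℂ) ^ k) ^ (-d) * f (y * (q : ℂ) ^ k) := fun k => by
    have hk : y * (q : ℂ) ^ k ≠ 0 := mul_ne_zero hy (zpow_ne_zero _ hq)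
    rw [← hf.quasi _ hk, zpow_add₀ hq, zpow_one]
    ring_nf
  induction k using Int.induction_on with
  | zero => simpa using h
  | succ k ih => rw [step, ih, mul_zero]
  | pred k ih =>
    have := step (-(k : ℤ) - 1)
    rw [sub_add_cancel, ih] at this
    have hk : y * (q : ℂ) ^ (-(k : ℤ) - 1) ≠ 0 := mul_ne_zero hy (zpow_ne_zero _ hq)
    exact (mul_eq_zero.1 this.symm).resolve_left (mul_ne_zero hc (zpow_ne_zero _ hk))

theorem exists_hasDerivAt_theta {q : ℝ} (hq0 : 0 < q) (hq1 : q < 1) (k : ℤ) :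
    ∃ c : ℂ, c ≠ 0 ∧ HasDerivAt (theta q) c ((q : ℂ) ^ k) := by
  have hq : (q : ℂ) ≠ 0 := by exact_mod_cast hq0.ne'
  set w : ℂ := (q : ℂ) ^ k with hw
  have hw0 : w ≠ 0 := zpow_ne_zero _ hq
  have hd := differentiable_qInf hq0 hq1
  set g : ℂ → ℂ := fun u => qInf q (q * (u / w)) * qInf q (q / (u / w)) / thetaMult q (u / w) k
  have hqq : qInf q q ≠ 0 := qInf_ne_zero_of_norm_lt_one hq0 hq1
    (by rwa [Complex.norm_real, Real.norm_of_nonneg hq0.le])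
  have hgw : g w ≠ 0 := by
    simp only [g, div_self hw0, mul_one, div_one]
    exact div_ne_zero (mul_ne_zero hqq hqq) (thetaMult_ne_zero hq0 one_ne_zero k)
  have hgd : DifferentiableAt ℂ g w := by
    have h1 : DifferentiableAt ℂ (fun u : ℂ => u / w) w := by fun_prop
    have h2 : DifferentiableAt ℂ (fun u : ℂ => (q : ℂ) / (u / w)) w :=
      (differentiableAt_const _).div h1 (by simp [hw0])
    refine (((hd _).comp w (h1.const_mul _)).mul ((hd _).comp w h2)).div ?_
      (thetaMult_ne_zero hq0 (by simp [hw0]) k)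
    unfold thetaMult
    exact (h1.neg.zpow (Or.inl (by simp [hw0]))).mul_const _
  have heq : theta q =ᶠ[𝓝 w] fun u => (1 - u / w) * g u := by
    filter_upwards [isOpen_ne.mem_nhds hw0] with u hu
    have hu' : u / w ≠ 0 := div_ne_zero hu hw0
    have h := theta_mul_thetaMult hq0 hq1 hu' k
    rw [← hw, div_mul_cancel₀ _ hw0] at h
    rw [eq_div_of_mul_eq (thetaMult_ne_zero hq0 hu' k) h]
    simp only [g]
    rw [theta, qInf_step hq0 hq1 (u / w)]
    ring
  refine ⟨(-(1 / w)) * g w, mul_ne_zero (neg_ne_zero.2 (one_div_ne_zero hw0)) hgw, ?_⟩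
  have h1 : HasDerivAt (fun u : ℂ => 1 - u / w) (-(1 / w)) w :=
    ((hasDerivAt_id w).div_const w).const_sub 1
  have h2 := (h1.mul hgd.hasDerivAt).congr_of_eventuallyEq heq
  simpa [div_self hw0] using h2

/-- A theta function vanishing at `p` is divisible by `θ(y/p)`. -/
theorem IsTheta.exists_div {q : ℝ} (hq0 : 0 < q) (hq1 : q < 1) {d : ℤ} {c p : ℂ} {f : ℂ → ℂ}
    (hc : c ≠ 0) (hf : IsTheta q d c f) (hp : p ≠ 0) (h : f p = 0) :
    ∃ g, IsTheta q (d - 1) (-c / p) g ∧ ∀ y ≠ 0, f y = g y * theta q (y / p) := by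
  have hq : (q : ℂ) ≠ 0 := by exact_mod_cast hq0.ne'
  set D : ℂ → ℂ := fun y => theta q (y / p) with hD
  have hDd : ∀ y ≠ 0, DifferentiableAt ℂ D y := fun y hy =>
    DifferentiableAt.comp (g := theta q) (f := fun y => y / p) y
      (differentiableAt_theta hq0 hq1 (div_ne_zero hy hp)) (differentiableAt_id.div_const p)
  have hD0 : ∀ y ≠ 0, D y = 0 → f y = 0 ∧ deriv D y ≠ 0 := by
    intro y hy h0
    obtain ⟨k, hk⟩ := (theta_eq_zero_iff hq0 hq1 (div_ne_zero hy hp)).1 h0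
    have hyk : y = p * (q : ℂ) ^ k := by rw [← hk]; field_simp
    refine ⟨by rw [hyk]; exact hf.zpow_zero_of_zero hq0 hc hp h k, ?_⟩
    obtain ⟨c', hc', hd⟩ := exists_hasDerivAt_theta hq0 hq1 k
    rw [← hk] at hd
    have h3 : HasDerivAt D (c' * (1 / p)) y :=
      HasDerivAt.comp (h₂ := theta q) (h := fun y => y / p) y hd ((hasDerivAt_id y).div_const p)
    rw [h3.deriv]
    exact mul_ne_zero hc' (one_div_ne_zero hp)
  set g : ℂ → ℂ := fun y => if D y = 0 then deriv f y / deriv D y else f y / D y with hg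
  have hfg : ∀ y ≠ 0, f y = g y * D y := by
    intro y hy
    by_cases h0 : D y = 0
    · rw [h0, mul_zero, (hD0 y hy h0).1]
    · simp only [hg, if_neg h0]
      field_simp
  have hgd : ∀ y ≠ 0, DifferentiableAt ℂ g y := by
    intro y hy
    have hnear : ∀ᶠ z in 𝓝 y, z ≠ 0 := isOpen_ne.mem_nhds hy
    by_cases h0 : D y = 0
    · obtain ⟨hf0, hD'⟩ := hD0 y hy h0
      have hne : ∀ᶠ z in 𝓝[≠] y, D z ≠ 0 := by
        simpa using (hDd y hy).hasDerivAt.eventually_ne (c := 0) hD'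
      have heq : g =ᶠ[𝓝 y] fun z => dslope f y z / dslope D y z := by
        have hne2 := eventually_nhdsWithin_iff.1 hne
        filter_upwards [hne2] with z hz
        by_cases hzy : z = y
        · subst hzy
          simp only [hg, if_pos h0, dslope_same]
        · have hDz := hz hzy
          simp only [hg, if_neg hDz]
          rw [dslope_of_ne _ hzy, dslope_of_ne _ hzy, slope_def_field, slope_def_field, hf0, h0,
            sub_zero, sub_zero]
          have : z - y ≠ 0 := sub_ne_zero.2 hzy
          field_simp
      have hs : ({0}ᶜ : Set ℂ) ∈ 𝓝 y := isOpen_ne.mem_nhds hy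
      have d1 : DifferentiableAt ℂ (dslope f y) y :=
        ((Complex.differentiableOn_dslope hs).2 fun z hz =>
          (hf.diff z hz).differentiableWithinAt).differentiableAt hs
      have d2 : DifferentiableAt ℂ (dslope D y) y :=
        ((Complex.differentiableOn_dslope hs).2 fun z hz =>
          (hDd z hz).differentiableWithinAt).differentiableAt hs
      exact (d1.div d2 (by rwa [dslope_same])).congr_of_eventuallyEq heq
    · have hne : ∀ᶠ z in 𝓝 y, D z ≠ 0 := (hDd y hy).continuousAt.eventually_ne h0
      have heq : g =ᶠ[𝓝 y] fun z => f z / D z := by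
        filter_upwards [hne] with z hz
        simp only [hg, if_neg hz]
      exact ((hf.diff y hy).div (hDd y hy) h0).congr_of_eventuallyEq heq
  refine ⟨g, ⟨hgd, ?_⟩, hfg⟩
  have hgen : ∀ y ≠ 0, D y ≠ 0 → g (q * y) = -c / p * y ^ (-(d - 1)) * g y := by
    intro y hy h0
    have h1 : D (q * y) = -(D y / (y / p)) := by
      simp only [hD, mul_div_assoc]
      exact theta_q_mul hq0 hq1 (div_ne_zero hy hp)
    have h2 := hf.quasi y hy
    rw [hfg _ (mul_ne_zero hq hy), hfg y hy, h1] at h2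
    have h3 : y ^ (-(d - 1)) = y ^ (-d) * y := by
      rw [neg_sub, sub_eq_add_neg, add_comm, zpow_add₀ hy, zpow_one]
    rw [h3]
    field_simp at h2 ⊢
    linear_combination -h2
  intro y hy
  by_cases h0 : D y = 0
  · have hD' := (hD0 y hy h0).2
    have hne : ∀ᶠ z in 𝓝[≠] y, D z ≠ 0 := by
      simpa using (hDd y hy).hasDerivAt.eventually_ne (c := 0) hD'
    have hy' : ∀ᶠ z in 𝓝[≠] y, z ≠ 0 := nhdsWithin_le_nhds (isOpen_ne.mem_nhds hy)
    have c1 : Tendsto (fun z : ℂ => g (q * z)) (𝓝[≠] y) (𝓝 (g (q * y))) := by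
      have : ContinuousAt (fun z : ℂ => g (q * z)) y :=
        ContinuousAt.comp (hgd _ (mul_ne_zero hq hy)).continuousAt (by fun_prop)
      exact this.tendsto.mono_left nhdsWithin_le_nhds
    have c2 : Tendsto (fun z : ℂ => -c / p * z ^ (-(d - 1)) * g z) (𝓝[≠] y)
        (𝓝 (-c / p * y ^ (-(d - 1)) * g y)) := by
      have : ContinuousAt (fun z : ℂ => -c / p * z ^ (-(d - 1)) * g z) y :=
        (continuousAt_const.mul (continuousAt_zpow₀ _ _ (Or.inl hy))).mul (hgd y hy).continuousAt
      exact this.tendsto.mono_left nhdsWithin_le_nhds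
    refine tendsto_nhds_unique (c1.congr' ?_) c2
    filter_upwards [hne, hy'] with z hz hz0 using hgen z hz0 hz
  · exact hgen y hy h0

/-- A holomorphic function on `ℂ ∖ {0}` with `f(qy) = c f(y)` vanishes unless `c` is a power of
`q`: after division by a suitable real power of `|y|` it is bounded, so Liouville's theorem applied
to `z ↦ f(e^z)` shows that it is a monomial. -/
theorem IsTheta.eq_zero_of_degree_zero {q : ℝ} (hq0 : 0 < q) (hq1 : q < 1) {c : ℂ} {f : ℂ → ℂ}
    (hf : IsTheta q 0 c f) (hc0 : c ≠ 0) (hc : ∀ k : ℤ, c ≠ (q : ℂ) ^ k) {y : ℂ} (hy : y ≠ 0) :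
    f y = 0 := by
  have hq : (q : ℂ) ≠ 0 := by exact_mod_cast hq0.ne'
  have hlq : Real.log q ≠ 0 := (Real.log_neg hq0 hq1).ne
  set μ : ℝ := Real.log ‖c‖ / Real.log q with hμ
  have hqμ : q ^ μ = ‖c‖ := by
    rw [Real.rpow_def_of_pos hq0, hμ, mul_div_cancel₀ _ hlq, Real.exp_log (norm_pos_iff.2 hc0)]
  set φ : ℂ → ℝ := fun y => ‖f y‖ * ‖y‖ ^ (-μ) with hφ
  have hφq : ∀ y ≠ 0, φ (q * y) = φ y := by
    intro y hy
    have h1 := hf.quasi y hy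
    simp only [neg_zero, zpow_zero, mul_one] at h1
    simp only [hφ]
    rw [h1, norm_mul, norm_mul, Complex.norm_real, Real.norm_of_nonneg hq0.le,
      Real.mul_rpow hq0.le (norm_nonneg _), Real.rpow_neg hq0.le, hqμ]
    have : ‖c‖ ≠ 0 := norm_ne_zero_iff.2 hc0
    field_simp
  have hφz : ∀ (k : ℤ) (y : ℂ), y ≠ 0 → φ (y * (q : ℂ) ^ k) = φ y := by
    have step : ∀ (k : ℤ) (y : ℂ), y ≠ 0 → φ (y * (q : ℂ) ^ (k + 1)) = φ (y * (q : ℂ) ^ k) := by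
      intro k y hy
      have hk : y * (q : ℂ) ^ k ≠ 0 := mul_ne_zero hy (zpow_ne_zero _ hq)
      rw [← hφq _ hk, zpow_add₀ hq, zpow_one]
      ring_nf
    intro k y hy
    induction k using Int.induction_on with
    | zero => simp
    | succ k ih => rw [step _ _ hy, ih]
    | pred k ih => rw [← ih, ← step _ _ hy, sub_add_cancel]
  set K : Set ℂ := Metric.closedBall 0 1 \ Metric.ball 0 q with hK
  have hKc : IsCompact K := (isCompact_closedBall _ _).diff Metric.isOpen_ball
  have hK0 : ∀ y ∈ K, y ≠ 0 := by
    rintro y hy rfl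
    exact hy.2 (by simpa using hq0)
  have hφc : ContinuousOn φ K := by
    intro y hy
    have h0 := hK0 y hy
    refine ContinuousAt.continuousWithinAt ?_
    exact (hf.diff y h0).continuousAt.norm.mul
      (continuousAt_id.norm.rpow_const (Or.inl (norm_ne_zero_iff.2 h0)))
  obtain ⟨M, hM⟩ := hKc.exists_bound_of_continuousOn hφc
  have hbound : ∀ y ≠ 0, φ y ≤ M := by
    intro y hy
    obtain ⟨k, hk1, hk2⟩ := exists_mem_Ico_zpow (norm_pos_iff.2 hy)
      ((one_lt_inv₀ hq0).2 hq1)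
    rw [← hφz (k + 1) y hy]
    refine (le_abs_self _).trans (hM _ ⟨?_, ?_⟩)
    · rw [mem_closedBall_zero_iff, norm_mul, norm_zpow, Complex.norm_real,
        Real.norm_of_nonneg hq0.le]
      rw [inv_zpow] at hk2
      have hpos : 0 < q ^ (k + 1) := zpow_pos hq0 _
      calc ‖y‖ * q ^ (k + 1) ≤ (q ^ (k + 1))⁻¹ * q ^ (k + 1) := by gcongr
        _ = 1 := inv_mul_cancel₀ hpos.ne'
    · rw [mem_ball_zero_iff, not_lt, norm_mul, norm_zpow, Complex.norm_real,
        Real.norm_of_nonneg hq0.le]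
      rw [inv_zpow] at hk1
      have hpos : 0 < q ^ (k + 1) := zpow_pos hq0 _
      calc q = (q ^ k)⁻¹ * q ^ (k + 1) := by
            rw [zpow_add₀ hq0.ne', zpow_one, ← mul_assoc, inv_mul_cancel₀ (zpow_pos hq0 k).ne',
              one_mul]
        _ ≤ _ := by gcongr
  set B : ℂ → ℂ := fun z => f (Complex.exp z) * Complex.exp (-μ * z) with hB
  have hBd : Differentiable ℂ B := by
    intro z
    exact ((hf.diff _ (Complex.exp_ne_zero z)).comp z Complex.differentiable_exp.differentiableAt).mul
      (by fun_prop)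
  have hBb : Bornology.IsBounded (Set.range B) := by
    refine isBounded_iff_forall_norm_le.2 ⟨M, ?_⟩
    rintro _ ⟨z, rfl⟩
    refine le_trans (le_of_eq ?_) (hbound (Complex.exp z) (Complex.exp_ne_zero z))
    simp only [hB, hφ]
    rw [norm_mul, Complex.norm_exp, Complex.norm_exp, ← Real.exp_mul]
    congr 2
    simp [mul_comm]
  have hconst := fun z w => hBd.apply_eq_apply_of_bounded hBb z w
  by_contra hne
  have hB0 : B 0 ≠ 0 := by
    rw [hconst 0 (Complex.log y)]
    simp only [hB, Complex.exp_log hy]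
    exact mul_ne_zero hne (Complex.exp_ne_zero _)
  have hf1 : f 1 ≠ 0 := by simpa [hB] using hB0
  -- Going once around the origin forces the exponent to be an integer.
  have h1 : Complex.exp (-μ * (2 * Real.pi * Complex.I)) = 1 := by
    have := hconst (2 * Real.pi * Complex.I) 0
    simp only [hB, Complex.exp_two_pi_mul_I, Complex.exp_zero, mul_zero, mul_one] at this
    exact mul_left_cancel₀ hf1 (by rw [this, mul_one])
  obtain ⟨m, hm⟩ := Complex.exp_eq_one_iff.1 h1
  have hμm : (μ : ℂ) = ((-m : ℤ) : ℂ) := by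
    have h2 := mul_right_cancel₀ Complex.two_pi_I_ne_zero hm
    push_cast
    rw [← h2, neg_neg]
  have h2 := hconst (Real.log q) 0
  have h3 := hf.quasi 1 one_ne_zero
  simp only [hB, Complex.exp_zero, mul_zero, mul_one] at h2
  rw [← Complex.ofReal_exp, Real.exp_log hq0] at h2
  simp only [neg_zero, zpow_zero, mul_one] at h3
  rw [h3] at h2
  have h4 : Complex.exp (-μ * Real.log q) = ((q : ℂ) ^ (-m : ℤ))⁻¹ := by
    rw [hμm, neg_mul, Complex.exp_neg, Complex.exp_int_mul, ← Complex.ofReal_exp, Real.exp_log hq0]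
  rw [h4] at h2
  refine hc (-m) ?_
  have hqm : (q : ℂ) ^ (-m) ≠ 0 := zpow_ne_zero _ hq
  field_simp at h2
  exact h2

theorem zpow_ne_of_theta_ne_zero {q : ℝ} (hq0 : 0 < q) (hq1 : q < 1) {u : ℂ} (hu : u ≠ 0)
    (h : theta q u ≠ 0) (k : ℤ) : u ≠ (q : ℂ) ^ k := fun hk =>
  h ((theta_eq_zero_iff hq0 hq1 hu).2 ⟨k, hk⟩)

/-- A theta function of degree two with two independent zeros `u`, `v` vanishes unless `c/(uv)` is
a power of `q`. -/
theorem IsTheta.eq_zero_of_degree_two {q : ℝ} (hq0 : 0 < q) (hq1 : q < 1) {c u v : ℂ} {f : ℂ → ℂ}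
    (hf : IsTheta q 2 c f) (hc : c ≠ 0) (hu : u ≠ 0) (hv : v ≠ 0) (huv : theta q (u / v) ≠ 0)
    (hcuv : theta q (c / (u * v)) ≠ 0) (fu : f u = 0) (fv : f v = 0) {y : ℂ} (hy : y ≠ 0) :
    f y = 0 := by
  obtain ⟨g, hg, hfg⟩ := hf.exists_div hq0 hq1 hc hv fv
  have hcv : -c / v ≠ 0 := div_ne_zero (neg_ne_zero.2 hc) hv
  have gu : g u = 0 := by
    have := hfg u hu
    rw [fu] at this
    exact (mul_eq_zero.1 this.symm).resolve_right huv
  obtain ⟨k, hk, hgk⟩ := hg.exists_div hq0 hq1 hcv hu gu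
  have he : -(-c / v) / u = c / (u * v) := by field_simp
  rw [he] at hk
  have := IsTheta.eq_zero_of_degree_zero hq0 hq1 hk (div_ne_zero hc (mul_ne_zero hu hv))
    (zpow_ne_of_theta_ne_zero hq0 hq1 (div_ne_zero hc (mul_ne_zero hu hv)) hcuv) hy
  rw [hfg y hy, hgk y hy, this, zero_mul, zero_mul]

theorem IsTheta.sub {q : ℝ} {d : ℤ} {c : ℂ} {f g : ℂ → ℂ} (hf : IsTheta q d c f)
    (hg : IsTheta q d c g) : IsTheta q d c fun y => f y - g y where
  diff y hy := (hf.diff y hy).sub (hg.diff y hy)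
  quasi y hy := by rw [hf.quasi y hy, hg.quasi y hy]; ring

theorem IsTheta.const_mul {q : ℝ} {d : ℤ} {c : ℂ} {f : ℂ → ℂ} (hf : IsTheta q d c f) (r : ℂ) :
    IsTheta q d c fun y => r * f y where
  diff y hy := (hf.diff y hy).const_mul r
  quasi y hy := by rw [hf.quasi y hy]; ring

/-- The theta function `θ(y/v) θ(cvy)/y` of degree two, with a zero at `v`. -/
theorem isTheta_two {q : ℝ} (hq0 : 0 < q) (hq1 : q < 1) {c v : ℂ} (hc : c ≠ 0) (hv : v ≠ 0) :
    IsTheta q 2 (1 / (q * c)) fun y => theta q (y / v) * theta q (c * v * y) / y := by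
  have hq : (q : ℂ) ≠ 0 := by exact_mod_cast hq0.ne'
  constructor
  · intro y hy
    have h1 : DifferentiableAt ℂ (fun y : ℂ => theta q (y / v)) y :=
      DifferentiableAt.comp (g := theta q) (f := fun y => y / v) y
        (differentiableAt_theta hq0 hq1 (div_ne_zero hy hv)) (differentiableAt_id.div_const v)
    have h2 : DifferentiableAt ℂ (fun y : ℂ => theta q (c * v * y)) y :=
      DifferentiableAt.comp (g := theta q) (f := fun y => c * v * y) y
        (differentiableAt_theta hq0 hq1 (mul_ne_zero (mul_ne_zero hc hv) hy))
        (differentiableAt_id.const_mul (c * v))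
    exact (h1.mul h2).div differentiableAt_id hy
  · intro y hy
    have h1 := theta_q_mul hq0 hq1 (div_ne_zero hy hv)
    have h2 := theta_q_mul hq0 hq1 (mul_ne_zero (mul_ne_zero hc hv) hy)
    rw [mul_div_assoc (q : ℂ) y v, h1, show c * v * (q * y) = q * (c * v * y) by ring, h2]
    rw [show y ^ (-2 : ℤ) = (y ^ 2)⁻¹ by rw [zpow_neg]; norm_cast]
    field_simp

/-- Interpolation in the two-dimensional space of theta functions of degree two. -/
theorem IsTheta.interpolation {q : ℝ} (hq0 : 0 < q) (hq1 : q < 1) {c u v : ℂ} {f : ℂ → ℂ}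
    (hc : c ≠ 0) (hf : IsTheta q 2 (1 / (q * c)) f) (hu : u ≠ 0) (hv : v ≠ 0)
    (huv : theta q (u / v) ≠ 0) (hcuv : theta q (c * u * v) ≠ 0) {y : ℂ} (hy : y ≠ 0) :
    f y = u / y * f u * (theta q (y / v) * theta q (c * v * y)) /
          (theta q (u / v) * theta q (c * u * v)) +
        v / y * f v * (theta q (y / u) * theta q (c * u * y)) /
          (theta q (v / u) * theta q (c * u * v)) := by
  have hq : (q : ℂ) ≠ 0 := by exact_mod_cast hq0.ne'
  have hvu : theta q (v / u) ≠ 0 := by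
    rw [← inv_div, Ne, theta_inv_eq_zero_iff hq0 hq1 (div_ne_zero hu hv)]
    exact huv
  have hcuv' : theta q (c * v * u) ≠ 0 := by rwa [mul_right_comm]
  have hqc : 1 / (q * c) ≠ 0 := one_div_ne_zero (mul_ne_zero hq hc)
  set e : ℂ → ℂ → ℂ := fun v y => theta q (y / v) * theta q (c * v * y) / y with he
  have h := (hf.sub ((isTheta_two hq0 hq1 hc hv).const_mul (f u / e v u))).sub
    ((isTheta_two hq0 hq1 hc hu).const_mul (f v / e u v))
  have hevu : e v u ≠ 0 := div_ne_zero (mul_ne_zero huv hcuv') hu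
  have heuv : e u v ≠ 0 := div_ne_zero (mul_ne_zero hvu hcuv) hv
  have hee : ∀ w ≠ 0, e w w = 0 := fun w hw => by
    simp only [he, div_self hw, theta_one hq0 hq1, zero_mul, zero_div]
  have hcuv2 : theta q (1 / (q * c) / (u * v)) ≠ 0 := by
    have h0 : c * u * v ≠ 0 := mul_ne_zero (mul_ne_zero hc hu) hv
    have : 1 / (q * c) / (u * v) = (q * (c * u * v))⁻¹ := by field_simp
    rw [this, Ne, theta_inv_eq_zero_iff hq0 hq1 (mul_ne_zero hq h0), theta_q_mul hq0 hq1 h0,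
      neg_eq_zero, div_eq_zero_iff, or_iff_left h0]
    exact hcuv
  have key := h.eq_zero_of_degree_two hq0 hq1 hqc hu hv huv hcuv2
    (by change f u - f u / e v u * e v u - f v / e u v * e u u = 0
        rw [hee u hu, div_mul_cancel₀ _ hevu]; ring)
    (by change f v - f u / e v u * e v v - f v / e u v * e u v = 0
        rw [hee v hv, div_mul_cancel₀ _ heuv]; ring) hy
  have key2 : f y = f u / e v u * e v y + f v / e u v * e u y := by
    have : f y - f u / e v u * e v y - f v / e u v * e u y = 0 := key
    linear_combination this
  rw [key2]
  simp only [he]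
  rw [mul_right_comm c v u]
  field_simp

/-- Theta functions of degree two with multiplier `1/(qc)` are even: they are invariant under
`y ↦ 1/(cy)`. -/
theorem IsTheta.even {q : ℝ} (hq0 : 0 < q) (hq1 : q < 1) {c : ℂ} {f : ℂ → ℂ}
    (hc : c ≠ 0) (hf : IsTheta q 2 (1 / (q * c)) f) {y : ℂ} (hy : y ≠ 0) :
    f (1 / (c * y)) = f y := by
  have hq : (q : ℂ) ≠ 0 := by exact_mod_cast hq0.ne'
  have hqc : 1 / (q * c) ≠ 0 := one_div_ne_zero (mul_ne_zero hq hc)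
  have hg : IsTheta q 2 (1 / (q * c)) fun y => f (1 / (c * y)) := by
    constructor
    · intro y hy
      have h1 : DifferentiableAt ℂ (fun y : ℂ => 1 / (c * y)) y :=
        (differentiableAt_const _).div (differentiableAt_id.const_mul c) (mul_ne_zero hc hy)
      exact (hf.diff _ (one_div_ne_zero (mul_ne_zero hc hy))).comp y h1
    · intro y hy
      have h0 : 1 / (c * (q * y)) ≠ 0 := one_div_ne_zero (mul_ne_zero hc (mul_ne_zero hq hy))
      have h1 := hf.quasi _ h0
      have h2 : (q : ℂ) * (1 / (c * (q * y))) = 1 / (c * y) := by field_simp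
      rw [h2] at h1
      rw [h1]
      rw [show (1 / (c * (q * y))) ^ (-2 : ℤ) = (c * (q * y)) ^ 2 by
          rw [one_div, inv_zpow, zpow_neg, inv_inv]; norm_cast,
        show y ^ (-2 : ℤ) = (y ^ 2)⁻¹ by rw [zpow_neg]; norm_cast]
      field_simp
  -- The difference vanishes at the two fixed points `±c^{-1/2}`, whose quotient is `-1`.
  obtain ⟨r, hr⟩ := IsAlgClosed.exists_pow_nat_eq (1 / c) zero_lt_two
  have hr0 : r ≠ 0 := by
    rintro rfl
    simp at hr
    exact hc hr.symm
  have hfix : 1 / (c * r) = r := by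
    field_simp
    field_simp at hr
    rw [mul_comm, hr]
  have hfix2 : 1 / (c * -r) = -r := by
    rw [mul_neg, div_neg, hfix]
  have hneg : theta q (-1) ≠ 0 := by
    rw [Ne, theta_eq_zero_iff hq0 hq1 (by norm_num)]
    rintro ⟨k, hk⟩
    have h1 : ((-1 : ℝ) : ℂ) = ((q ^ k : ℝ) : ℂ) := by push_cast; exact hk
    have h2 := Complex.ofReal_injective h1
    have := zpow_pos hq0 k
    linarith
  have key := (hg.sub hf).eq_zero_of_degree_two hq0 hq1 hqc hr0 (neg_ne_zero.2 hr0)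
    (by rw [div_neg, div_self hr0]; exact hneg)
    (by
      have : 1 / (q * c) / (r * -r) = ((q : ℂ) * (-1))⁻¹ := by
        rw [show r * -r = -(r ^ 2) by ring, hr]; field_simp
      rw [this, Ne, theta_inv_eq_zero_iff hq0 hq1 (by simp [hq]), theta_q_mul hq0 hq1 (by simp)]
      simpa using hneg)
    (by simp only [hfix, sub_self]) (by simp only [hfix2, sub_self]) hy
  exact sub_eq_zero.1 key

/-! ### The regularised sum -/

/-- The factor of the summand that depends on the single variable `z = x q^k`. Each pole
`1/(b_l z)_∞` is traded for `thetaMult (b_l x) k * (q/(b_l z))_∞`, which is the same up to the factor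
`θ(b_l x)`, so that the result is holomorphic in `x ≠ 0`. The power `c ^ k` collects the
quasi-periodicity of the powers of `z`; `c` stands for `q t^{n-1}`, or for `q^s t^{n-1}` in the dual
integral. -/
def oneBody (q : ℝ) (a b : Fin 2 → ℂ) (c x : ℂ) (k : ℤ) : ℂ :=
  c ^ k * ∏ l, (qInf q (q * (a l)⁻¹ * (x * (q : ℂ) ^ k)) *
    (thetaMult q (b l * x) k * qInf q (q / (b l * (x * (q : ℂ) ^ k)))))

/-- The interaction of two variables `x q^k` and `y q^l`, antisymmetric under their exchange. -/
def twoBody (q : ℝ) (t x : ℂ) (k : ℤ) (y : ℂ) (l : ℤ) : ℂ :=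
  x * (1 - y / x * (q : ℂ) ^ (l - k)) * thetaMult q (y / x) (l - k) *
    (qInf q (q * t⁻¹ * (y / x * (q : ℂ) ^ (l - k))) *
      qInf q (q / (t * (y / x * (q : ℂ) ^ (l - k)))))

/-- The summand of the regularised sum at the lattice point `x q^ν`. -/
def term {n : ℕ} (q : ℝ) (a b : Fin 2 → ℂ) (t : ℂ) (x : Fin n → ℂ) (ν : Fin n → ℤ) : ℂ :=
  (∏ i, oneBody q a b (q * t ^ (n - 1)) (x i) (ν i)) *
    ∏ i, ∏ j ∈ Ioi i, twoBody q t (x i) (ν i) (x j) (ν j)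

/-- The regularised sum; as a function of `x` it is holomorphic and antisymmetric. -/
def altSum {n : ℕ} (q : ℝ) (a b : Fin 2 → ℂ) (t : ℂ) (x : Fin n → ℂ) : ℂ :=
  ∑' ν, term q a b t x ν

/-- The theta analogue `∏_{i<j} x_i θ(x_j/x_i)` of the Vandermonde product. -/
def thetaVand {n : ℕ} (q : ℝ) (x : Fin n → ℂ) : ℂ :=
  ∏ i, ∏ j ∈ Ioi i, x i * theta q (x j / x i)

/-- The regularised Jackson integral, up to the factor `(1-q)^n`. -/
def symSum {n : ℕ} (q : ℝ) (a b : Fin 2 → ℂ) (t : ℂ) (x : Fin n → ℂ) : ℂ :=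
  altSum q a b t x / thetaVand q x

/-! ### Bounds -/

theorem norm_q_zpow {q : ℝ} (hq0 : 0 < q) (k : ℤ) : ‖(q : ℂ) ^ k‖ = q ^ k := by
  rw [norm_zpow, Complex.norm_real, Real.norm_of_nonneg hq0.le]

theorem qInf_mul_zpow_neg {q : ℝ} (hq0 : 0 < q) (hq1 : q < 1) {u : ℂ} (hu : u ≠ 0) (m : ℕ) :
    qInf q (u * (q : ℂ) ^ (-(m : ℤ))) * thetaMult q u (-(m : ℤ)) =
      (∏ i ∈ range m, (1 - (q : ℂ) ^ i * (q / u))) * qInf q u := by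
  have hq : (q : ℂ) ≠ 0 := by exact_mod_cast hq0.ne'
  induction m with
  | zero => simp
  | succ m ih =>
    have h1 := thetaMult_succ hq0 hu (-((m + 1 : ℕ) : ℤ))
    have h2 := qInf_step hq0 hq1 (u * (q : ℂ) ^ (-((m + 1 : ℕ) : ℤ)))
    have e1 : -((m + 1 : ℕ) : ℤ) + 1 = -(m : ℤ) := by push_cast; ring
    have e2 : (q : ℂ) * (u * (q : ℂ) ^ (-((m + 1 : ℕ) : ℤ))) = u * (q : ℂ) ^ (-(m : ℤ)) := by
      rw [← e1, zpow_add₀ hq, zpow_one]; ring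
    rw [e1] at h1
    rw [e2] at h2
    rw [h2, prod_range_succ, mul_right_comm _ (1 - _), ← ih, h1]
    have e3 : (q : ℂ) ^ m * (q / u) = (u * (q : ℂ) ^ (-((m + 1 : ℕ) : ℤ)))⁻¹ := by
      rw [zpow_neg, zpow_natCast, pow_succ]
      field_simp
    rw [e3]
    have e4 : u * (q : ℂ) ^ (-((m + 1 : ℕ) : ℤ)) ≠ 0 := mul_ne_zero hu (zpow_ne_zero _ hq)
    field_simp
    ring

/-- The decay profile of the regularised summand: `r` to the right, `s` to the left. -/
def profile (r s : ℝ) (k : ℤ) : ℝ := if 0 ≤ k then r ^ k else s ^ (-k)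

/-- The pair of factors belonging to a numerator `(vz)_∞` and a denominator `(uz)_∞` is bounded to
the right and grows at most like `(‖v‖/‖u‖)^{-k}` to the left, uniformly for `u`, `v` in compact
subsets of the punctured plane. -/
theorem norm_pair_le {q : ℝ} (hq0 : 0 < q) (hq1 : q < 1) {R : ℝ} {u v : ℂ} (hu : u ≠ 0)
    (hv : v ≠ 0) (h1 : ‖u‖ ≤ R) (h2 : ‖v‖ ≤ R) (h3 : ‖q / u‖ ≤ R) (h4 : ‖q / v‖ ≤ R) (k : ℤ) :
    ‖qInf q (v * (q : ℂ) ^ k) * (thetaMult q u k * qInf q (q / (u * (q : ℂ) ^ k)))‖ ≤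
      Real.exp (R / (1 - q)) ^ 3 * profile 1 (‖v‖ / ‖u‖) k := by
  have hq : (q : ℂ) ≠ 0 := by exact_mod_cast hq0.ne'
  have h1q : 0 < 1 - q := by linarith
  have hE : ∀ w : ℂ, ‖w‖ ≤ R → ‖qInf q w‖ ≤ Real.exp (R / (1 - q)) := fun w hw =>
    (norm_qInf_le hq0 hq1 w).trans (Real.exp_le_exp.2 (by gcongr))
  have hP : ∀ (w : ℂ) (m : ℕ), ‖w‖ ≤ R →
      ‖∏ i ∈ range m, (1 - (q : ℂ) ^ i * w)‖ ≤ Real.exp (R / (1 - q)) := fun w m hw =>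
    (norm_prod_one_sub_le_exp hq0 hq1 w m).trans (Real.exp_le_exp.2 (by gcongr))
  set E := Real.exp (R / (1 - q)) with hEdef
  have hE0 : 0 < E := Real.exp_pos _
  have hR0 : 0 ≤ R := (norm_nonneg _).trans h1
  have hE1 : 1 ≤ E := Real.one_le_exp (by positivity)
  rcases le_or_gt 0 k with hk | hk
  · obtain ⟨m, rfl⟩ := Int.eq_ofNat_of_zero_le hk
    -- The factors belonging to `u` combine to a finite product.
    have e1 : thetaMult q u m * qInf q (q / (u * (q : ℂ) ^ (m : ℤ))) =
        (∏ i ∈ range m, (1 - (q : ℂ) ^ i * u)) * qInf q (q / u) := by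
      induction m with
      | zero => simp
      | succ m ih =>
        have h1 := thetaMult_succ hq0 hu (m : ℤ)
        have ih := ih (by positivity)
        have hm : u * (q : ℂ) ^ (m : ℤ) ≠ 0 := mul_ne_zero hu (zpow_ne_zero _ hq)
        have e2 : (q : ℂ) / (u * (q : ℂ) ^ ((m + 1 : ℕ) : ℤ)) = (u * (q : ℂ) ^ (m : ℤ))⁻¹ := by
          push_cast
          rw [zpow_add₀ hq, zpow_one]
          field_simp
        have e3 : (q : ℂ) * (u * (q : ℂ) ^ (m : ℤ))⁻¹ = q / (u * (q : ℂ) ^ (m : ℤ)) := by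
          rw [div_eq_mul_inv]
        rw [e2, qInf_step hq0 hq1, e3, prod_range_succ, mul_right_comm _ (1 - _), ← ih]
        push_cast
        rw [h1, zpow_natCast]
        rw [zpow_natCast] at hm
        field_simp
        ring
    rw [e1, norm_mul, norm_mul, profile, if_pos hk, one_zpow, mul_one]
    have e2 : ‖qInf q (v * (q : ℂ) ^ (m : ℤ))‖ ≤ E := by
      refine hE _ ?_
      rw [norm_mul, norm_q_zpow hq0, zpow_natCast]
      exact (mul_le_of_le_one_right (norm_nonneg _) (pow_le_one₀ hq0.le hq1.le)).trans h2
    calc _ ≤ E * (E * E) := by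
          gcongr
          · exact hP u m h1
          · exact hE _ h3
      _ = E ^ 3 := by ring
  · obtain ⟨m, rfl⟩ : ∃ m : ℕ, k = -(m : ℤ) := ⟨k.natAbs, by omega⟩
    have hprof : profile 1 (‖v‖ / ‖u‖) (-(m : ℤ)) = (‖v‖ / ‖u‖) ^ m := by
      rw [profile, if_neg (not_le.2 hk), neg_neg, zpow_natCast]
    have h5 := qInf_mul_zpow_neg hq0 hq1 hv m
    have h6 : thetaMult q v (-(m : ℤ)) = (v / u) ^ (-(m : ℤ)) * thetaMult q u (-(m : ℤ)) := by
      rw [← thetaMult_mul, div_mul_cancel₀ _ hu]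
    have h7 : qInf q (v * (q : ℂ) ^ (-(m : ℤ))) * thetaMult q u (-(m : ℤ)) =
        (v / u) ^ m * ((∏ i ∈ range m, (1 - (q : ℂ) ^ i * (q / v))) * qInf q v) := by
      rw [← h5, h6, zpow_neg (v / u), zpow_natCast (v / u)]
      have : (v / u) ^ m ≠ 0 := pow_ne_zero _ (div_ne_zero hv hu)
      field_simp
    rw [← mul_assoc, h7, hprof, norm_mul, norm_mul, norm_mul, norm_pow, norm_div]
    have e2 : ‖qInf q (q / (u * (q : ℂ) ^ (-(m : ℤ))))‖ ≤ E := by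
      refine hE _ ?_
      rw [zpow_neg, zpow_natCast, div_mul_eq_div_div, div_inv_eq_mul, norm_mul, norm_pow,
        Complex.norm_real, Real.norm_of_nonneg hq0.le]
      exact (mul_le_of_le_one_right (norm_nonneg _) (pow_le_one₀ hq0.le hq1.le)).trans h3
    calc _ ≤ (‖v‖ / ‖u‖) ^ m * (E * E) * E := by
          gcongr
          · exact hP _ m h4
          · exact hE _ h2
      _ = _ := by ring

theorem profile_nonneg {r s : ℝ} (hr : 0 ≤ r) (hs : 0 ≤ s) (k : ℤ) : 0 ≤ profile r s k := by
  unfold profile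
  split_ifs <;> positivity

theorem profile_mul (r s r' s' : ℝ) (k : ℤ) :
    profile r s k * profile r' s' k = profile (r * r') (s * s') k := by
  unfold profile
  split_ifs <;> rw [mul_zpow]

theorem profile_inv (r : ℝ) (k : ℤ) : profile r r⁻¹ k = r ^ k := by
  unfold profile
  split_ifs
  · rfl
  · rw [inv_zpow, zpow_neg, inv_inv]

theorem profile_mono {r s r' s' : ℝ} (hr : 0 ≤ r) (hs : 0 ≤ s) (hrr : r ≤ r') (hss : s ≤ s')
    (k : ℤ) : profile r s k ≤ profile r' s' k := by
  unfold profile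
  split_ifs with h
  · exact zpow_le_zpow_left₀ h hr hrr
  · exact zpow_le_zpow_left₀ (by omega) hs hss

theorem profile_self (r : ℝ) (k : ℤ) : profile r r k = r ^ k.natAbs := by
  unfold profile
  split_ifs with h
  · rw [← zpow_natCast, Int.natAbs_of_nonneg h]
  · rw [← zpow_natCast, ← Int.natAbs_neg, Int.natAbs_of_nonneg (by omega)]

theorem summable_profile {r s : ℝ} (hr0 : 0 ≤ r) (hr : r < 1) (hs0 : 0 ≤ s) (hs : s < 1) :
    Summable (profile r s) := by
  refine Summable.of_nat_of_neg ?_ ?_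
  · refine (summable_geometric_of_lt_one hr0 hr).congr fun k => ?_
    simp [profile]
  · refine Summable.of_nonneg_of_le (fun k => profile_nonneg hr0 hs0 _) (fun k => ?_)
      ((summable_geometric_of_lt_one hs0 hs))
    rcases Nat.eq_zero_or_pos k with rfl | hk
    · simp [profile]
    · rw [profile, if_neg (by omega), neg_neg, zpow_natCast]

theorem summable_prod_fin {n : ℕ} {f : ℤ → ℝ} (hf0 : ∀ k, 0 ≤ f k) (hf : Summable f) :
    Summable fun ν : Fin n → ℤ => ∏ i, f (ν i) := by
  induction n with
  | zero => exact Summable.of_finite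
  | succ n ih =>
    have h := hf.mul_of_nonneg ih hf0 fun ν => prod_nonneg fun i _ => hf0 _
    rw [← (Fin.consEquiv fun _ : Fin (n + 1) => ℤ).summable_iff]
    refine h.congr fun p => ?_
    simp [Fin.prod_univ_succ, Fin.consEquiv]

theorem prod_pairs {n : ℕ} {M : Type*} [CommMonoid M] (f : Fin n → M) :
    ∏ i, ∏ j ∈ Ioi i, f i * f j = ∏ i, f i ^ (n - 1) := by
  have h : ∏ i, ∏ j ∈ Ioi i, f j = ∏ j, ∏ i ∈ Iio j, f j :=
    Finset.prod_comm' (by simp)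
  simp only [prod_mul_distrib]
  rw [h, ← prod_mul_distrib]
  refine prod_congr rfl fun i _ => ?_
  rw [prod_const, prod_const, ← pow_add, Fin.card_Ioi, Fin.card_Iio]
  congr 1
  omega

/-- A quantity bounding all parameters and their inverses; it is continuous in the parameters, which
makes the estimates below locally uniform. -/
def size {n : ℕ} (a b : Fin 2 → ℂ) (t : ℂ) (x : Fin n → ℂ) : ℝ :=
  1 + (‖t‖ + ‖t⁻¹‖) + ∑ l, (‖a l‖ + ‖(a l)⁻¹‖ + (‖b l‖ + ‖(b l)⁻¹‖)) + ∑ i, (‖x i‖ + ‖(x i)⁻¹‖)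

theorem one_le_size {n : ℕ} (a b : Fin 2 → ℂ) (t : ℂ) (x : Fin n → ℂ) : 1 ≤ size a b t x := by
  unfold size
  have h1 : 0 ≤ ∑ l, (‖a l‖ + ‖(a l)⁻¹‖ + (‖b l‖ + ‖(b l)⁻¹‖)) := sum_nonneg fun _ _ => by positivity
  have h2 : 0 ≤ ∑ i, (‖x i‖ + ‖(x i)⁻¹‖) := sum_nonneg fun _ _ => by positivity
  have h3 : 0 ≤ ‖t‖ + ‖t⁻¹‖ := by positivity
  linarith

theorem size_t {n : ℕ} (a b : Fin 2 → ℂ) (t : ℂ) (x : Fin n → ℂ) :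
    ‖t‖ ≤ size a b t x ∧ ‖t⁻¹‖ ≤ size a b t x := by
  unfold size
  have h1 : 0 ≤ ∑ l, (‖a l‖ + ‖(a l)⁻¹‖ + (‖b l‖ + ‖(b l)⁻¹‖)) := sum_nonneg fun _ _ => by positivity
  have h2 : 0 ≤ ∑ i, (‖x i‖ + ‖(x i)⁻¹‖) := sum_nonneg fun _ _ => by positivity
  constructor <;> linarith [norm_nonneg t, norm_nonneg t⁻¹]

theorem size_ab {n : ℕ} (a b : Fin 2 → ℂ) (t : ℂ) (x : Fin n → ℂ) (l : Fin 2) :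
    (‖a l‖ ≤ size a b t x ∧ ‖(a l)⁻¹‖ ≤ size a b t x) ∧
      ‖b l‖ ≤ size a b t x ∧ ‖(b l)⁻¹‖ ≤ size a b t x := by
  unfold size
  have h1 : ‖a l‖ + ‖(a l)⁻¹‖ + (‖b l‖ + ‖(b l)⁻¹‖) ≤
      ∑ l, (‖a l‖ + ‖(a l)⁻¹‖ + (‖b l‖ + ‖(b l)⁻¹‖)) :=
    single_le_sum (f := fun l => ‖a l‖ + ‖(a l)⁻¹‖ + (‖b l‖ + ‖(b l)⁻¹‖))
      (fun _ _ => by positivity) (mem_univ l)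
  have h2 : 0 ≤ ∑ i, (‖x i‖ + ‖(x i)⁻¹‖) := sum_nonneg fun _ _ => by positivity
  have := norm_nonneg (a l)
  have := norm_nonneg (a l)⁻¹
  have := norm_nonneg (b l)
  have := norm_nonneg (b l)⁻¹
  have := norm_nonneg t
  have := norm_nonneg t⁻¹
  refine ⟨⟨?_, ?_⟩, ?_, ?_⟩ <;> linarith

theorem size_x {n : ℕ} (a b : Fin 2 → ℂ) (t : ℂ) (x : Fin n → ℂ) (i : Fin n) :
    ‖x i‖ ≤ size a b t x ∧ ‖(x i)⁻¹‖ ≤ size a b t x := by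
  unfold size
  have h1 : 0 ≤ ∑ l, (‖a l‖ + ‖(a l)⁻¹‖ + (‖b l‖ + ‖(b l)⁻¹‖)) := sum_nonneg fun _ _ => by positivity
  have h2 : ‖x i‖ + ‖(x i)⁻¹‖ ≤ ∑ i, (‖x i‖ + ‖(x i)⁻¹‖) :=
    single_le_sum (f := fun i => ‖x i‖ + ‖(x i)⁻¹‖) (fun _ _ => by positivity) (mem_univ i)
  have := norm_nonneg (x i)
  have := norm_nonneg (x i)⁻¹
  have := norm_nonneg t
  have := norm_nonneg t⁻¹
  constructor <;> linarith

theorem norm_mul_three_le {M : ℝ} {u v w : ℂ} (hu : ‖u‖ ≤ M) (hv : ‖v‖ ≤ M) (hw : ‖w‖ ≤ M) :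
    ‖u * v * w‖ ≤ M ^ 3 := by
  have hM : 0 ≤ M := (norm_nonneg u).trans hu
  rw [norm_mul, norm_mul]
  calc ‖u‖ * ‖v‖ * ‖w‖ ≤ M * M * M := by gcongr
    _ = M ^ 3 := by ring

theorem norm_oneBody_le {q : ℝ} (hq0 : 0 < q) (hq1 : q < 1) {M : ℝ} (hM : 1 ≤ M)
    {a b : Fin 2 → ℂ} {x : ℂ} (ha : ∀ l, a l ≠ 0) (hb : ∀ l, b l ≠ 0) (hx : x ≠ 0)
    (haM : ∀ l, ‖a l‖ ≤ M ∧ ‖(a l)⁻¹‖ ≤ M) (hbM : ∀ l, ‖b l‖ ≤ M ∧ ‖(b l)⁻¹‖ ≤ M)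
    (hxM : ‖x‖ ≤ M ∧ ‖x⁻¹‖ ≤ M) (c : ℂ) (k : ℤ) :
    ‖oneBody q a b c x k‖ ≤ Real.exp (M ^ 3 / (1 - q)) ^ 6 *
      profile ‖c‖ (‖c‖⁻¹ * (q ^ 2 / (‖a 0‖ * ‖a 1‖ * ‖b 0‖ * ‖b 1‖))) k := by
  have hq : (q : ℂ) ≠ 0 := by exact_mod_cast hq0.ne'
  have hqM : ‖(q : ℂ)‖ ≤ M := by
    rw [Complex.norm_real, Real.norm_of_nonneg hq0.le]; linarith
  have h1M : ‖(1 : ℂ)‖ ≤ M := by simpa using hM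
  have key : ∀ l, ‖qInf q (q * (a l)⁻¹ * (x * (q : ℂ) ^ k)) *
      (thetaMult q (b l * x) k * qInf q (q / (b l * (x * (q : ℂ) ^ k))))‖ ≤
      Real.exp (M ^ 3 / (1 - q)) ^ 3 * profile 1 (q / (‖a l‖ * ‖b l‖)) k := by
    intro l
    have h := norm_pair_le hq0 hq1 (R := M ^ 3) (u := b l * x) (v := q * (a l)⁻¹ * x)
      (mul_ne_zero (hb l) hx) (mul_ne_zero (mul_ne_zero hq (inv_ne_zero (ha l))) hx)
      (by simpa using norm_mul_three_le h1M (hbM l).1 hxM.1)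
      (norm_mul_three_le hqM (haM l).2 hxM.1)
      (by
        have := norm_mul_three_le hqM (hbM l).2 hxM.2
        rwa [mul_assoc, ← mul_inv, ← div_eq_mul_inv] at this)
      (by
        have := norm_mul_three_le h1M (haM l).1 hxM.2
        have e : (q : ℂ) / (q * (a l)⁻¹ * x) = 1 * a l * x⁻¹ := by
          have := ha l
          field_simp
        rwa [e]) k
    have e : ‖q * (a l)⁻¹ * x‖ / ‖b l * x‖ = q / (‖a l‖ * ‖b l‖) := by
      have h1 := norm_ne_zero_iff.2 (ha l)
      have h2 := norm_ne_zero_iff.2 (hb l)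
      have h3 := norm_ne_zero_iff.2 hx
      rw [norm_mul, norm_mul, norm_mul, norm_inv, Complex.norm_real, Real.norm_of_nonneg hq0.le]
      field_simp
    rw [e, mul_assoc _ x, mul_assoc (b l) x] at h
    exact h
  have ha0 := norm_ne_zero_iff.2 (ha 0)
  have ha1 := norm_ne_zero_iff.2 (ha 1)
  have hb0 := norm_ne_zero_iff.2 (hb 0)
  have hb1 := norm_ne_zero_iff.2 (hb 1)
  rw [oneBody, norm_mul, norm_zpow, Fin.prod_univ_two, norm_mul, ← profile_inv]
  calc _ ≤ profile ‖c‖ ‖c‖⁻¹ k * ((Real.exp (M ^ 3 / (1 - q)) ^ 3 *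
        profile 1 (q / (‖a 0‖ * ‖b 0‖)) k) * (Real.exp (M ^ 3 / (1 - q)) ^ 3 *
        profile 1 (q / (‖a 1‖ * ‖b 1‖)) k)) := by
        have : 0 ≤ profile ‖c‖ ‖c‖⁻¹ k := profile_nonneg (by positivity) (by positivity) k
        have : 0 ≤ profile 1 (q / (‖a 0‖ * ‖b 0‖)) k := profile_nonneg (by positivity) (by positivity) k
        gcongr
        · exact key 0
        · exact key 1
    _ = Real.exp (M ^ 3 / (1 - q)) ^ 6 * (profile ‖c‖ ‖c‖⁻¹ k *
        profile 1 (q / (‖a 0‖ * ‖b 0‖)) k * profile 1 (q / (‖a 1‖ * ‖b 1‖)) k) := by ring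
    _ = _ := by
      rw [profile_mul, profile_mul]
      congr 2
      · ring
      · field_simp

theorem norm_twoBody_le {q : ℝ} (hq0 : 0 < q) (hq1 : q < 1) {M : ℝ} (hM : 1 ≤ M)
    {t x y : ℂ} (ht : t ≠ 0) (hx : x ≠ 0) (hy : y ≠ 0)
    (htM : ‖t‖ ≤ M ∧ ‖t⁻¹‖ ≤ M) (hxM : ‖x‖ ≤ M ∧ ‖x⁻¹‖ ≤ M) (hyM : ‖y‖ ≤ M ∧ ‖y⁻¹‖ ≤ M)
    {T : ℝ} (hT1 : 1 ≤ T) (hT : ‖t⁻¹‖ ≤ T) (k l : ℤ) :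
    ‖twoBody q t x k y l‖ ≤ M * (1 + M ^ 3) * Real.exp (M ^ 3 / (1 - q)) ^ 3 *
      (T ^ k.natAbs * T ^ l.natAbs) := by
  have hq : (q : ℂ) ≠ 0 := by exact_mod_cast hq0.ne'
  have hqM : ‖(q : ℂ)‖ ≤ M := by
    rw [Complex.norm_real, Real.norm_of_nonneg hq0.le]; linarith
  have h1M : ‖(1 : ℂ)‖ ≤ M := by simpa using hM
  have hu : y / x ≠ 0 := div_ne_zero hy hx
  have htn := norm_ne_zero_iff.2 ht
  set m := l - k with hm
  set u := y / x with hudef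
  have huM : ‖u‖ ≤ M ^ 3 := by
    have := norm_mul_three_le h1M hyM.1 hxM.2
    rwa [one_mul, ← div_eq_mul_inv] at this
  have h := norm_pair_le hq0 hq1 (R := M ^ 3) (u := t * u) (v := q * t⁻¹ * u)
    (mul_ne_zero ht hu) (mul_ne_zero (mul_ne_zero hq (inv_ne_zero ht)) hu)
    (by
      have := norm_mul_three_le htM.1 hyM.1 hxM.2
      rwa [mul_assoc, ← div_eq_mul_inv] at this)
    (by
      have e : ‖q * t⁻¹ * u‖ ≤ ‖t⁻¹ * y * x⁻¹‖ := by
        rw [mul_assoc, norm_mul, Complex.norm_real, Real.norm_of_nonneg hq0.le, mul_assoc,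
          ← div_eq_mul_inv]
        exact mul_le_of_le_one_left (norm_nonneg _) hq1.le
      exact e.trans (norm_mul_three_le htM.2 hyM.1 hxM.2))
    (by
      have e : ‖q / (t * u)‖ ≤ ‖t⁻¹ * y⁻¹ * x‖ := by
        have : (q : ℂ) / (t * u) = q * (t⁻¹ * y⁻¹ * x) := by rw [hudef]; field_simp
        rw [this, norm_mul, Complex.norm_real, Real.norm_of_nonneg hq0.le]
        exact mul_le_of_le_one_left (norm_nonneg _) hq1.le
      exact e.trans (norm_mul_three_le htM.2 hyM.2 hxM.1))
    (by
      have e : (q : ℂ) / (q * t⁻¹ * u) = t * y⁻¹ * x := by rw [hudef]; field_simp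
      rw [e]
      exact norm_mul_three_le htM.1 hyM.2 hxM.1) m
  have e1 : ‖q * t⁻¹ * u‖ / ‖t * u‖ = q / ‖t‖ ^ 2 := by
    have h3 := norm_ne_zero_iff.2 hu
    rw [norm_mul, norm_mul, norm_mul, norm_inv, Complex.norm_real, Real.norm_of_nonneg hq0.le]
    field_simp
  have e2 : twoBody q t x k y l = x * (1 - u * (q : ℂ) ^ m) * t ^ (-m) *
      (qInf q (q * t⁻¹ * u * (q : ℂ) ^ m) *
        (thetaMult q (t * u) m * qInf q (q / (t * u * (q : ℂ) ^ m)))) := by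
    have h1 : t ^ (-m) * t ^ m = 1 := by rw [← zpow_add₀ ht]; simp
    rw [twoBody, ← hm, ← hudef, thetaMult_mul, mul_assoc (q * t⁻¹ : ℂ) u, mul_assoc t u]
    generalize qInf q _ = A
    generalize qInf q _ = B
    linear_combination -(x * (1 - u * (q : ℂ) ^ m) * thetaMult q u m * A * B) * h1
  have e3 : ‖1 - u * (q : ℂ) ^ m‖ ≤ (1 + M ^ 3) * profile 1 q⁻¹ m := by
    have e4 : ‖1 - u * (q : ℂ) ^ m‖ ≤ 1 + M ^ 3 * q ^ m := by
      refine (norm_sub_le _ _).trans ?_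
      rw [norm_one, norm_mul, norm_q_zpow hq0]
      have := zpow_pos hq0 m
      gcongr
    have hM3 : 0 ≤ M ^ 3 := by positivity
    unfold profile
    split_ifs with hm0
    · have : q ^ m ≤ 1 := zpow_le_one₀ hq0 hq1.le hm0
      rw [one_zpow, mul_one]
      nlinarith
    · have e5 : q⁻¹ ^ (-m) = q ^ m := by rw [inv_zpow, zpow_neg, inv_inv]
      have : 1 ≤ q ^ m := one_le_zpow_of_nonpos₀ hq0 hq1.le (by omega)
      rw [e5]
      nlinarith
  rw [e1] at h
  have p1 : 0 ≤ profile 1 q⁻¹ m := profile_nonneg (by positivity) (by positivity) m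
  rw [e2, norm_mul, norm_mul, norm_mul, norm_zpow]
  calc _ ≤ M * ((1 + M ^ 3) * profile 1 q⁻¹ m) * ‖t‖ ^ (-m) *
        (Real.exp (M ^ 3 / (1 - q)) ^ 3 * profile 1 (q / ‖t‖ ^ 2) m) := by
        have := hxM.1
        gcongr
    _ = M * (1 + M ^ 3) * Real.exp (M ^ 3 / (1 - q)) ^ 3 *
        (profile 1 q⁻¹ m * profile ‖t‖⁻¹ ‖t‖⁻¹⁻¹ m * profile 1 (q / ‖t‖ ^ 2) m) := by
        rw [profile_inv, inv_zpow, zpow_neg]; ring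
    _ = M * (1 + M ^ 3) * Real.exp (M ^ 3 / (1 - q)) ^ 3 * (‖t‖⁻¹ ^ m.natAbs) := by
        rw [profile_mul, profile_mul, ← profile_self]
        congr 2
        · ring
        · have := hq0.ne'
          field_simp
    _ ≤ _ := by
        have hpos : 0 ≤ M * (1 + M ^ 3) * Real.exp (M ^ 3 / (1 - q)) ^ 3 := by positivity
        refine mul_le_mul_of_nonneg_left ?_ hpos
        rw [← norm_inv, ← pow_add]
        calc ‖t⁻¹‖ ^ m.natAbs ≤ T ^ m.natAbs := by gcongr
          _ ≤ T ^ (k.natAbs + l.natAbs) := pow_le_pow_right₀ hT1 (by omega)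

theorem norm_term_le {n : ℕ} {q : ℝ} (hq0 : 0 < q) (hq1 : q < 1) {a b : Fin 2 → ℂ} {t : ℂ}
    {x : Fin n → ℂ} (ha : ∀ l, a l ≠ 0) (hb : ∀ l, b l ≠ 0) (ht : t ≠ 0) (hx : ∀ i, x i ≠ 0)
    {M : ℝ} (hM : size a b t x ≤ M) {T ρ σ : ℝ} (hT1 : 1 ≤ T) (hT : ‖t⁻¹‖ ≤ T)
    (hρ : ‖q * t ^ (n - 1)‖ * T ^ (n - 1) ≤ ρ)
    (hσ : ‖q * t ^ (n - 1)‖⁻¹ * (q ^ 2 / (‖a 0‖ * ‖a 1‖ * ‖b 0‖ * ‖b 1‖)) * T ^ (n - 1) ≤ σ)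
    (ν : Fin n → ℤ) :
    ‖term q a b t x ν‖ ≤ ((∏ _i : Fin n, Real.exp (M ^ 3 / (1 - q)) ^ 6) *
      ∏ i : Fin n, ∏ _j ∈ Ioi i, M * (1 + M ^ 3) * Real.exp (M ^ 3 / (1 - q)) ^ 3) *
        ∏ i, profile ρ σ (ν i) := by
  have hM1 : 1 ≤ M := (one_le_size a b t x).trans hM
  have haM : ∀ l, ‖a l‖ ≤ M ∧ ‖(a l)⁻¹‖ ≤ M := fun l =>
    ⟨(size_ab a b t x l).1.1.trans hM, (size_ab a b t x l).1.2.trans hM⟩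
  have hbM : ∀ l, ‖b l‖ ≤ M ∧ ‖(b l)⁻¹‖ ≤ M := fun l =>
    ⟨(size_ab a b t x l).2.1.trans hM, (size_ab a b t x l).2.2.trans hM⟩
  have htM : ‖t‖ ≤ M ∧ ‖t⁻¹‖ ≤ M := ⟨(size_t a b t x).1.trans hM, (size_t a b t x).2.trans hM⟩
  have hxM : ∀ i, ‖x i‖ ≤ M ∧ ‖(x i)⁻¹‖ ≤ M := fun i =>
    ⟨(size_x a b t x i).1.trans hM, (size_x a b t x i).2.trans hM⟩
  set c : ℂ := q * t ^ (n - 1) with hc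
  set E := Real.exp (M ^ 3 / (1 - q)) with hE
  set s : ℝ := ‖c‖⁻¹ * (q ^ 2 / (‖a 0‖ * ‖a 1‖ * ‖b 0‖ * ‖b 1‖)) with hs
  have hs0 : 0 ≤ s := by positivity
  have h0 : ∀ k, 0 ≤ profile ‖c‖ s k := profile_nonneg (norm_nonneg _) hs0
  rw [term, norm_mul, norm_prod, norm_prod]
  simp only [norm_prod]
  calc _ ≤ (∏ i : Fin n, E ^ 6 * profile ‖c‖ s (ν i)) *
        ∏ i : Fin n, ∏ j ∈ Ioi i, (M * (1 + M ^ 3) * E ^ 3) *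
          (T ^ (ν i).natAbs * T ^ (ν j).natAbs) := by
        refine mul_le_mul ?_ ?_ ?_ ?_
        · exact prod_le_prod (fun _ _ => norm_nonneg _) fun i _ =>
            norm_oneBody_le hq0 hq1 hM1 ha hb (hx i) haM hbM (hxM i) c (ν i)
        · refine prod_le_prod (fun _ _ => prod_nonneg fun _ _ => norm_nonneg _) fun i _ => ?_
          exact prod_le_prod (fun _ _ => norm_nonneg _) fun j _ =>
            norm_twoBody_le hq0 hq1 hM1 ht (hx i) (hx j) htM (hxM i) (hxM j) hT1 hT _ _
        · exact prod_nonneg fun _ _ => prod_nonneg fun _ _ => norm_nonneg _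
        · exact prod_nonneg fun i _ => mul_nonneg (by positivity) (h0 _)
    _ = (∏ _i : Fin n, E ^ 6) * (∏ i : Fin n, ∏ _j ∈ Ioi i, M * (1 + M ^ 3) * E ^ 3) *
        ∏ i, profile (‖c‖ * T ^ (n - 1)) (s * T ^ (n - 1)) (ν i) := by
        have e : ∀ k : ℤ, profile (‖c‖ * T ^ (n - 1)) (s * T ^ (n - 1)) k =
            profile ‖c‖ s k * (T ^ k.natAbs) ^ (n - 1) := fun k => by
          rw [← profile_mul, profile_self, ← pow_mul, ← pow_mul, mul_comm (n - 1)]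
        simp only [e, prod_mul_distrib, ← prod_pairs]
        ring
    _ ≤ _ := by
        refine mul_le_mul_of_nonneg_left ?_ ?_
        · refine prod_le_prod (fun i _ => profile_nonneg (by positivity) (by positivity) _)
            fun i _ => profile_mono (by positivity) (by positivity) hρ hσ _
        · have : 0 ≤ M := by linarith
          exact mul_nonneg (prod_nonneg fun _ _ => by positivity)
            (prod_nonneg fun _ _ => prod_nonneg fun _ _ => by positivity)

/-- The growth rate of the summand in the direction of the origin. -/
def growthZero (n : ℕ) (q : ℝ) (t : ℂ) : ℝ := ‖q * t ^ (n - 1)‖ * max 1 ‖t⁻¹‖ ^ (n - 1)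

/-- The growth rate of the summand in the direction of infinity. -/
def growthInfty (n : ℕ) (q : ℝ) (a b : Fin 2 → ℂ) (t : ℂ) : ℝ :=
  ‖q * t ^ (n - 1)‖⁻¹ * (q ^ 2 / (‖a 0‖ * ‖a 1‖ * ‖b 0‖ * ‖b 1‖)) * max 1 ‖t⁻¹‖ ^ (n - 1)

theorem growthZero_nonneg (n : ℕ) (q : ℝ) (t : ℂ) : 0 ≤ growthZero n q t := by
  unfold growthZero; positivity

theorem growthInfty_nonneg (n : ℕ) (q : ℝ) (a b : Fin 2 → ℂ) (t : ℂ) :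
    0 ≤ growthInfty n q a b t := by
  unfold growthInfty; positivity

/-- The constant in the bound for the summand. -/
def termConst (n : ℕ) (q M : ℝ) : ℝ :=
  (∏ _i : Fin n, Real.exp (M ^ 3 / (1 - q)) ^ 6) *
      ∏ i : Fin n, ∏ _j ∈ Ioi i, M * (1 + M ^ 3) * Real.exp (M ^ 3 / (1 - q)) ^ 3

theorem norm_term_le_profile {n : ℕ} {q : ℝ} (hq0 : 0 < q) (hq1 : q < 1) {a b : Fin 2 → ℂ} {t : ℂ}
    {x : Fin n → ℂ} (ha : ∀ l, a l ≠ 0) (hb : ∀ l, b l ≠ 0) (ht : t ≠ 0) (hx : ∀ i, x i ≠ 0)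
    {M : ℝ} (hM : size a b t x ≤ M) {ρ σ : ℝ} (hρ : growthZero n q t ≤ ρ)
    (hσ : growthInfty n q a b t ≤ σ) (ν : Fin n → ℤ) :
    ‖term q a b t x ν‖ ≤ termConst n q M * ∏ i, profile ρ σ (ν i) :=
  norm_term_le hq0 hq1 ha hb ht hx hM (le_max_left _ _) (le_max_right _ _) hρ hσ ν

/-- The parameters for which the regularised sum converges absolutely. -/
structure Admissible (n : ℕ) (q : ℝ) (a b : Fin 2 → ℂ) (t : ℂ) : Prop where
  q_pos : 0 < q
  q_lt_one : q < 1
  a_ne : ∀ l, a l ≠ 0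
  b_ne : ∀ l, b l ≠ 0
  t_ne : t ≠ 0
  zero_lt : growthZero n q t < 1
  infty_lt : growthInfty n q a b t < 1

theorem Admissible.summable_norm {n : ℕ} {q : ℝ} {a b : Fin 2 → ℂ} {t : ℂ}
    (h : Admissible n q a b t) {x : Fin n → ℂ} (hx : ∀ i, x i ≠ 0) :
    Summable fun ν => ‖term q a b t x ν‖ := by
  refine Summable.of_nonneg_of_le (fun _ => norm_nonneg _) (fun ν => norm_term_le_profile h.q_pos
    h.q_lt_one h.a_ne h.b_ne h.t_ne hx le_rfl le_rfl le_rfl ν) ?_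
  exact (summable_prod_fin (fun k => profile_nonneg (growthZero_nonneg _ _ _)
    (growthInfty_nonneg _ _ _ _ _) k) (summable_profile (growthZero_nonneg _ _ _) h.zero_lt
      (growthInfty_nonneg _ _ _ _ _) h.infty_lt)).mul_left _

/-! ### Symmetry and quasi-periodicity of the regularised sum -/

theorem twoBody_antisymm {q : ℝ} (hq0 : 0 < q) {t x y : ℂ} (hx : x ≠ 0)
    (hy : y ≠ 0) (k l : ℤ) : twoBody q t x k y l = -twoBody q t y l x k := by
  have hq : (q : ℂ) ≠ 0 := by exact_mod_cast hq0.ne'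
  have hu : y / x ≠ 0 := div_ne_zero hy hx
  set m := l - k with hm
  have hm' : k - l = -m := by rw [hm]; ring
  set u := y / x with hudef
  have hu' : x / y = u⁻¹ := by rw [hudef, inv_div]
  have hyx : y = u * x := by rw [hudef, div_mul_cancel₀ _ hx]
  set v := u * (q : ℂ) ^ m with hv
  have hv0 : v ≠ 0 := mul_ne_zero hu (zpow_ne_zero _ hq)
  have hv' : u⁻¹ * (q : ℂ) ^ (-m) = v⁻¹ := by rw [hv, mul_inv, zpow_neg]
  have hmult : thetaMult q u⁻¹ (-m) = (q : ℂ) ^ m * thetaMult q u m := by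
    have e : (-m) * (-m - 1) / 2 = m * (m - 1) / 2 + m := by
      rw [← tri_succ]; congr 1; ring
    rw [thetaMult, thetaMult, e, zpow_add₀ hq, ← inv_neg, inv_zpow, zpow_neg, inv_inv]
    ring
  rw [twoBody, twoBody, hm', hu', ← hm, ← hudef, ← hv, hv', hmult, hyx]
  have e1 : (q : ℂ) / (t * v⁻¹) = q * t⁻¹ * v := by
    rw [div_eq_mul_inv, mul_inv, inv_inv]; ring
  have e2 : (q : ℂ) / (t * v) = q * t⁻¹ * v⁻¹ := by
    rw [div_eq_mul_inv, mul_inv]; ring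
  rw [e1, e2]
  have e3 : u * (1 - v⁻¹) * (q : ℂ) ^ m = -(1 - v) := by
    rw [mul_right_comm, ← hv]; field_simp; ring
  linear_combination (x * thetaMult q u m * (qInf q (q * t⁻¹ * v) * qInf q (q * t⁻¹ * v⁻¹))) * e3

theorem term_perm {n : ℕ} {q : ℝ} (hq0 : 0 < q) (a b : Fin 2 → ℂ) (t : ℂ) {x : Fin n → ℂ}
    (hx : ∀ i, x i ≠ 0) (σ : Equiv.Perm (Fin n)) (ν : Fin n → ℤ) :
    term q a b t (x ∘ σ) (ν ∘ σ) = (Equiv.Perm.sign σ : ℤ) * term q a b t x ν := by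
  have h1 : ∏ i, oneBody q a b (q * t ^ (n - 1)) ((x ∘ σ) i) ((ν ∘ σ) i) =
      ∏ i, oneBody q a b (q * t ^ (n - 1)) (x i) (ν i) :=
    Equiv.prod_comp σ fun i => oneBody q a b (q * t ^ (n - 1)) (x i) (ν i)
  have h2 := σ.prod_Ioi_comp_eq_sign_mul_prod
    (f := fun i j => twoBody q t (x i) (ν i) (x j) (ν j))
    fun i j => twoBody_antisymm hq0 (hx i) (hx j) _ _
  rw [term, term, h1]
  simp only [Function.comp_apply]
  rw [h2]
  ring

theorem altSum_perm {n : ℕ} {q : ℝ} (hq0 : 0 < q) (a b : Fin 2 → ℂ) (t : ℂ) {x : Fin n → ℂ}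
    (hx : ∀ i, x i ≠ 0) (σ : Equiv.Perm (Fin n)) :
    altSum q a b t (x ∘ σ) = (Equiv.Perm.sign σ : ℤ) * altSum q a b t x := by
  rw [altSum, altSum, ← tsum_mul_left, ← (σ.symm.arrowCongr (Equiv.refl ℤ)).tsum_eq]
  refine tsum_congr fun ν => ?_
  rw [← term_perm hq0 a b t hx]
  rfl

theorem altSum_eq_zero {n : ℕ} {q : ℝ} (hq0 : 0 < q) (a b : Fin 2 → ℂ) (t : ℂ) {x : Fin n → ℂ}
    (hx : ∀ i, x i ≠ 0) {i j : Fin n} (hij : i ≠ j) (h : x i = x j) :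
    altSum q a b t x = 0 := by
  have h1 := altSum_perm hq0 a b t hx (Equiv.swap i j)
  have h2 : x ∘ Equiv.swap i j = x := by
    funext k
    rw [Function.comp_apply, Equiv.swap_apply_def]
    split_ifs with h3 h4
    · rw [h3, h]
    · rw [h4, h]
    · rfl
  rw [h2, Equiv.Perm.sign_swap hij] at h1
  push_cast at h1
  have h3 : (2 : ℂ) * altSum q a b t x = 0 := by linear_combination h1
  simpa using h3

theorem thetaVand_perm {n : ℕ} {q : ℝ} (hq0 : 0 < q) (hq1 : q < 1) {x : Fin n → ℂ}
    (hx : ∀ i, x i ≠ 0) (σ : Equiv.Perm (Fin n)) :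
    thetaVand q (x ∘ σ) = (Equiv.Perm.sign σ : ℤ) * thetaVand q x := by
  have h2 := σ.prod_Ioi_comp_eq_sign_mul_prod (f := fun i j => x i * theta q (x j / x i))
    fun i j => by
      rw [← inv_div (x i) (x j), theta_inv hq0 hq1 (div_ne_zero (hx i) (hx j))]
      have := hx i
      have := hx j
      field_simp
  rw [thetaVand, thetaVand]
  simp only [Function.comp_apply]
  rw [h2]

theorem symSum_perm {n : ℕ} {q : ℝ} (hq0 : 0 < q) (hq1 : q < 1) (a b : Fin 2 → ℂ) (t : ℂ)
    {x : Fin n → ℂ} (hx : ∀ i, x i ≠ 0) (σ : Equiv.Perm (Fin n)) :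
    symSum q a b t (x ∘ σ) = symSum q a b t x := by
  rw [symSum, symSum, altSum_perm hq0 a b t hx, thetaVand_perm hq0 hq1 hx, mul_div_mul_left]
  have : (Equiv.Perm.sign σ : ℤ) ≠ 0 := by simp
  exact_mod_cast this

theorem oneBody_q_mul {q : ℝ} (hq0 : 0 < q) {a b : Fin 2 → ℂ} (hb : ∀ l, b l ≠ 0) {c x : ℂ}
    (hc : c ≠ 0) (hx : x ≠ 0) (k : ℤ) :
    oneBody q a b c (q * x) k * (c * (b 0 * b 1) * x ^ 2) = oneBody q a b c x (k + 1) := by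
  have hq : (q : ℂ) ≠ 0 := by exact_mod_cast hq0.ne'
  have e : (q : ℂ) * x * (q : ℂ) ^ k = x * (q : ℂ) ^ (k + 1) := by
    rw [zpow_add₀ hq, zpow_one]; ring
  have h : ∀ l, thetaMult q (b l * x) (k + 1) = thetaMult q (b l * (q * x)) k * -(b l * x) := by
    intro l
    rw [thetaMult_succ hq0 (mul_ne_zero (hb l) hx),
      show b l * (q * x) = q * (b l * x) by ring, thetaMult_mul q (q : ℂ)]
    ring
  rw [oneBody, oneBody, Fin.prod_univ_two, Fin.prod_univ_two, e, h, h, zpow_add₀ hc, zpow_one]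
  ring

theorem twoBody_q_mul {q : ℝ} (hq0 : 0 < q) {t x y : ℂ} (hx : x ≠ 0) (hy : y ≠ 0)
    (k l : ℤ) : twoBody q t (q * x) k y l = -(y / x) * twoBody q t x (k + 1) y l := by
  have hq : (q : ℂ) ≠ 0 := by exact_mod_cast hq0.ne'
  set j := l - (k + 1) with hj
  have hj' : l - k = j + 1 := by rw [hj]; ring
  have hu : y / (q * x) ≠ 0 := div_ne_zero hy (mul_ne_zero hq hx)
  have e1 : y / x = q * (y / (q * x)) := by field_simp
  have h1 : thetaMult q (y / (q * x)) (j + 1) = -(y / (q * x)) * thetaMult q (y / x) j := by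
    rw [thetaMult_succ hq0 hu, e1, thetaMult_mul]; ring
  have h2 : y / (q * x) * (q : ℂ) ^ (j + 1) = y / x * (q : ℂ) ^ j := by
    rw [e1, zpow_add₀ hq, zpow_one]; ring
  rw [twoBody, twoBody, ← hj, hj', h1, h2]
  have h3 : (q : ℂ) * x * (y / (q * x)) = y / x * x := by field_simp
  linear_combination (-(1 - y / x * (q : ℂ) ^ j) * thetaMult q (y / x) j *
      (qInf q (q * t⁻¹ * (y / x * (q : ℂ) ^ j)) * qInf q (q / (t * (y / x * (q : ℂ) ^ j))))) * h3

theorem term_cons {m : ℕ} (q : ℝ) (a b : Fin 2 → ℂ) (t y : ℂ) (p : Fin m → ℂ)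
    (ν : Fin (m + 1) → ℤ) :
    term q a b t (Fin.cons y p : Fin (m + 1) → ℂ) ν =
      oneBody q a b (q * t ^ m) y (ν 0) * (∏ j, twoBody q t y (ν 0) (p j) (ν j.succ)) *
        ((∏ i, oneBody q a b (q * t ^ m) (p i) (ν i.succ)) *
          ∏ i, ∏ j ∈ Ioi i, twoBody q t (p i) (ν i.succ) (p j) (ν j.succ)) := by
  rw [term, Fin.prod_univ_succ, Fin.prod_univ_succ, Fin.prod_Ioi_zero]
  simp only [Fin.prod_Ioi_succ, Fin.cons_zero, Fin.cons_succ, Nat.add_sub_cancel]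
  ring

theorem thetaVand_cons {m : ℕ} (q : ℝ) (y : ℂ) (p : Fin m → ℂ) :
    thetaVand q (Fin.cons y p : Fin (m + 1) → ℂ) =
      (∏ j, y * theta q (p j / y)) * thetaVand q p := by
  rw [thetaVand, thetaVand, Fin.prod_univ_succ, Fin.prod_Ioi_zero]
  simp only [Fin.prod_Ioi_succ, Fin.cons_zero, Fin.cons_succ]

theorem altSum_cons_q_mul {m : ℕ} {q : ℝ} (hq0 : 0 < q) (a : Fin 2 → ℂ) {b : Fin 2 → ℂ}
    (hb : ∀ l, b l ≠ 0) {t y : ℂ} (ht : t ≠ 0) (hy : y ≠ 0) {p : Fin m → ℂ} (hp : ∀ j, p j ≠ 0) :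
    altSum q a b t (Fin.cons (q * y) p : Fin (m + 1) → ℂ) * (q * t ^ m * (b 0 * b 1) * y ^ 2) =
      (∏ j, -(p j / y)) * altSum q a b t (Fin.cons y p : Fin (m + 1) → ℂ) := by
  have hq : (q : ℂ) ≠ 0 := by exact_mod_cast hq0.ne'
  have hc : (q : ℂ) * t ^ m ≠ 0 := mul_ne_zero hq (pow_ne_zero _ ht)
  rw [altSum, altSum, ← tsum_mul_left, ← tsum_mul_right,
    ← (Equiv.addRight (Pi.single (0 : Fin (m + 1)) (1 : ℤ))).tsum_eq
      fun ν => (∏ j, -(p j / y)) * term q a b t (Fin.cons y p : Fin (m + 1) → ℂ) ν]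
  refine tsum_congr fun ν => ?_
  have e0 : (Equiv.addRight (Pi.single (0 : Fin (m + 1)) (1 : ℤ))) ν 0 = ν 0 + 1 := by simp
  have e1 : ∀ j : Fin m, (Equiv.addRight (Pi.single (0 : Fin (m + 1)) (1 : ℤ))) ν j.succ =
      ν j.succ := fun j => by simp [Fin.succ_ne_zero]
  rw [term_cons, term_cons, e0]
  simp only [e1]
  rw [← oneBody_q_mul hq0 hb hc hy]
  simp only [twoBody_q_mul hq0 hy (hp _), prod_mul_distrib]
  ring

theorem differentiableAt_oneBody {q : ℝ} (hq0 : 0 < q) (hq1 : q < 1) (a : Fin 2 → ℂ)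
    {b : Fin 2 → ℂ} (hb : ∀ l, b l ≠ 0) (c : ℂ) {y : ℂ} (hy : y ≠ 0) (k : ℤ) :
    DifferentiableAt ℂ (fun y => oneBody q a b c y k) y := by
  have hq : (q : ℂ) ≠ 0 := by exact_mod_cast hq0.ne'
  have hd := differentiable_qInf hq0 hq1
  have hfac : ∀ l, DifferentiableAt ℂ (fun y : ℂ => qInf q (q * (a l)⁻¹ * (y * (q : ℂ) ^ k)) *
      (thetaMult q (b l * y) k * qInf q (q / (b l * (y * (q : ℂ) ^ k))))) y := by
    intro l
    have h1 : DifferentiableAt ℂ (fun y : ℂ => (q : ℂ) / (b l * (y * (q : ℂ) ^ k))) y :=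
      (differentiableAt_const _).div (by fun_prop)
        (mul_ne_zero (hb l) (mul_ne_zero hy (zpow_ne_zero _ hq)))
    have h2 : DifferentiableAt ℂ (fun y : ℂ => q * (a l)⁻¹ * (y * (q : ℂ) ^ k)) y := by fun_prop
    have h3 : DifferentiableAt ℂ (fun y : ℂ => -(b l * y)) y := by fun_prop
    have h4 : DifferentiableAt ℂ (fun y : ℂ => thetaMult q (b l * y) k) y := by
      unfold thetaMult
      exact (h3.zpow (Or.inl (neg_ne_zero.2 (mul_ne_zero (hb l) hy)))).mul_const _
    exact (DifferentiableAt.comp (g := qInf q) y (hd _) h2).mul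
      (h4.mul (DifferentiableAt.comp (g := qInf q) y (hd _) h1))
  unfold oneBody
  simp only [Fin.prod_univ_two]
  exact ((hfac 0).mul (hfac 1)).const_mul _

theorem differentiableAt_twoBody {q : ℝ} (hq0 : 0 < q) (hq1 : q < 1) {t y w : ℂ} (ht : t ≠ 0)
    (hy : y ≠ 0) (hw : w ≠ 0) (k l : ℤ) :
    DifferentiableAt ℂ (fun y => twoBody q t y k w l) y := by
  have hq : (q : ℂ) ≠ 0 := by exact_mod_cast hq0.ne'
  have hd := differentiable_qInf hq0 hq1
  have h1 : DifferentiableAt ℂ (fun y : ℂ => w / y) y :=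
    (differentiableAt_const _).div differentiableAt_id hy
  have h2 : DifferentiableAt ℂ (fun y : ℂ => w / y * (q : ℂ) ^ (l - k)) y := h1.mul_const _
  have h3 : DifferentiableAt ℂ (fun y : ℂ => (q : ℂ) / (t * (w / y * (q : ℂ) ^ (l - k)))) y :=
    (differentiableAt_const _).div (h2.const_mul _)
      (mul_ne_zero ht (mul_ne_zero (div_ne_zero hw hy) (zpow_ne_zero _ hq)))
  have h4 : DifferentiableAt ℂ (fun y : ℂ => thetaMult q (w / y) (l - k)) y := by
    unfold thetaMult
    exact (h1.neg.zpow (Or.inl (neg_ne_zero.2 (div_ne_zero hw hy)))).mul_const _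
  unfold twoBody
  exact ((differentiableAt_id.mul (h2.const_sub _)).mul h4).mul
    ((DifferentiableAt.comp (g := qInf q) y (hd _) (h2.const_mul _)).mul
      (DifferentiableAt.comp (g := qInf q) y (hd _) h3))

theorem differentiableAt_term_cons {m : ℕ} {q : ℝ} (hq0 : 0 < q) (hq1 : q < 1) (a : Fin 2 → ℂ)
    {b : Fin 2 → ℂ} (hb : ∀ l, b l ≠ 0) {t y : ℂ} (ht : t ≠ 0) (hy : y ≠ 0) {p : Fin m → ℂ}
    (hp : ∀ j, p j ≠ 0) (ν : Fin (m + 1) → ℤ) :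
    DifferentiableAt ℂ (fun y => term q a b t (Fin.cons y p : Fin (m + 1) → ℂ) ν) y := by
  simp only [term_cons]
  exact ((differentiableAt_oneBody hq0 hq1 a hb _ hy _).mul (DifferentiableAt.fun_finsetProd
    fun j _ => differentiableAt_twoBody hq0 hq1 ht hy (hp j) _ _)).mul_const _

theorem Admissible.isTheta_altSum {m : ℕ} {q : ℝ} {a b : Fin 2 → ℂ} {t : ℂ}
    (h : Admissible (m + 1) q a b t) {p : Fin m → ℂ} (hp : ∀ j, p j ≠ 0) :
    IsTheta q (m + 2) ((∏ j, -p j) / (q * (b 0 * b 1 * t ^ m)))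
      fun y => altSum q a b t (Fin.cons y p : Fin (m + 1) → ℂ) := by
  have hq0 := h.q_pos
  have hq1 := h.q_lt_one
  have hq : (q : ℂ) ≠ 0 := by exact_mod_cast hq0.ne'
  constructor
  · intro y0 hy0
    set S : ℂ → ℝ := fun y => size a b t (Fin.cons y p : Fin (m + 1) → ℂ) with hS
    have hSc : ContinuousAt S y0 := by
      simp only [hS, size, Fin.sum_univ_succ, Fin.cons_zero, Fin.cons_succ]
      have : ContinuousAt (fun y : ℂ => y⁻¹) y0 := continuousAt_inv₀ hy0
      fun_prop
    have hev : ∀ᶠ y in 𝓝 y0, S y < S y0 + 1 ∧ y ≠ 0 :=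
      (hSc.eventually_lt_const (lt_add_one _)).and (isOpen_ne.mem_nhds hy0)
    obtain ⟨U, hU, hUo, hyU⟩ := eventually_nhds_iff.1 hev
    have hcons : ∀ y ∈ U, ∀ i, (Fin.cons y p : Fin (m + 1) → ℂ) i ≠ 0 := by
      intro y hy i
      refine Fin.cases ?_ (fun j => ?_) i
      · simpa using (hU y hy).2
      · simpa using hp j
    set u : (Fin (m + 1) → ℤ) → ℝ := fun ν => termConst (m + 1) q (S y0 + 1) *
      ∏ i, profile (growthZero (m + 1) q t) (growthInfty (m + 1) q a b t) (ν i) with hu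
    have hus : Summable u := (summable_prod_fin (fun k => profile_nonneg (growthZero_nonneg _ _ _)
      (growthInfty_nonneg _ _ _ _ _) k) (summable_profile (growthZero_nonneg _ _ _) h.zero_lt
        (growthInfty_nonneg _ _ _ _ _) h.infty_lt)).mul_left _
    have hle : ∀ (ν : Fin (m + 1) → ℤ) (y : ℂ), y ∈ U →
        ‖term q a b t (Fin.cons y p : Fin (m + 1) → ℂ) ν‖ ≤ u ν := fun ν y hy =>
      norm_term_le_profile hq0 hq1 h.a_ne h.b_ne h.t_ne (hcons y hy) (hU y hy).1.le le_rfl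
        le_rfl ν
    have hdiff : ∀ ν : Fin (m + 1) → ℤ, DifferentiableOn ℂ
        (fun y => term q a b t (Fin.cons y p : Fin (m + 1) → ℂ) ν) U := fun ν y hy =>
      (differentiableAt_term_cons hq0 hq1 a h.b_ne h.t_ne (hU y hy).2 hp ν).differentiableWithinAt
    exact (Complex.differentiableOn_tsum_of_summable_norm hus hdiff hUo hle).differentiableAt
      (hUo.mem_nhds hyU)
  · intro y hy
    have h1 := altSum_cons_q_mul hq0 a h.b_ne h.t_ne hy hp
    have h2 : (q : ℂ) * t ^ m * (b 0 * b 1) * y ^ 2 ≠ 0 :=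
      mul_ne_zero (mul_ne_zero (mul_ne_zero hq (pow_ne_zero _ h.t_ne))
        (mul_ne_zero (h.b_ne 0) (h.b_ne 1))) (pow_ne_zero _ hy)
    rw [← eq_div_iff h2] at h1
    have h3 : ∏ j, -(p j / y) = (∏ j, -p j) * (y ^ m)⁻¹ := by
      have : ∀ j, -(p j / y) = -p j * y⁻¹ := fun j => by ring
      simp only [this, prod_mul_distrib]
      rw [prod_const, card_univ, Fintype.card_fin, inv_pow]
    have h4 : y ^ (-((m : ℤ) + 2)) = (y ^ m)⁻¹ * (y ^ 2)⁻¹ := by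
      rw [neg_add, zpow_add₀ hy, zpow_neg, zpow_neg]; norm_cast
    rw [h1, h3, h4, show (q : ℂ) * t ^ m * (b 0 * b 1) = q * (b 0 * b 1 * t ^ m) by ring]
    rw [mul_assoc, div_eq_mul_inv, mul_inv, div_eq_mul_inv]
    ring

/-- Division of a theta function by several of its zeros. -/
theorem IsTheta.exists_div_prod {q : ℝ} (hq0 : 0 < q) (hq1 : q < 1) {ι : Type*} [DecidableEq ι]
    {p : ι → ℂ} (hp : ∀ j, p j ≠ 0) (s : Finset ι)
    (hpp : ∀ i ∈ s, ∀ j ∈ s, i ≠ j → theta q (p i / p j) ≠ 0) {d : ℤ} {c : ℂ} {f : ℂ → ℂ}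
    (hc : c ≠ 0) (hf : IsTheta q d c f) (h : ∀ j ∈ s, f (p j) = 0) :
    ∃ g, IsTheta q (d - s.card) (c / ∏ j ∈ s, -p j) g ∧
      ∀ y ≠ 0, f y = g y * ∏ j ∈ s, theta q (y / p j) := by
  induction s using Finset.induction_on with
  | empty => exact ⟨f, by simpa using hf, by simp⟩
  | insert i s hi ih =>
    obtain ⟨g, hg, hfg⟩ := ih (fun i hi j hj => hpp i (mem_insert_of_mem hi) j (mem_insert_of_mem hj))
      fun j hj => h j (mem_insert_of_mem hj)
    have hgi : g (p i) = 0 := by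
      have h1 := hfg (p i) (hp i)
      rw [h i (mem_insert_self _ _)] at h1
      refine (mul_eq_zero.1 h1.symm).resolve_right (prod_ne_zero_iff.2 fun j hj => ?_)
      exact hpp i (mem_insert_self _ _) j (mem_insert_of_mem hj) (by rintro rfl; exact hi hj)
    have hc' : c / ∏ j ∈ s, -p j ≠ 0 :=
      div_ne_zero hc (prod_ne_zero_iff.2 fun j _ => neg_ne_zero.2 (hp j))
    obtain ⟨k, hk, hgk⟩ := hg.exists_div hq0 hq1 hc' (hp i) hgi
    refine ⟨k, ?_, fun y hy => ?_⟩
    · rw [card_insert_of_notMem hi, prod_insert hi]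
      convert hk using 1
      · push_cast; ring
      · rw [neg_div, ← div_neg, div_div, mul_comm]
    · rw [hfg y hy, hgk y hy, prod_insert hi]; ring

/-- As a function of one variable, the regularised integral extends to a theta function of degree
two: the poles coming from the theta Vandermonde product are cancelled by antisymmetry. -/
theorem Admissible.exists_slice {m : ℕ} {q : ℝ} {a b : Fin 2 → ℂ} {t : ℂ}
    (h : Admissible (m + 1) q a b t) {p : Fin m → ℂ} (hp : ∀ j, p j ≠ 0)
    (hpp : ∀ i j, i ≠ j → theta q (p i / p j) ≠ 0) :
    ∃ f, IsTheta q 2 (1 / (q * (b 0 * b 1 * t ^ m))) f ∧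
      ∀ y ≠ 0, (∀ j, theta q (y / p j) ≠ 0) →
        symSum q a b t (Fin.cons y p : Fin (m + 1) → ℂ) = f y := by
  have hq0 := h.q_pos
  have hq1 := h.q_lt_one
  have hq : (q : ℂ) ≠ 0 := by exact_mod_cast hq0.ne'
  have hP : ∏ j, -p j ≠ 0 := prod_ne_zero_iff.2 fun j _ => neg_ne_zero.2 (hp j)
  have hc0 : (q : ℂ) * (b 0 * b 1 * t ^ m) ≠ 0 :=
    mul_ne_zero hq (mul_ne_zero (mul_ne_zero (h.b_ne 0) (h.b_ne 1)) (pow_ne_zero _ h.t_ne))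
  obtain ⟨g, hg, hfg⟩ := (h.isTheta_altSum hp).exists_div_prod hq0 hq1 hp univ
    (fun i _ j _ hij => hpp i j hij) (div_ne_zero hP hc0) fun j _ => by
      refine altSum_eq_zero hq0 a b t (i := 0) (j := j.succ) (fun i => ?_)
        (Fin.succ_ne_zero j).symm (by simp)
      refine Fin.cases ?_ (fun k => ?_) i
      · simpa using hp j
      · simpa using hp k
  have e1 : ((m : ℤ) + 2 - (univ : Finset (Fin m)).card) = 2 := by simp
  have e2 : (∏ j, -p j) / (q * (b 0 * b 1 * t ^ m)) / ∏ j, -p j = 1 / (q * (b 0 * b 1 * t ^ m)) := by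
    rw [div_div, mul_comm, ← div_div, div_self hP]
  rw [e1, e2] at hg
  refine ⟨fun y => ((∏ j, -p j) * thetaVand q p)⁻¹ * g y, hg.const_mul _, fun y hy hyp => ?_⟩
  have e3 : ∏ j, y * theta q (p j / y) = (∏ j, -p j) * ∏ j, theta q (y / p j) := by
    rw [← prod_mul_distrib]
    refine prod_congr rfl fun j _ => ?_
    rw [← inv_div y (p j), theta_inv hq0 hq1 (div_ne_zero hy (hp j))]
    have := hp j
    field_simp
  have e4 : ∏ j, theta q (y / p j) ≠ 0 := prod_ne_zero_iff.2 fun j _ => hyp j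
  rw [symSum, thetaVand_cons, hfg y hy, e3, div_eq_inv_mul, mul_inv, mul_inv, mul_inv]
  field_simp

/-! ### The connection coefficients -/

/-- The connection coefficient `H_i(x₁,x₂)` for `n` variables, with free parameters `B₁`, `B₂`. -/
def connCoeff (q : ℝ) (t B₁ B₂ x₁ x₂ : ℂ) (n i : ℕ) : ℂ :=
  (∏ j ∈ Icc 1 i,
    (theta q (x₂ * B₁ * t ^ ((n : ℤ) - j)) * theta q (x₂ * B₂ * t ^ ((n : ℤ) - j))) /
      (theta q (t ^ j) * theta q (x₂ * x₁⁻¹ * t ^ ((n : ℤ) - i - j + 1)))) *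
  (∏ k ∈ Icc 1 (n - i),
    (theta q (x₁ * B₁ * t ^ ((n : ℤ) - k)) * theta q (x₁ * B₂ * t ^ ((n : ℤ) - k))) /
      (theta q (t ^ k) * theta q (x₁ * x₂⁻¹ * t ^ ((i : ℤ) - k + 1)))) *
  ∏ l ∈ Icc 1 n, theta q (t ^ l) / theta q (x₁ * x₂ * B₁ * B₂ * t ^ ((n : ℤ) + l - 2))

theorem connCoeff_zero (q : ℝ) (t B₁ B₂ x₁ x₂ : ℂ) : connCoeff q t B₁ B₂ x₁ x₂ 0 0 = 1 := by
  simp [connCoeff]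

theorem connCoeff_swap (q : ℝ) (t B₁ B₂ x₁ x₂ : ℂ) {n i : ℕ} (hi : i ≤ n) :
    connCoeff q t B₁ B₂ x₂ x₁ n (n - i) = connCoeff q t B₁ B₂ x₁ x₂ n i := by
  have h1 : n - (n - i) = i := by omega
  have h2 : ((n - i : ℕ) : ℤ) = n - i := by omega
  rw [connCoeff, connCoeff, h1, h2, mul_comm x₂ x₁, mul_comm (∏ j ∈ Icc 1 (n - i), _)]
  congr 2
  · refine prod_congr rfl fun j _ => ?_
    congr 5
    ring

theorem prod_Icc_one {M : Type*} [CommMonoid M] (f : ℕ → M) (n : ℕ) :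
    ∏ j ∈ Icc 1 n, f j = ∏ j ∈ range n, f (j + 1) := by
  induction n with
  | zero => simp
  | succ n ih => rw [prod_Icc_succ_top (by omega), ih, prod_range_succ]

/-- The ratio, for `n` variables, between the coefficient for `n - 1` variables with `B₁` replaced by
`B₁ t`, multiplied by the interpolation coefficient, and the coefficient for `n` variables; see
`connCoeff_succ`. The value for `i = 0` is set separately, as the general expression may be `0 / 0`
there. -/
def connRatio (q : ℝ) (t B₂ x₁ x₂ : ℂ) (n i : ℕ) : ℂ :=
  if i = 0 then 1 else
    theta q (x₁ * B₂ * t ^ ((n : ℤ) - 1 + i)) * theta q (t ^ ((n : ℤ) - i)) *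
      theta q (x₂ * B₂ * t ^ ((n : ℤ) - 1 - i)) * theta q (x₂ * x₁⁻¹ * t ^ ((n : ℤ) - i)) /
    (theta q (x₁ * B₂ * t ^ ((n : ℤ) - 1)) * theta q (x₂ * B₂ * t ^ ((n : ℤ) - 1)) *
      theta q (x₂ * x₁⁻¹ * t ^ ((n : ℤ) - 2 * i)) * theta q (t ^ n))

/-- Weierstrass's three-term relation for theta functions, in the form of an interpolation formula. -/
theorem connRatio_add {q : ℝ} (hq0 : 0 < q) (hq1 : q < 1) {t B₂ x₁ x₂ : ℂ} (ht : t ≠ 0)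
    (hB : B₂ ≠ 0) (hx₁ : x₁ ≠ 0) (hx₂ : x₂ ≠ 0) {n i : ℕ} (hn : 0 < n) (hi : i ≤ n)
    (h1 : theta q (t ^ n) ≠ 0) (h2 : ∀ m : ℤ, |m| < n → theta q (x₂ * x₁⁻¹ * t ^ m) ≠ 0)
    (h3 : theta q (x₁ * B₂ * t ^ ((n : ℤ) - 1)) ≠ 0)
    (h4 : theta q (x₂ * B₂ * t ^ ((n : ℤ) - 1)) ≠ 0) :
    connRatio q t B₂ x₁ x₂ n i + connRatio q t B₂ x₂ x₁ n (n - i) = 1 := by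
  rcases Nat.eq_zero_or_pos i with rfl | hi0
  · rw [connRatio, if_pos rfl, connRatio, if_neg (by omega)]
    simp [theta_one hq0 hq1]
  rcases hi.eq_or_lt with rfl | hin
  · rw [connRatio, if_neg (by omega), connRatio, if_pos (by omega)]
    simp [theta_one hq0 hq1]
  rw [connRatio, if_neg (by omega), connRatio, if_neg (by omega)]
  have e0 : ((n - i : ℕ) : ℤ) = n - i := by omega
  rw [e0]
  set X := x₁ * B₂ * t ^ ((n : ℤ) - 1) with hX
  set Y := x₂ * B₂ * t ^ ((n : ℤ) - 1) with hY
  set Z := x₂ * x₁⁻¹ with hZ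
  set r := t ^ ((n : ℤ) - i) with hr
  set s := t ^ (i : ℤ) with hs
  have hX0 : X ≠ 0 := mul_ne_zero (mul_ne_zero hx₁ hB) (zpow_ne_zero _ ht)
  have hZ0 : Z ≠ 0 := mul_ne_zero hx₂ (inv_ne_zero hx₁)
  have hr0 : r ≠ 0 := zpow_ne_zero _ ht
  have hs0 : s ≠ 0 := zpow_ne_zero _ ht
  have hYX : Y = Z * X := by rw [hX, hY, hZ]; field_simp
  have f1 : x₁ * B₂ * t ^ ((n : ℤ) - 1 + i) = Z * (s / Z) * X := by
    rw [zpow_add₀ ht, hX, hs]; field_simp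
  have f2 : x₂ * B₂ * t ^ ((n : ℤ) - 1 - i) = X / (s / Z) := by
    rw [zpow_sub₀ ht, div_div_eq_mul_div, mul_comm X, ← hYX, hY, hs]; ring
  have f3 : x₂ * B₂ * t ^ ((n : ℤ) - 1 + (n - i)) = Z * r * X := by
    rw [zpow_add₀ ht, mul_right_comm Z, ← hYX, hY, hr]; ring
  have f4 : x₁ * B₂ * t ^ ((n : ℤ) - 1 - (n - i)) = X / r := by
    rw [zpow_sub₀ ht, hX, hr]; ring
  have f5 : t ^ ((n : ℤ) - (n - i)) = s := by rw [hs]; congr 1; ring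
  have f6 : x₁ * x₂⁻¹ * s = s / Z := by rw [hZ]; field_simp
  have f7 : Z * t ^ ((n : ℤ) - 2 * i) = r / (s / Z) := by
    rw [show (n : ℤ) - 2 * i = (n - i) - i by ring, zpow_sub₀ ht, div_div_eq_mul_div]
    ring
  have f8 : x₁ * x₂⁻¹ * t ^ ((n : ℤ) - 2 * (n - i)) = (s / Z) / r := by
    rw [show (n : ℤ) - 2 * (n - i) = i - (n - i) by ring, zpow_sub₀ ht, ← f6]
    ring
  have f9 : t ^ n = Z * r * (s / Z) := by
    rw [← zpow_natCast, show (n : ℤ) = (n - i) + i by ring, zpow_add₀ ht, ← hs, ← hr]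
    field_simp
  have hm := h2 ((n : ℤ) - 2 * i) (by rw [abs_lt]; constructor <;> omega)
  rw [f7] at hm
  rw [f9] at h1
  have hv0 : s / Z ≠ 0 := div_ne_zero hs0 hZ0
  have key := (isTheta_two hq0 hq1 hZ0 one_ne_zero).interpolation hq0 hq1 hZ0 hr0 hv0 hm h1 hX0
  rw [f1, f2, f3, f4, f5, f6, f7, f8, f9]
  simp only [mul_one, div_one] at key
  rw [← hYX, show Z * (s / Z) = s by field_simp] at key
  rw [show Z * (s / Z) = s by field_simp]
  have hm' : theta q (s / Z / r) ≠ 0 := by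
    rw [← inv_div, Ne, theta_inv_eq_zero_iff hq0 hq1 (div_ne_zero hr0 hv0)]
    exact hm
  generalize theta q (s / Z / r) = a1 at *
  generalize theta q (r / (s / Z)) = a2 at *
  generalize theta q (Z * r * (s / Z)) = a3 at *
  generalize theta q X = a4 at *
  generalize theta q Y = a5 at *
  generalize theta q (X / (s / Z)) = a6 at *
  generalize theta q (X / r) = a7 at *
  generalize theta q (s * X) = a8 at *
  generalize theta q (Z * r * X) = a9 at *
  generalize theta q r = a10 at *
  generalize theta q s = a11 at *
  generalize theta q (s / Z) = a12 at *
  generalize theta q (Z * r) = a13 at *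
  clear_value X Y Z r s
  field_simp at key ⊢
  first
    | linear_combination key
    | linear_combination -key

theorem prod_range_sub_shift {M : Type*} [CommMonoid M] (f : ℤ → M) (c : ℤ) (i : ℕ) :
    (∏ j ∈ range i, f (c - 1 - j)) * f c = (∏ j ∈ range i, f (c - j)) * f (c - i) := by
  rw [← prod_range_succ (fun j : ℕ => f (c - j)), prod_range_succ' (fun j : ℕ => f (c - j))]
  congr 1
  · refine prod_congr rfl fun j _ => ?_
    congr 1
    push_cast
    ring
  · simp

/-- The second factor on the left is the coefficient of `IsTheta.interpolation` at the node
`x₂ t^{n-i}`, with `y = B₁⁻¹` and second node `x₁ t^i`. -/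
theorem connCoeff_succ {q : ℝ} (hq0 : 0 < q) (hq1 : q < 1) {t B₁ B₂ x₁ x₂ : ℂ} (ht : t ≠ 0)
    (hB₁ : B₁ ≠ 0) (hx₁ : x₁ ≠ 0) (hx₂ : x₂ ≠ 0) {n i : ℕ} (hi : i ≤ n)
    (h1 : ∀ m ∈ Icc 1 (n + 1), theta q (t ^ m) ≠ 0)
    (h2 : ∀ m : ℤ, |m| < ((n + 1 : ℕ) : ℤ) → theta q (x₂ * x₁⁻¹ * t ^ m) ≠ 0)
    (h3 : ∀ m < n + 1, theta q (x₁ * B₂ * t ^ m) ≠ 0)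
    (h4 : ∀ m < n + 1, theta q (x₂ * B₂ * t ^ m) ≠ 0) :
    connCoeff q t (B₁ * t) B₂ x₁ x₂ n i *
        (x₂ * t ^ (n - i) / B₁⁻¹ * (theta q (B₁⁻¹ / (x₁ * t ^ i)) *
          theta q (B₁ * B₂ * t ^ n * (x₁ * t ^ i) * B₁⁻¹)) /
        (theta q (x₂ * t ^ (n - i) / (x₁ * t ^ i)) *
          theta q (B₁ * B₂ * t ^ n * (x₁ * t ^ i) * (x₂ * t ^ (n - i))))) =
      connCoeff q t B₁ B₂ x₁ x₂ (n + 1) i * connRatio q t B₂ x₁ x₂ (n + 1) i := by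
  have hti : ∀ m : ℤ, t ^ m ≠ 0 := fun m => zpow_ne_zero m ht
  -- the interpolation coefficient, with its monomial prefactors cancelled
  have hcoef : x₂ * t ^ (n - i) / B₁⁻¹ * (theta q (B₁⁻¹ / (x₁ * t ^ i)) *
          theta q (B₁ * B₂ * t ^ n * (x₁ * t ^ i) * B₁⁻¹)) /
        (theta q (x₂ * t ^ (n - i) / (x₁ * t ^ i)) *
          theta q (B₁ * B₂ * t ^ n * (x₁ * t ^ i) * (x₂ * t ^ (n - i)))) =
      theta q (x₁ * B₁ * t ^ (i : ℤ)) * theta q (x₁ * B₂ * t ^ ((n : ℤ) + i)) /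
        (theta q (x₁ * x₂⁻¹ * t ^ ((i : ℤ) - (n - i))) *
          theta q (x₁ * x₂ * B₁ * B₂ * t ^ (2 * (n : ℤ)))) := by
    have g1 : B₁⁻¹ / (x₁ * t ^ i) = (x₁ * B₁ * t ^ (i : ℤ))⁻¹ := by
      rw [zpow_natCast]; field_simp
    have g2 : B₁ * B₂ * t ^ n * (x₁ * t ^ i) * B₁⁻¹ = x₁ * B₂ * t ^ ((n : ℤ) + i) := by
      rw [zpow_add₀ ht, zpow_natCast, zpow_natCast]; field_simp
    have g3 : x₂ * t ^ (n - i) / (x₁ * t ^ i) = (x₁ * x₂⁻¹ * t ^ ((i : ℤ) - (n - i)))⁻¹ := by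
      rw [zpow_sub₀ ht, zpow_natCast, show (n : ℤ) - i = ((n - i : ℕ) : ℤ) by omega, zpow_natCast]
      field_simp
    have g4 : B₁ * B₂ * t ^ n * (x₁ * t ^ i) * (x₂ * t ^ (n - i)) =
        x₁ * x₂ * B₁ * B₂ * t ^ (2 * (n : ℤ)) := by
      have : t ^ n = t ^ i * t ^ (n - i) := by rw [← pow_add]; congr 1; omega
      rw [two_mul, zpow_add₀ ht, zpow_natCast]
      nth_rw 2 [this]
      ring
    rw [g1, g2, g3, g4, theta_inv hq0 hq1 (mul_ne_zero (mul_ne_zero hx₁ hB₁) (hti _)),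
      theta_inv hq0 hq1 (mul_ne_zero (mul_ne_zero hx₁ (inv_ne_zero hx₂)) (hti _))]
    have g5 : t ^ ((i : ℤ) - (n - i)) * t ^ (n - i) = t ^ i := by
      rw [show (n : ℤ) - i = ((n - i : ℕ) : ℤ) by omega, zpow_sub₀ ht, zpow_natCast, zpow_natCast]
      have := pow_ne_zero (n - i) ht
      field_simp
    have hm := h2 (-((i : ℤ) - (n - i))) (by rw [abs_lt]; push_cast; constructor <;> omega)
    have g6 : theta q (x₁ * x₂⁻¹ * t ^ ((i : ℤ) - (n - i))) ≠ 0 := by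
      have e : x₂ * x₁⁻¹ * t ^ (-((i : ℤ) - (n - i))) =
          (x₁ * x₂⁻¹ * t ^ ((i : ℤ) - (n - i)))⁻¹ := by
        rw [zpow_neg, mul_inv, mul_inv, inv_inv, mul_comm x₂]
      rw [e, Ne, theta_inv_eq_zero_iff hq0 hq1
        (mul_ne_zero (mul_ne_zero hx₁ (inv_ne_zero hx₂)) (hti _))] at hm
      exact hm
    have g7 : t ^ ((i : ℤ) - (n - i)) = t ^ i / t ^ (n - i) :=
      eq_div_of_mul_eq (pow_ne_zero _ ht) g5
    have g8 := hti ((i : ℤ) - (n - i))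
    generalize theta q (x₁ * B₁ * t ^ (i : ℤ)) = a1 at *
    generalize theta q (x₁ * x₂⁻¹ * t ^ ((i : ℤ) - (n - i))) = a2 at *
    generalize theta q (x₁ * x₂ * B₁ * B₂ * t ^ (2 * (n : ℤ))) = a3 at *
    generalize theta q (x₁ * B₂ * t ^ ((n : ℤ) + i)) = a4 at *
    rw [g7, zpow_natCast]
    field_simp
  rw [hcoef]
  clear hcoef
  have hT : ∀ m : ℕ, m ≤ n → theta q (t ^ (m + 1)) ≠ 0 := fun m hm =>
    h1 (m + 1) (mem_Icc.2 ⟨by omega, by omega⟩)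
  have hF' := h3 n (by omega)
  have hFn := h4 n (by omega)
  have hFi := h4 (n - i) (by omega)
  rw [← zpow_natCast] at hF' hFn hFi
  rw [show ((n - i : ℕ) : ℤ) = (n : ℤ) - i by omega] at hFi
  -- both coefficients, with the indices normalised
  have hL : connCoeff q t (B₁ * t) B₂ x₁ x₂ n i =
      (∏ j ∈ range i, (theta q (x₂ * B₁ * t ^ ((n : ℤ) - j)) *
          theta q (x₂ * B₂ * t ^ ((n : ℤ) - 1 - j))) /
        (theta q (t ^ (j + 1)) * theta q (x₂ * x₁⁻¹ * t ^ ((n : ℤ) + 1 - i - 1 - j)))) *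
      (∏ k ∈ range (n - i), (theta q (x₁ * B₁ * t ^ ((n : ℤ) - k)) *
          theta q (x₁ * B₂ * t ^ ((n : ℤ) - (k + 1 : ℕ)))) /
        (theta q (t ^ (k + 1)) * theta q (x₁ * x₂⁻¹ * t ^ ((i : ℤ) - k)))) *
      ∏ l ∈ range n, theta q (t ^ (l + 1)) / theta q (x₁ * x₂ * B₁ * B₂ * t ^ ((n : ℤ) + l)) := by
    rw [connCoeff, prod_Icc_one, prod_Icc_one, prod_Icc_one]
    have hz : ∀ u v w : ℂ, ∀ m : ℤ, u * (v * t) * w * t ^ m = u * v * w * t ^ (m + 1) := by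
      intro u v w m
      rw [zpow_add₀ ht, zpow_one]; ring
    have hz' : ∀ u v : ℂ, ∀ m : ℤ, u * (v * t) * t ^ m = u * v * t ^ (m + 1) := by
      intro u v m
      rw [zpow_add₀ ht, zpow_one]; ring
    refine congrArg₂ _ (congrArg₂ _ (prod_congr rfl fun j _ => ?_) (prod_congr rfl fun j _ => ?_))
      (prod_congr rfl fun j _ => ?_)
    · rw [hz', show (n : ℤ) - (j + 1 : ℕ) + 1 = n - j by push_cast; ring,
        show (n : ℤ) - (j + 1 : ℕ) = n - 1 - j by push_cast; ring,
        show (n : ℤ) - i - (j + 1 : ℕ) + 1 = n + 1 - i - 1 - j by push_cast; ring]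
    · rw [hz', show (n : ℤ) - (j + 1 : ℕ) + 1 = n - j by push_cast; ring,
        show (i : ℤ) - (j + 1 : ℕ) + 1 = i - j by push_cast; ring]
    · rw [hz, show (n : ℤ) + (j + 1 : ℕ) - 2 + 1 = n + j by push_cast; ring]
  have hR : connCoeff q t B₁ B₂ x₁ x₂ (n + 1) i =
      (∏ j ∈ range i, (theta q (x₂ * B₁ * t ^ ((n : ℤ) - j)) *
          theta q (x₂ * B₂ * t ^ ((n : ℤ) - j))) /
        (theta q (t ^ (j + 1)) * theta q (x₂ * x₁⁻¹ * t ^ ((n : ℤ) + 1 - i - j)))) *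
      (∏ k ∈ range (n - i + 1), (theta q (x₁ * B₁ * t ^ ((n : ℤ) - k)) *
          theta q (x₁ * B₂ * t ^ ((n : ℤ) - k))) /
        (theta q (t ^ (k + 1)) * theta q (x₁ * x₂⁻¹ * t ^ ((i : ℤ) - k)))) *
      ∏ l ∈ range (n + 1),
        theta q (t ^ (l + 1)) / theta q (x₁ * x₂ * B₁ * B₂ * t ^ ((n : ℤ) + l)) := by
    rw [connCoeff, prod_Icc_one, prod_Icc_one, prod_Icc_one, show n + 1 - i = n - i + 1 by omega]
    refine congrArg₂ _ (congrArg₂ _ (prod_congr rfl fun j _ => ?_) (prod_congr rfl fun j _ => ?_))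
      (prod_congr rfl fun j _ => ?_)
    · rw [show ((n + 1 : ℕ) : ℤ) - (j + 1 : ℕ) = n - j by push_cast; ring,
        show ((n + 1 : ℕ) : ℤ) - i - (j + 1 : ℕ) + 1 = n + 1 - i - j by push_cast; ring]
    · rw [show ((n + 1 : ℕ) : ℤ) - (j + 1 : ℕ) = n - j by push_cast; ring,
        show (i : ℤ) - (j + 1 : ℕ) + 1 = i - j by push_cast; ring]
    · rw [show ((n + 1 : ℕ) : ℤ) + (j + 1 : ℕ) - 2 = n + j by push_cast; ring]
  rw [hL, hR]
  clear hL hR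
  simp only [prod_div_distrib, prod_mul_distrib]
  rw [prod_range_succ (fun k : ℕ => theta q (x₁ * B₁ * t ^ ((n : ℤ) - k))),
    prod_range_succ' (fun k : ℕ => theta q (x₁ * B₂ * t ^ ((n : ℤ) - k))),
    prod_range_succ (fun k => theta q (t ^ (k + 1))) (n - i),
    prod_range_succ (fun k => theta q (t ^ (k + 1))) n,
    prod_range_succ (fun k : ℕ => theta q (x₁ * x₂⁻¹ * t ^ ((i : ℤ) - k))),
    prod_range_succ (fun k : ℕ => theta q (x₁ * x₂ * B₁ * B₂ * t ^ ((n : ℤ) + k)))]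
  have e1 : (n : ℤ) - (n - i : ℕ) = i := by omega
  have e2 : (i : ℤ) - (n - i : ℕ) = i - (n - i) := by omega
  have e3 : (n : ℤ) + n = 2 * n := by ring
  have e4 : (n : ℤ) - (0 : ℕ) = n := by simp
  rw [e1, e2, e3, e4]
  have hTn := hT n le_rfl
  have hTi := hT (n - i) (by omega)
  have hS2 := prod_range_sub_shift (fun e => theta q (x₂ * B₂ * t ^ e)) n i
  have hSG := prod_range_sub_shift (fun e => theta q (x₂ * x₁⁻¹ * t ^ e)) ((n : ℤ) + 1 - i) i
  rw [← eq_div_iff hFn] at hS2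
  rcases Nat.eq_zero_or_pos i with rfl | hi0
  · rw [connRatio, if_pos rfl]
    simp only [range_zero, prod_empty, Nat.cast_zero, add_zero, Nat.sub_zero, mul_one, one_mul,
      div_one]
    generalize theta q (t ^ (n + 1)) = T at *
    generalize theta q (x₁ * B₂ * t ^ (n : ℤ)) = F at *
    field_simp
  · have hG1 := h2 ((n : ℤ) + 1 - i) (by rw [abs_lt]; push_cast; constructor <;> omega)
    have hG2 := h2 ((n : ℤ) + 1 - i - i) (by rw [abs_lt]; push_cast; constructor <;> omega)
    rw [← eq_div_iff hG1] at hSG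
    rw [connRatio, if_neg (by omega), hS2, hSG]
    have e5 : ((n + 1 : ℕ) : ℤ) - 1 + i = n + i := by push_cast; ring
    have e6 : t ^ (n - i + 1) = t ^ ((n : ℤ) + 1 - i) := by
      rw [← zpow_natCast t (n - i + 1)]; congr 1; omega
    have e7 : ((n + 1 : ℕ) : ℤ) - 1 - i = n - i := by push_cast; ring
    have e8 : ((n + 1 : ℕ) : ℤ) - i = n + 1 - i := by push_cast; ring
    have e9 : ((n + 1 : ℕ) : ℤ) - 1 = n := by push_cast; ring
    have e10 : ((n + 1 : ℕ) : ℤ) - 2 * i = n + 1 - i - i := by push_cast; ring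
    rw [e6] at hTi ⊢
    rw [e5, e7, e8, e9, e10]
    generalize theta q (t ^ (n + 1)) = T at *
    generalize theta q (t ^ ((n : ℤ) + 1 - i)) = Ti at *
    generalize theta q (x₁ * B₂ * t ^ (n : ℤ)) = F' at *
    generalize theta q (x₂ * B₂ * t ^ (n : ℤ)) = Fn at *
    generalize theta q (x₂ * B₂ * t ^ ((n : ℤ) - i)) = Fi at *
    generalize theta q (x₂ * x₁⁻¹ * t ^ ((n : ℤ) + 1 - i)) = G1 at *
    generalize theta q (x₂ * x₁⁻¹ * t ^ ((n : ℤ) + 1 - i - i)) = G2 at *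
    clear hS2 hSG
    generalize ∏ x ∈ range i, theta q (x₂ * B₁ * t ^ ((n : ℤ) - x)) = p1
    generalize ∏ x ∈ range i, theta q (x₂ * B₂ * t ^ ((n : ℤ) - x)) = p2
    generalize ∏ x ∈ range i, theta q (t ^ (x + 1)) = p3
    generalize ∏ x ∈ range i, theta q (x₂ * x₁⁻¹ * t ^ ((n : ℤ) + 1 - i - x)) = p4
    generalize ∏ x ∈ range (n - i), theta q (x₁ * B₁ * t ^ ((n : ℤ) - x)) = p5
    generalize ∏ x ∈ range (n - i), theta q (x₁ * B₂ * t ^ ((n : ℤ) - (x + 1 : ℕ))) = p6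
    generalize ∏ x ∈ range (n - i), theta q (t ^ (x + 1)) = p7
    generalize ∏ x ∈ range (n - i), theta q (x₁ * x₂⁻¹ * t ^ ((i : ℤ) - x)) = p8
    generalize ∏ x ∈ range n, theta q (t ^ (x + 1)) = p9
    generalize ∏ x ∈ range n, theta q (x₁ * x₂ * B₁ * B₂ * t ^ ((n : ℤ) + x)) = p10
    generalize theta q (x₁ * B₁ * t ^ (i : ℤ)) = a1
    generalize theta q (x₁ * B₂ * t ^ ((n : ℤ) + i)) = a2
    generalize theta q (x₁ * x₂⁻¹ * t ^ ((i : ℤ) - (n - i))) = a3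
    generalize theta q (x₁ * x₂ * B₁ * B₂ * t ^ (2 * (n : ℤ))) = a4
    have key : ∀ u v : ℂ, v = u * (T * T⁻¹) * (Ti * Ti⁻¹) * (F' * F'⁻¹) → u = v := by
      rintro u v rfl
      rw [mul_inv_cancel₀ hTn, mul_inv_cancel₀ hTi, mul_inv_cancel₀ hF', mul_one, mul_one, mul_one]
    refine key _ _ ?_
    simp only [div_eq_mul_inv, mul_inv, inv_inv]
    ring

/-! ### Lists of points and the connection formula -/

/-- The symmetric function `symSum` as a function of a list of points. -/
def symList (q : ℝ) (a b : Fin 2 → ℂ) (t : ℂ) (l : List ℂ) : ℂ := symSum q a b t l.get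

theorem symSum_eq_symList {n : ℕ} (q : ℝ) (a b : Fin 2 → ℂ) (t : ℂ) {l : List ℂ} {x : Fin n → ℂ}
    (h : l.length = n) (hx : ∀ k : Fin n, x k = l.get (k.cast h.symm)) :
    symSum q a b t x = symList q a b t l := by
  subst h
  rw [symList]
  congr 1
  funext k
  exact hx k

theorem exists_equiv_of_perm {α : Type*} {l l' : List α} (h : l.Perm l') :
    ∃ σ : Fin l.length ≃ Fin l'.length, ∀ i, l.get i = l'.get (σ i) := by
  induction h with
  | nil => exact ⟨Equiv.refl _, fun i => rfl⟩
  | @cons x l₁ l₂ _ ih =>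
    obtain ⟨σ, hσ⟩ := ih
    refine ⟨(finSuccEquiv l₁.length).trans
      ((Equiv.optionCongr σ).trans (finSuccEquiv l₂.length).symm), fun i => ?_⟩
    refine Fin.cases (motive := fun i : Fin (l₁.length + 1) => (x :: l₁).get i =
      (x :: l₂).get (((finSuccEquiv l₁.length).trans
      ((Equiv.optionCongr σ).trans (finSuccEquiv l₂.length).symm)) i)) ?_ (fun j => ?_) i
    · simp
    · have := hσ j
      simp only [List.get_eq_getElem] at this
      simp [this]
  | swap x y l =>
    refine ⟨Equiv.swap (α := Fin (l.length + 2)) 0 1, fun i => ?_⟩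
    refine Fin.cases (motive := fun i : Fin (l.length + 2) => (y :: x :: l).get i =
      (x :: y :: l).get (Equiv.swap (α := Fin (l.length + 2)) 0 1 i)) ?_ (fun j => ?_) i
    · simp
    · refine Fin.cases (motive := fun j : Fin (l.length + 1) => (y :: x :: l).get j.succ =
        (x :: y :: l).get (Equiv.swap (α := Fin (l.length + 2)) 0 1 j.succ)) ?_ (fun k => ?_) j
      · simp
      · rw [Equiv.swap_apply_of_ne_of_ne]
        · simp
        · exact Fin.succ_ne_zero _
        · exact fun h => Fin.succ_ne_zero k (Fin.succ_injective _ h)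
  | trans _ _ ih₁ ih₂ =>
    obtain ⟨σ, hσ⟩ := ih₁
    obtain ⟨τ, hτ⟩ := ih₂
    exact ⟨σ.trans τ, fun i => by rw [hσ, hτ]; rfl⟩

theorem symList_perm {q : ℝ} (hq0 : 0 < q) (hq1 : q < 1) (a b : Fin 2 → ℂ) (t : ℂ)
    {l l' : List ℂ} (hl : ∀ x ∈ l, x ≠ 0) (h : l.Perm l') :
    symList q a b t l = symList q a b t l' := by
  obtain ⟨σ, hσ⟩ := exists_equiv_of_perm h.symm
  rw [← symSum_eq_symList q a b t (l := l') (x := l'.get ∘ finCongr h.length_eq)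
    h.length_eq.symm fun k => rfl]
  have e : l'.get ∘ finCongr h.length_eq = l.get ∘ ((finCongr h.length_eq).trans σ) :=
    funext fun k => hσ _
  rw [e, symSum_perm hq0 hq1 a b t fun i => hl _ (l.get_mem i)]
  rfl

/-- A list of points in general position: no theta function in the theta Vandermonde product
vanishes. -/
structure Regular (q : ℝ) (l : List ℂ) : Prop where
  ne_zero : ∀ x ∈ l, x ≠ 0
  pairwise : l.Pairwise fun x y => theta q (x / y) ≠ 0 ∧ theta q (y / x) ≠ 0

theorem Regular.perm {q : ℝ} {l l' : List ℂ} (h : Regular q l) (hl : l.Perm l') : Regular q l' :=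
  ⟨fun x hx => h.ne_zero x (hl.mem_iff.2 hx), (hl.pairwise_iff fun h => ⟨h.2, h.1⟩).1 h.pairwise⟩

theorem Regular.of_cons {q : ℝ} {y : ℂ} {l : List ℂ} (h : Regular q (y :: l)) : Regular q l :=
  ⟨fun x hx => h.ne_zero x (List.mem_cons_of_mem _ hx), (List.pairwise_cons.1 h.pairwise).2⟩

theorem Admissible.exists_slice_list {q : ℝ} {a b : Fin 2 → ℂ} {t : ℂ} {m : ℕ}
    (h : Admissible (m + 1) q a b t) {p : List ℂ} (hm : p.length = m) (hp : Regular q p) :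
    ∃ f, IsTheta q 2 (1 / (q * (b 0 * b 1 * t ^ m))) f ∧
      ∀ y, Regular q (y :: p) → symList q a b t (y :: p) = f y := by
  subst hm
  obtain ⟨f, hf, hfs⟩ := h.exists_slice (p := p.get) (fun j => hp.ne_zero _ (p.get_mem j))
    fun i j hij => by
      rcases lt_or_gt_of_ne hij with h | h
      · exact (List.pairwise_iff_get.1 hp.pairwise i j h).1
      · exact (List.pairwise_iff_get.1 hp.pairwise j i h).2
  refine ⟨f, hf, fun y hy => ?_⟩
  rw [← hfs y (hy.ne_zero y List.mem_cons_self) fun j =>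
    ((List.pairwise_cons.1 hy.pairwise).1 _ (p.get_mem j)).1]
  refine (symSum_eq_symList q a b t (l := y :: p) rfl fun k => ?_).symm
  refine Fin.cases ?_ (fun j => ?_) k
  · rfl
  · rfl

/-- The list `x, x r, …, x r^{m-1}`. -/
def geomList (x r : ℂ) (m : ℕ) : List ℂ := (List.range m).map fun k => x * r ^ k

@[simp]
theorem length_geomList (x r : ℂ) (m : ℕ) : (geomList x r m).length = m := by simp [geomList]

theorem geomList_succ (x r : ℂ) (m : ℕ) :
    geomList x r (m + 1) = geomList x r m ++ [x * r ^ m] := by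
  rw [geomList, List.range_succ, List.map_append]; rfl

theorem mem_geomList {x r : ℂ} {m : ℕ} {y : ℂ} :
    y ∈ geomList x r m ↔ ∃ k < m, y = x * r ^ k := by
  simp [geomList, eq_comm]

theorem geomList_pairwise {R : ℂ → ℂ → Prop} {x r : ℂ} {m : ℕ}
    (h : ∀ k l, k < l → l < m → R (x * r ^ k) (x * r ^ l)) : (geomList x r m).Pairwise R := by
  rw [geomList, List.pairwise_map]
  exact (List.pairwise_lt_range (n := m)).imp_of_mem fun {k l} _ hl hkl =>
    h k l hkl (List.mem_range.1 hl)

theorem regular_geomList {q : ℝ} (hq0 : 0 < q) (hq1 : q < 1) {x r : ℂ} {m : ℕ} (hx : x ≠ 0)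
    (hr : r ≠ 0) (h : ∀ k, 0 < k → k < m → theta q (r ^ k) ≠ 0) : Regular q (geomList x r m) := by
  refine ⟨fun y hy => ?_, geomList_pairwise fun k l hkl hl => ?_⟩
  · obtain ⟨k, _, rfl⟩ := mem_geomList.1 hy
    exact mul_ne_zero hx (pow_ne_zero _ hr)
  · have e : x * r ^ l / (x * r ^ k) = r ^ (l - k) := by
      rw [mul_div_mul_left _ _ hx, pow_sub₀ _ hr hkl.le, div_eq_mul_inv]
    have e' : x * r ^ k / (x * r ^ l) = (r ^ (l - k))⁻¹ := by rw [← e, inv_div]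
    rw [e, e', Ne, theta_inv_eq_zero_iff hq0 hq1 (pow_ne_zero _ hr)]
    exact ⟨h _ (by omega) (by omega), h _ (by omega) (by omega)⟩

theorem Regular.append {q : ℝ} (hq0 : 0 < q) (hq1 : q < 1) {l l' : List ℂ} (h : Regular q l)
    (h' : Regular q l') (hh : ∀ x ∈ l, ∀ y ∈ l', theta q (y / x) ≠ 0) : Regular q (l ++ l') := by
  refine ⟨fun x hx => ?_, List.pairwise_append.2 ⟨h.pairwise, h'.pairwise, fun x hx y hy => ?_⟩⟩
  · rcases List.mem_append.1 hx with hx | hx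
    · exact h.ne_zero x hx
    · exact h'.ne_zero x hx
  · refine ⟨?_, hh x hx y hy⟩
    rw [← inv_div, Ne, theta_inv_eq_zero_iff hq0 hq1 (div_ne_zero (h'.ne_zero y hy) (h.ne_zero x hx))]
    exact hh x hx y hy

/-- The points at which the connection formula is proved by induction: `m` points of the
progression with ratio `t⁻¹` starting at `y`, together with `ζ_i(x₁,x₂)` for `N` variables. -/
def connList (t y x₁ x₂ : ℂ) (m N i : ℕ) : List ℂ :=
  geomList y t⁻¹ m ++ (geomList x₁ t i ++ geomList x₂ t (N - i))

theorem length_connList (t y x₁ x₂ : ℂ) {m N i : ℕ} (hi : i ≤ N) :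
    (connList t y x₁ x₂ m N i).length = m + N := by
  simp [connList]; omega

theorem regular_connList {q : ℝ} (hq0 : 0 < q) (hq1 : q < 1) {t B x₁ x₂ : ℂ} {n : ℕ}
    (ht : t ≠ 0) (hB : B ≠ 0) (hx₁ : x₁ ≠ 0) (hx₂ : x₂ ≠ 0)
    (h1 : ∀ m ∈ Icc 1 n, theta q (t ^ m) ≠ 0)
    (h2 : ∀ m : ℤ, |m| < (n : ℤ) → theta q (x₂ * x₁⁻¹ * t ^ m) ≠ 0)
    (h3 : ∀ m < n, theta q (x₁ * B * t ^ m) ≠ 0 ∧ theta q (x₂ * B * t ^ m) ≠ 0)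
    {m N i : ℕ} (hi : i ≤ N) (hN : m + N = n) : Regular q (connList t B⁻¹ x₁ x₂ m N i) := by
  have ht' := inv_ne_zero ht
  have h1' : ∀ k, 0 < k → k < n → theta q (t ^ k) ≠ 0 := fun k hk hkn =>
    h1 k (mem_Icc.2 ⟨hk, hkn.le⟩)
  refine Regular.append hq0 hq1 (regular_geomList hq0 hq1 (inv_ne_zero hB) ht' fun k hk hkm => ?_)
    (Regular.append hq0 hq1 (regular_geomList hq0 hq1 hx₁ ht fun k hk hkm => h1' k hk (by omega))
      (regular_geomList hq0 hq1 hx₂ ht fun k hk hkm => h1' k hk (by omega)) ?_) ?_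
  · rw [inv_pow, Ne, theta_inv_eq_zero_iff hq0 hq1 (pow_ne_zero _ ht)]
    exact h1' k hk (by omega)
  · intro x hx y hy
    obtain ⟨k, hk, rfl⟩ := mem_geomList.1 hx
    obtain ⟨l, hl, rfl⟩ := mem_geomList.1 hy
    have e : x₂ * t ^ l / (x₁ * t ^ k) = x₂ * x₁⁻¹ * t ^ ((l : ℤ) - k) := by
      rw [zpow_sub₀ ht, zpow_natCast, zpow_natCast]; field_simp
    rw [e]
    exact h2 _ (by rw [abs_lt]; constructor <;> omega)
  · intro x hx y hy
    obtain ⟨k, hk, rfl⟩ := mem_geomList.1 hx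
    have e : ∀ z : ℂ, ∀ l : ℕ, z * t ^ l / (B⁻¹ * t⁻¹ ^ k) = z * B * t ^ (l + k) := fun z l => by
      rw [pow_add, inv_pow]; field_simp
    rcases List.mem_append.1 hy with hy | hy
    · obtain ⟨l, hl, rfl⟩ := mem_geomList.1 hy
      rw [e]
      exact (h3 _ (by omega)).1
    · obtain ⟨l, hl, rfl⟩ := mem_geomList.1 hy
      rw [e]
      exact (h3 _ (by omega)).2

theorem connList_perm_left (t y x₁ x₂ : ℂ) (m N i : ℕ) :
    (connList t y x₁ x₂ (m + 1) N i).Perm (y * t⁻¹ ^ m :: connList t y x₁ x₂ m N i) := by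
  rw [connList, geomList_succ, List.append_assoc, List.singleton_append]
  exact List.perm_middle

theorem connList_perm_first (t y x₁ x₂ : ℂ) (m N i : ℕ) :
    (connList t y x₁ x₂ m (N + 1) (i + 1)).Perm (x₁ * t ^ i :: connList t y x₁ x₂ m N i) := by
  rw [connList, geomList_succ, List.append_assoc, List.singleton_append, Nat.add_sub_add_right,
    connList]
  exact (List.perm_middle.append_left _).trans List.perm_middle

theorem connList_perm_second (t y x₁ x₂ : ℂ) (m : ℕ) {N i : ℕ} (hi : i ≤ N) :
    (connList t y x₁ x₂ m (N + 1) i).Perm (x₂ * t ^ (N - i) :: connList t y x₁ x₂ m N i) := by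
  rw [connList, Nat.succ_sub hi, geomList_succ, connList, ← List.append_assoc, ← List.append_assoc]
  exact (List.perm_append_singleton _ _).trans (List.Perm.cons _ (by rw [List.append_assoc]))

/-- One step of the connection formula: the interpolation formula for theta functions of degree two
expresses the sum at a point `y = 1/(b₁ t^m)` through those with `y` replaced by `x₁ t^i` or
`x₂ t^{N-i}`. -/
theorem Admissible.connection_step {q : ℝ} {a b : Fin 2 → ℂ} {t x₁ x₂ : ℂ} {n : ℕ}
    (h : Admissible n q a b t) (hx₁ : x₁ ≠ 0) (hx₂ : x₂ ≠ 0)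
    (h1 : ∀ m ∈ Icc 1 n, theta q (t ^ m) ≠ 0)
    (h2 : ∀ m : ℤ, |m| < (n : ℤ) → theta q (x₂ * x₁⁻¹ * t ^ m) ≠ 0)
    (h3 : ∀ l : Fin 2, ∀ m < n, theta q (x₁ * b l * t ^ m) ≠ 0 ∧ theta q (x₂ * b l * t ^ m) ≠ 0)
    (h4 : ∀ l ∈ Icc 1 n, theta q (x₁ * x₂ * b 0 * b 1 * t ^ ((n : ℤ) + l - 2)) ≠ 0)
    {m N i : ℕ} (hi : i ≤ N) (hN : m + N + 1 = n) :
    symList q a b t (connList t (b 0)⁻¹ x₁ x₂ (m + 1) N i) *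
        connCoeff q t (b 0 * t ^ (m + 1)) (b 1) x₁ x₂ N i =
      symList q a b t (connList t (b 0)⁻¹ x₁ x₂ m (N + 1) i) *
        (connCoeff q t (b 0 * t ^ m) (b 1) x₁ x₂ (N + 1) i * connRatio q t (b 1) x₁ x₂ (N + 1) i) +
      symList q a b t (connList t (b 0)⁻¹ x₁ x₂ m (N + 1) (i + 1)) *
        (connCoeff q t (b 0 * t ^ m) (b 1) x₁ x₂ (N + 1) (i + 1) *
          connRatio q t (b 1) x₂ x₁ (N + 1) (N + 1 - (i + 1))) := by
  have hq0 := h.q_pos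
  have hq1 := h.q_lt_one
  have ht := h.t_ne
  have hreg : ∀ {m N i : ℕ}, i ≤ N → m + N = n → Regular q (connList t (b 0)⁻¹ x₁ x₂ m N i) :=
    fun hi hN => regular_connList hq0 hq1 ht (h.b_ne 0) hx₁ hx₂ h1 h2 (h3 0) hi hN
  set p := connList t (b 0)⁻¹ x₁ x₂ m N i with hpdef
  have hpl : p.length = m + N := length_connList t _ _ _ hi
  have hry := (hreg (m := m + 1) hi (by omega)).perm (connList_perm_left t (b 0)⁻¹ x₁ x₂ m N i)
  have hru := (hreg (m := m) (N := N + 1) (i := i + 1) (by omega) (by omega)).perm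
    (connList_perm_first t (b 0)⁻¹ x₁ x₂ m N i)
  have hrv := (hreg (m := m) (N := N + 1) (i := i) (by omega) (by omega)).perm
    (connList_perm_second t (b 0)⁻¹ x₁ x₂ m hi)
  rw [← hpdef] at hry hru hrv
  have hadm : Admissible (m + N + 1) q a b t := hN ▸ h
  obtain ⟨f, hf, hfs⟩ := hadm.exists_slice_list hpl hry.of_cons
  have ey := symList_perm hq0 hq1 a b t (hreg (m := m + 1) hi (by omega)).ne_zero
    (connList_perm_left t (b 0)⁻¹ x₁ x₂ m N i)
  have eu := symList_perm hq0 hq1 a b t (hreg (m := m) (N := N + 1) (i := i + 1) (by omega)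
    (by omega)).ne_zero (connList_perm_first t (b 0)⁻¹ x₁ x₂ m N i)
  have ev := symList_perm hq0 hq1 a b t (hreg (m := m) (N := N + 1) (i := i) (by omega)
    (by omega)).ne_zero (connList_perm_second t (b 0)⁻¹ x₁ x₂ m hi)
  rw [← hpdef, hfs _ hry] at ey
  rw [← hpdef, hfs _ hru] at eu
  rw [← hpdef, hfs _ hrv] at ev
  rw [ey, eu, ev]
  have hB : b 0 * t ^ m ≠ 0 := mul_ne_zero (h.b_ne 0) (pow_ne_zero _ ht)
  have hc : b 0 * b 1 * t ^ (m + N) ≠ 0 :=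
    mul_ne_zero (mul_ne_zero (h.b_ne 0) (h.b_ne 1)) (pow_ne_zero _ ht)
  have hu0 : x₁ * t ^ i ≠ 0 := mul_ne_zero hx₁ (pow_ne_zero _ ht)
  have hv0 : x₂ * t ^ (N - i) ≠ 0 := mul_ne_zero hx₂ (pow_ne_zero _ ht)
  have huv : theta q (x₁ * t ^ i / (x₂ * t ^ (N - i))) ≠ 0 := by
    rw [← inv_div, Ne, theta_inv_eq_zero_iff hq0 hq1 (div_ne_zero hv0 hu0)]
    have e : x₂ * t ^ (N - i) / (x₁ * t ^ i) = x₂ * x₁⁻¹ * t ^ (((N - i : ℕ) : ℤ) - i) := by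
      rw [zpow_sub₀ ht, zpow_natCast, zpow_natCast]; field_simp
    rw [e]
    exact h2 _ (by rw [abs_lt]; constructor <;> omega)
  have hcuv : theta q (b 0 * b 1 * t ^ (m + N) * (x₁ * t ^ i) * (x₂ * t ^ (N - i))) ≠ 0 := by
    have := h4 (N + 1) (mem_Icc.2 ⟨by omega, by omega⟩)
    convert this using 2
    have e : (n : ℤ) + (N + 1 : ℕ) - 2 = ((m + N + (i + (N - i)) : ℕ) : ℤ) := by omega
    rw [e, zpow_natCast, pow_add t (m + N), pow_add t i]
    ring
  have hy : (b 0)⁻¹ * t⁻¹ ^ m = (b 0 * t ^ m)⁻¹ := by rw [mul_inv, inv_pow]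
  have key := hf.interpolation hq0 hq1 hc hu0 hv0 huv hcuv (inv_ne_zero hB)
  rw [hy, key]
  have h1' : ∀ k ∈ Icc 1 (N + 1), theta q (t ^ k) ≠ 0 := fun k hk =>
    h1 k (mem_Icc.2 ⟨(mem_Icc.1 hk).1, (mem_Icc.1 hk).2.trans (by omega)⟩)
  have c1 := connCoeff_succ hq0 hq1 (B₁ := b 0 * t ^ m) (B₂ := b 1) ht hB hx₁ hx₂ hi h1'
    (fun k hk => h2 k (hk.trans_le (by omega))) (fun k hk => (h3 1 k (by omega)).1)
    fun k hk => (h3 1 k (by omega)).2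
  have c2 := connCoeff_succ hq0 hq1 (B₁ := b 0 * t ^ m) (B₂ := b 1) ht hB hx₂ hx₁
    (Nat.sub_le N i) h1'
    (fun k hk => by
      have := h2 (-k) (by rw [abs_neg]; exact hk.trans_le (by omega))
      rwa [show x₂ * x₁⁻¹ * t ^ (-k) = (x₁ * x₂⁻¹ * t ^ k)⁻¹ by
        rw [zpow_neg, mul_inv, mul_inv, inv_inv, mul_comm x₂], Ne, theta_inv_eq_zero_iff hq0 hq1
        (mul_ne_zero (mul_ne_zero hx₁ (inv_ne_zero hx₂)) (zpow_ne_zero _ ht))] at this)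
    (fun k hk => (h3 1 k (by omega)).2) fun k hk => (h3 1 k (by omega)).1
  have e1 : N + 1 - (i + 1) = N - i := by omega
  have e2 : connCoeff q t (b 0 * t ^ m) (b 1) x₂ x₁ (N + 1) (N - i) =
      connCoeff q t (b 0 * t ^ m) (b 1) x₁ x₂ (N + 1) (i + 1) := by
    rw [← connCoeff_swap q t _ _ x₁ x₂ (show i + 1 ≤ N + 1 by omega), e1]
  have e3 : b 0 * t ^ m * b 1 * t ^ N = b 0 * b 1 * t ^ (m + N) := by rw [pow_add]; ring
  have e4 : N - (N - i) = i := by omega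
  rw [connCoeff_swap q t _ _ x₁ x₂ hi, e2, e4, e3,
    mul_right_comm (b 0 * b 1 * t ^ (m + N)) (x₂ * t ^ (N - i)) (x₁ * t ^ i)] at c2
  rw [e3] at c1
  have e5 : b 0 * t ^ m * t = b 0 * t ^ (m + 1) := by rw [pow_succ]; ring
  rw [e5] at c1 c2
  rw [e1, ← c1, ← c2]
  ring

/-- The connection formula: a combination of the sums at the points `ζ_i(x₁,x₂)` is the sum at the
truncation point `(1/b₁, 1/(b₁t), …)`. -/
theorem Admissible.connection {q : ℝ} {a b : Fin 2 → ℂ} {t x₁ x₂ : ℂ} {n : ℕ}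
    (h : Admissible n q a b t) (hx₁ : x₁ ≠ 0) (hx₂ : x₂ ≠ 0)
    (h1 : ∀ m ∈ Icc 1 n, theta q (t ^ m) ≠ 0)
    (h2 : ∀ m : ℤ, |m| < (n : ℤ) → theta q (x₂ * x₁⁻¹ * t ^ m) ≠ 0)
    (h3 : ∀ l : Fin 2, ∀ m < n, theta q (x₁ * b l * t ^ m) ≠ 0 ∧ theta q (x₂ * b l * t ^ m) ≠ 0)
    (h4 : ∀ l ∈ Icc 1 n, theta q (x₁ * x₂ * b 0 * b 1 * t ^ ((n : ℤ) + l - 2)) ≠ 0) :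
    ∑ i ∈ range (n + 1), symList q a b t (geomList x₁ t i ++ geomList x₂ t (n - i)) *
        connCoeff q t (b 0) (b 1) x₁ x₂ n i =
      symList q a b t (geomList (b 0)⁻¹ t⁻¹ n) := by
  have main : ∀ N m : ℕ, m + N = n →
      ∑ i ∈ range (N + 1), symList q a b t (connList t (b 0)⁻¹ x₁ x₂ m N i) *
        connCoeff q t (b 0 * t ^ m) (b 1) x₁ x₂ N i =
      symList q a b t (geomList (b 0)⁻¹ t⁻¹ n) := by
    intro N
    induction N with
    | zero =>
      intro m hm
      obtain rfl : m = n := hm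
      simp [connCoeff_zero, connList, geomList]
    | succ N ih =>
      intro m hm
      rw [← ih (m + 1) (by omega), sum_congr rfl fun i hi => h.connection_step hx₁ hx₂ h1 h2 h3 h4
        (Nat.lt_succ_iff.1 (mem_range.1 hi)) (by omega), sum_add_distrib]
      have hρ : ∀ i ≤ N + 1, connRatio q t (b 1) x₁ x₂ (N + 1) i +
          connRatio q t (b 1) x₂ x₁ (N + 1) (N + 1 - i) = 1 := fun i hi => by
        have e1 : ((N + 1 : ℕ) : ℤ) - 1 = (N : ℕ) := by push_cast; ring
        refine connRatio_add h.q_pos h.q_lt_one h.t_ne (h.b_ne 1) hx₁ hx₂ (Nat.succ_pos N) hi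
          (h1 _ (mem_Icc.2 ⟨by omega, by omega⟩)) (fun k hk => h2 k (hk.trans_le (by omega))) ?_ ?_
        · rw [e1, zpow_natCast]; exact (h3 1 N (by omega)).1
        · rw [e1, zpow_natCast]; exact (h3 1 N (by omega)).2
      have hl := hρ (N + 1) le_rfl
      have hf := hρ 0 (Nat.zero_le _)
      rw [Nat.sub_self] at hl
      rw [Nat.sub_zero] at hf
      have hl0 : connRatio q t (b 1) x₁ x₂ (N + 1) (N + 1) = 0 := by
        have : connRatio q t (b 1) x₂ x₁ (N + 1) 0 = 1 := if_pos rfl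
        linear_combination hl - this
      have hf0 : connRatio q t (b 1) x₂ x₁ (N + 1) (N + 1) = 0 := by
        have : connRatio q t (b 1) x₁ x₂ (N + 1) 0 = 1 := if_pos rfl
        linear_combination hf - this
      set Ψ : ℕ → ℂ := fun i => symList q a b t (connList t (b 0)⁻¹ x₁ x₂ m (N + 1) i) with hΨ
      set C : ℕ → ℂ := fun i => connCoeff q t (b 0 * t ^ m) (b 1) x₁ x₂ (N + 1) i with hC
      have s1 : ∑ i ∈ range (N + 1), Ψ i * (C i * connRatio q t (b 1) x₁ x₂ (N + 1) i) =
          ∑ i ∈ range (N + 2), Ψ i * (C i * connRatio q t (b 1) x₁ x₂ (N + 1) i) := by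
        rw [sum_range_succ _ (N + 1), hl0]; ring
      have s2 : ∑ i ∈ range (N + 1), Ψ (i + 1) *
          (C (i + 1) * connRatio q t (b 1) x₂ x₁ (N + 1) (N + 1 - (i + 1))) =
          ∑ i ∈ range (N + 2), Ψ i * (C i * connRatio q t (b 1) x₂ x₁ (N + 1) (N + 1 - i)) := by
        rw [sum_range_succ' _ (N + 1), Nat.sub_zero, hf0]; ring
      change ∑ i ∈ range (N + 2), Ψ i * C i = ∑ i ∈ range (N + 1), Ψ i * (C i * _) +
        ∑ i ∈ range (N + 1), Ψ (i + 1) * (C (i + 1) * _)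
      rw [s1, s2, ← sum_add_distrib]
      refine sum_congr rfl fun i hi => ?_
      rw [← mul_add, ← mul_add, hρ i (Nat.lt_succ_iff.1 (mem_range.1 hi)), mul_one]
  have := main n 0 (zero_add n)
  simpa [connList, geomList] using this

/-! ### Rational function identities -/

/-- The ratio `(z_i - t z_j)/(z_i - z_j)`. -/
def pairRatio {ι : Type*} (t : ℂ) (z : ι → ℂ) (i j : ι) : ℂ := (z i - t * z j) / (z i - z j)

theorem pairRatio_inv {ι : Type*} (t : ℂ) {z : ι → ℂ} (hz : Function.Injective z) (hz0 : ∀ i, z i ≠ 0)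
    {i j : ι} (hij : i ≠ j) : pairRatio t (fun i => (z i)⁻¹) i j = pairRatio t z j i := by
  have h1 : z j - z i ≠ 0 := sub_ne_zero.2 fun h => hij (hz h).symm
  have hi := hz0 i
  have hj := hz0 j
  have h2 : (z i)⁻¹ - (z j)⁻¹ ≠ 0 := by
    rw [inv_sub_inv hi hj]; exact div_ne_zero h1 (mul_ne_zero hi hj)
  rw [pairRatio, pairRatio, div_eq_div_iff h2 h1]
  field_simp

theorem pairRatio_swap {ι : Type*} {t : ℂ} (ht : t ≠ 0) (z : ι → ℂ) (i j : ι) :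
    pairRatio t z j i = t * pairRatio t⁻¹ z i j := by
  rw [pairRatio, pairRatio, ← neg_sub (z i) (z j), ← neg_sub (t * z i), neg_div_neg_eq, ← mul_div_assoc]
  congr 1
  field_simp

section Lagrange

variable {ι : Type*} [DecidableEq ι]

/-- Partial fraction expansion of `∏ (a - t z_j)/(a - z_j)` in the variable `a`. -/
theorem prod_partial_fraction (t : ℂ) {z : ι → ℂ} (hz : Function.Injective z) (K : Finset ι) {a : ℂ}
    (ha : ∀ i ∈ K, z i ≠ a) :
    ∏ j ∈ K, (a - t * z j) / (a - z j) =
      t ^ K.card + (1 - t) * a * ∑ i ∈ K, (∏ j ∈ K.erase i, pairRatio t z i j) / (a - z i) := by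
  induction K using Finset.induction_on generalizing a with
  | empty => simp
  | insert b K hb ih =>
    have hbz : ∀ i ∈ K, z i ≠ z b := fun i hi h => hb (hz h ▸ hi)
    have iha := ih fun i hi => ha i (mem_insert_of_mem hi)
    have ihb := ih hbz
    have hab : a - z b ≠ 0 := sub_ne_zero.2 (ha b (mem_insert_self _ _)).symm
    rw [prod_insert hb, sum_insert hb, erase_insert hb, card_insert_of_notMem hb]
    have e : ∀ i ∈ K, (∏ j ∈ (insert b K).erase i, pairRatio t z i j) / (a - z i) =
        (∏ j ∈ K.erase i, pairRatio t z i j) * ((1 - t) * z b / (z i - z b) +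
          (a - t * z b) / (a - z i)) / (a - z b) := by
      intro i hi
      have hib : i ≠ b := fun h => hb (h ▸ hi)
      have h1 : a - z i ≠ 0 := sub_ne_zero.2 (ha i (mem_insert_of_mem hi)).symm
      have h2 : z i - z b ≠ 0 := sub_ne_zero.2 (hbz i hi)
      rw [erase_insert_of_ne hib.symm, prod_insert fun h => hb (mem_of_mem_erase h)]
      simp only [pairRatio]
      generalize ∏ j ∈ K.erase i, (z i - t * z j) / (z i - z j) = A
      field_simp
      ring
    rw [sum_congr rfl e]
    have e2 : ∑ i ∈ K, (∏ j ∈ K.erase i, pairRatio t z i j) * ((1 - t) * z b / (z i - z b) +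
          (a - t * z b) / (a - z i)) / (a - z b) =
        (-((1 - t) * z b * ∑ i ∈ K, (∏ j ∈ K.erase i, pairRatio t z i j) / (z b - z i)) +
          (a - t * z b) * ∑ i ∈ K, (∏ j ∈ K.erase i, pairRatio t z i j) / (a - z i)) /
          (a - z b) := by
      rw [mul_sum, mul_sum, ← sum_neg_distrib, ← sum_add_distrib, sum_div]
      refine sum_congr rfl fun i hi => ?_
      have e3 : z b - z i = -(z i - z b) := by ring
      rw [e3, div_neg]
      ring
    rw [e2]
    simp only [pairRatio] at *
    generalize ∑ i ∈ K, (∏ j ∈ K.erase i, (z i - t * z j) / (z i - z j)) / (z b - z i) = S at *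
    generalize ∑ i ∈ K, (∏ j ∈ K.erase i, (z i - t * z j) / (z i - z j)) / (a - z i) = S' at *
    rw [iha, ihb]
    field_simp
    ring

/-- The two sums below are the residue sums of `∏ (y - t z_j)/(y - z_j)` against powers of `y`. -/
theorem sum_prod_pairRatio (t : ℂ) {z : ι → ℂ} (hz : Function.Injective z) (K : Finset ι) :
    ∑ i ∈ K, ∏ j ∈ K.erase i, pairRatio t z i j = ∑ k ∈ range K.card, t ^ k ∧
      ∑ i ∈ K, z i * ∏ j ∈ K.erase i, pairRatio t z i j = ∑ i ∈ K, z i := by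
  induction K using Finset.induction_on with
  | empty => simp
  | insert b K hb ih =>
    have hbz : ∀ i ∈ K, z i ≠ z b := fun i hi h => hb (hz h ▸ hi)
    have hpf := prod_partial_fraction t hz K hbz
    have hstep : ∀ i ∈ K, ∏ j ∈ (insert b K).erase i, pairRatio t z i j =
        (∏ j ∈ K.erase i, pairRatio t z i j) -
          (1 - t) * z b * ((∏ j ∈ K.erase i, pairRatio t z i j) / (z b - z i)) := by
      intro i hi
      have hib : i ≠ b := fun h => hb (h ▸ hi)
      have h2 : z i - z b ≠ 0 := sub_ne_zero.2 (hbz i hi)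
      rw [erase_insert_of_ne hib.symm, prod_insert fun h => hb (mem_of_mem_erase h),
        ← neg_sub (z i) (z b)]
      simp only [pairRatio]
      generalize ∏ j ∈ K.erase i, (z i - t * z j) / (z i - z j) = A
      field_simp
      ring
    have hstep' : ∀ i ∈ K, z i * ∏ j ∈ (insert b K).erase i, pairRatio t z i j =
        z i * (∏ j ∈ K.erase i, pairRatio t z i j) +
          (1 - t) * z b * (∏ j ∈ K.erase i, pairRatio t z i j) -
          (1 - t) * z b * z b * ((∏ j ∈ K.erase i, pairRatio t z i j) / (z b - z i)) := by
      intro i hi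
      have h2 : z b - z i ≠ 0 := sub_ne_zero.2 (hbz i hi).symm
      rw [hstep i hi]
      generalize ∏ j ∈ K.erase i, pairRatio t z i j = A
      field_simp
      ring
    have hR : ∏ j ∈ K, pairRatio t z b j = t ^ K.card + (1 - t) * z b *
        ∑ i ∈ K, (∏ j ∈ K.erase i, pairRatio t z i j) / (z b - z i) := hpf
    have hg : (1 - t) * ∑ k ∈ range K.card, t ^ k = 1 - t ^ K.card := mul_neg_geom_sum t _
    constructor
    · rw [sum_insert hb, sum_congr rfl hstep, sum_sub_distrib, ih.1, ← mul_sum, erase_insert hb,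
        card_insert_of_notMem hb, sum_range_succ, hR]
      ring
    · rw [sum_insert hb, sum_insert hb, sum_congr rfl hstep', sum_sub_distrib, sum_add_distrib,
        ih.2, ← mul_sum, ← mul_sum, ih.1, erase_insert hb, hR]
      linear_combination z b * hg

theorem sum_prod_pairRatio_swap (t : ℂ) {z : ι → ℂ} (hz : Function.Injective z)
    (hz0 : ∀ i, z i ≠ 0) (K : Finset ι) :
    ∑ i ∈ K, ∏ j ∈ K.erase i, pairRatio t z j i = ∑ k ∈ range K.card, t ^ k ∧
      ∑ i ∈ K, (z i)⁻¹ * ∏ j ∈ K.erase i, pairRatio t z j i = ∑ i ∈ K, (z i)⁻¹ := by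
  have h := sum_prod_pairRatio t (inv_injective.comp hz) K
  have e : ∀ i ∈ K, ∏ j ∈ K.erase i, pairRatio t (Inv.inv ∘ z) i j =
      ∏ j ∈ K.erase i, pairRatio t z j i := fun i _ => prod_congr rfl fun j hj =>
    pairRatio_inv t hz hz0 (ne_of_mem_erase hj).symm
  rw [sum_congr rfl e, sum_congr rfl fun i hi => congrArg _ (e i hi)] at h
  exact h

theorem sum_mul_prod_pairRatio_swap {t : ℂ} (ht : t ≠ 0) {z : ι → ℂ} (hz : Function.Injective z)
    (K : Finset ι) :
    ∑ i ∈ K, z i * ∏ j ∈ K.erase i, pairRatio t z j i = t ^ (K.card - 1) * ∑ i ∈ K, z i := by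
  rw [← (sum_prod_pairRatio t⁻¹ hz K).2, mul_sum]
  refine sum_congr rfl fun i hi => ?_
  simp only [pairRatio_swap ht z i, prod_mul_distrib, prod_const, card_erase_of_mem hi]
  ring

theorem sum_inv_mul_prod_pairRatio {t : ℂ} (ht : t ≠ 0) {z : ι → ℂ} (hz : Function.Injective z)
    (hz0 : ∀ i, z i ≠ 0) (K : Finset ι) :
    ∑ i ∈ K, (z i)⁻¹ * ∏ j ∈ K.erase i, pairRatio t z i j =
      t ^ (K.card - 1) * ∑ i ∈ K, (z i)⁻¹ := by
  have h := sum_mul_prod_pairRatio_swap ht (inv_injective.comp hz) K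
  simp only [Function.comp_apply] at h
  rw [← h]
  refine sum_congr rfl fun i _ => congrArg _ (prod_congr rfl fun j hj => ?_)
  exact (pairRatio_inv t hz hz0 (ne_of_mem_erase hj)).symm

end Lagrange

section Subsets

variable {ι : Type*} [Fintype ι] [DecidableEq ι]

theorem sum_powersetCard_succ {M : Type*} [AddCommMonoid M] (r : ℕ) (F : Finset ι → ι → M) :
    ∑ I ∈ powersetCard r univ, ∑ i ∈ Iᶜ, F I i =
      ∑ L ∈ powersetCard (r + 1) univ, ∑ i ∈ L, F (L.erase i) i := by
  rw [sum_sigma', sum_sigma']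
  refine sum_bij' (fun p _ => ⟨insert p.2 p.1, p.2⟩) (fun p _ => ⟨p.1.erase p.2, p.2⟩) ?_ ?_ ?_ ?_ ?_
  · rintro ⟨I, i⟩ h
    simp only [mem_sigma, mem_powersetCard_univ, mem_compl] at h ⊢
    exact ⟨by rw [card_insert_of_notMem h.2, h.1], mem_insert_self _ _⟩
  · rintro ⟨L, i⟩ h
    simp only [mem_sigma, mem_powersetCard_univ, mem_compl] at h ⊢
    exact ⟨by rw [card_erase_of_mem h.2, h.1]; rfl, notMem_erase _ _⟩
  · rintro ⟨I, i⟩ h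
    simp only [mem_sigma, mem_powersetCard_univ, mem_compl] at h
    simp [erase_insert h.2]
  · rintro ⟨L, i⟩ h
    simp only [mem_sigma, mem_powersetCard_univ] at h
    simp [insert_erase h.2]
  · rintro ⟨I, i⟩ h
    simp only [mem_sigma, mem_powersetCard_univ, mem_compl] at h
    simp [erase_insert h.2]

/-- The weight `∏_{i ∈ I} u_i ∏_{j ∉ I, i ∈ I} (z_j - t z_i)/(z_j - z_i)` of a subset. -/
def subsetWeight (t : ℂ) (z u : ι → ℂ) (I : Finset ι) : ℂ :=
  (∏ i ∈ I, u i) * ∏ j ∈ Iᶜ, ∏ k ∈ I, pairRatio t z j k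

/-- The weight of the pair of disjoint sets `I` and `(I ∪ {i})ᶜ`. -/
def pairWeight (t : ℂ) (z u : ι → ℂ) (I : Finset ι) (i : ι) : ℂ :=
  (∏ k ∈ I, u k) * ∏ j ∈ Iᶜ.erase i, ∏ k ∈ I, pairRatio t z j k

theorem subsetWeight_eq_left (t : ℂ) (z u : ι → ℂ) {I : Finset ι} {i : ι} (hi : i ∈ Iᶜ) :
    subsetWeight t z u I = pairWeight t z u I i * ∏ k ∈ I, pairRatio t z i k := by
  rw [subsetWeight, pairWeight, ← mul_prod_erase _ _ hi]
  ring

theorem subsetWeight_eq_right (t : ℂ) (z u : ι → ℂ) {L : Finset ι} {i : ι} (hi : i ∈ L) :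
    subsetWeight t z u L = pairWeight t z u (L.erase i) i * (u i * ∏ j ∈ Lᶜ, pairRatio t z j i) := by
  have e : (L.erase i)ᶜ.erase i = Lᶜ := by
    ext j; by_cases h : j = i <;> simp [h, hi]
  rw [subsetWeight, pairWeight, e, ← mul_prod_erase _ _ hi]
  have : ∀ j ∈ Lᶜ, ∏ k ∈ L, pairRatio t z j k =
      pairRatio t z j i * ∏ k ∈ L.erase i, pairRatio t z j k := fun j _ =>
    (mul_prod_erase _ _ hi).symm
  rw [prod_congr rfl this, prod_mul_distrib]
  ring

/-- The weighted sum of the subsets of a given cardinality. -/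
def subsetSum (t : ℂ) (z u : ι → ℂ) (r : ℕ) : ℂ :=
  ∑ I ∈ powersetCard r univ, subsetWeight t z u I

theorem subsetSum_zero (t : ℂ) (z u : ι → ℂ) : subsetSum t z u 0 = 1 := by
  simp [subsetSum, subsetWeight]

theorem subsetSum_card (t : ℂ) (z u : ι → ℂ) :
    subsetSum t z u (Fintype.card ι) = ∏ i, u i := by
  rw [subsetSum, ← card_univ, powersetCard_self]
  simp [subsetWeight]

/-- Moving an element from the complement of a subset into the subset. -/
theorem sum_subsetWeight_move (t : ℂ) (z u φ : ι → ℂ) (r : ℕ) :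
    ∑ I ∈ powersetCard r univ, subsetWeight t z u I *
        ∑ i ∈ Iᶜ, u i * φ i * ∏ j ∈ Iᶜ.erase i, pairRatio t z j i =
      ∑ L ∈ powersetCard (r + 1) univ, subsetWeight t z u L *
        ∑ i ∈ L, φ i * ∏ j ∈ L.erase i, pairRatio t z i j := by
  simp only [mul_sum]
  rw [sum_powersetCard_succ r fun I i => subsetWeight t z u I *
    (u i * φ i * ∏ j ∈ Iᶜ.erase i, pairRatio t z j i)]
  refine sum_congr rfl fun L _ => sum_congr rfl fun i hi => ?_
  have e : (L.erase i)ᶜ.erase i = Lᶜ := by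
    ext j; by_cases h : j = i <;> simp [h, hi]
  rw [subsetWeight_eq_left t z u (i := i) (by simp), subsetWeight_eq_right t z u hi, e]
  ring

/-- The bracket on the left comes from a difference of the summand in the direction `i`, so that the
left side sums to zero over the lattice. The identity evaluates it through two consecutive weighted
subset sums, and thereby gives a two-term recurrence for their moments. -/
theorem subset_telescoping {t : ℂ} (ht : t ≠ 0) (γ : ℂ) {z : ι → ℂ}
    (hz : Function.Injective z) (hz0 : ∀ i, z i ≠ 0) (α₁ α₂ δ : ℂ) {r m : ℕ}
    (hr : r + m + 1 = Fintype.card ι) :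
    t ^ m * γ * ∑ I ∈ powersetCard r univ, ∑ i ∈ Iᶜ, pairWeight t z (fun i => 1 - γ * z i) I i *
        ((z i)⁻¹ * ((1 - α₁ * z i) * (1 - α₂ * z i)) * ∏ j ∈ univ.erase i, pairRatio t z i j -
          t ^ (r + m) * ((z i)⁻¹ * ((1 - δ * z i) * (1 - γ * z i))) *
            ∏ j ∈ univ.erase i, pairRatio t z j i) =
      (∑ k ∈ range (m + 1), t ^ k) * ((t ^ m * γ - α₁) * (t ^ m * γ - α₂)) *
          subsetSum t z (fun i => 1 - γ * z i) r -
        (∑ k ∈ range (r + 1), t ^ k) * (α₁ * α₂ - t ^ (r + m + m) * (γ * δ)) *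
          subsetSum t z (fun i => 1 - γ * z i) (r + 1) := by
  set u : ι → ℂ := fun i => 1 - γ * z i with hu
  set s : ℂ := ∑ k ∈ range (m + 1), t ^ k with hs
  set s' : ℂ := ∑ k ∈ range (r + 1), t ^ k with hs'
  clear_value s s'
  have hcard : ∀ I ∈ powersetCard r (univ : Finset ι), Iᶜ.card = m + 1 := fun I hI => by
    rw [card_compl, (mem_powersetCard_univ.1 hI)]; omega
  have hcard' : ∀ L ∈ powersetCard (r + 1) (univ : Finset ι), L.card = r + 1 := fun L hL =>
    mem_powersetCard_univ.1 hL
  -- The four sums occurring in the identity.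
  set Y := subsetSum t z u r with hY
  set Y' := subsetSum t z u (r + 1) with hY'
  set Z := ∑ I ∈ powersetCard r univ, subsetWeight t z u I * ∑ i ∈ Iᶜ, z i with hZ
  set V := ∑ I ∈ powersetCard r univ, subsetWeight t z u I * ∑ i ∈ Iᶜ, (z i)⁻¹ with hV
  set V' := ∑ L ∈ powersetCard (r + 1) univ, subsetWeight t z u L * ∑ i ∈ L, (z i)⁻¹ with hV'
  have m1 : V - γ * s * Y = t ^ r * V' := by
    have h := sum_subsetWeight_move t z u (fun i => (z i)⁻¹) r
    have hl : ∀ I ∈ powersetCard r (univ : Finset ι), subsetWeight t z u I *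
        ∑ i ∈ Iᶜ, u i * (z i)⁻¹ * ∏ j ∈ Iᶜ.erase i, pairRatio t z j i =
        subsetWeight t z u I * (∑ i ∈ Iᶜ, (z i)⁻¹) - γ * s * subsetWeight t z u I := by
      intro I hI
      have h1 := sum_prod_pairRatio_swap t hz hz0 Iᶜ
      rw [hcard I hI] at h1
      have h2 : ∑ i ∈ Iᶜ, u i * (z i)⁻¹ * ∏ j ∈ Iᶜ.erase i, pairRatio t z j i =
          ∑ i ∈ Iᶜ, (z i)⁻¹ * ∏ j ∈ Iᶜ.erase i, pairRatio t z j i -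
            γ * ∑ i ∈ Iᶜ, ∏ j ∈ Iᶜ.erase i, pairRatio t z j i := by
        rw [mul_sum, ← sum_sub_distrib]
        refine sum_congr rfl fun i _ => ?_
        have := hz0 i
        simp only [hu]
        field_simp
      rw [h2, h1.1, h1.2, ← hs]; ring
    have hr' : ∀ L ∈ powersetCard (r + 1) (univ : Finset ι), subsetWeight t z u L *
        ∑ i ∈ L, (z i)⁻¹ * ∏ j ∈ L.erase i, pairRatio t z i j =
        t ^ r * (subsetWeight t z u L * ∑ i ∈ L, (z i)⁻¹) := by
      intro L hL
      rw [sum_inv_mul_prod_pairRatio ht hz hz0, hcard' L hL, Nat.add_sub_cancel]; ring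
    rw [sum_congr rfl hl, sum_congr rfl hr', sum_sub_distrib, ← mul_sum, ← mul_sum] at h
    exact h
  have m2 : s * Y - γ * t ^ m * Z = s' * Y' := by
    have h := sum_subsetWeight_move t z u (fun _ => 1) r
    have hl : ∀ I ∈ powersetCard r (univ : Finset ι), subsetWeight t z u I *
        ∑ i ∈ Iᶜ, u i * 1 * ∏ j ∈ Iᶜ.erase i, pairRatio t z j i =
        s * subsetWeight t z u I - γ * t ^ m * (subsetWeight t z u I * (∑ i ∈ Iᶜ, z i)) := by
      intro I hI
      have h1 := (sum_prod_pairRatio_swap t hz hz0 Iᶜ).1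
      have h3 := sum_mul_prod_pairRatio_swap ht hz Iᶜ
      rw [hcard I hI] at h1 h3
      have h2 : ∑ i ∈ Iᶜ, u i * 1 * ∏ j ∈ Iᶜ.erase i, pairRatio t z j i =
          ∑ i ∈ Iᶜ, ∏ j ∈ Iᶜ.erase i, pairRatio t z j i -
            γ * ∑ i ∈ Iᶜ, z i * ∏ j ∈ Iᶜ.erase i, pairRatio t z j i := by
        rw [mul_sum, ← sum_sub_distrib]
        refine sum_congr rfl fun i _ => ?_
        simp only [hu]
        ring
      rw [h2, h1, h3, Nat.add_sub_cancel, ← hs]; ring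
    have hr' : ∀ L ∈ powersetCard (r + 1) (univ : Finset ι), subsetWeight t z u L *
        ∑ i ∈ L, 1 * ∏ j ∈ L.erase i, pairRatio t z i j = s' * subsetWeight t z u L := by
      intro L hL
      simp only [one_mul]
      rw [(sum_prod_pairRatio t hz L).1, hcard' L hL, ← hs']; ring
    rw [sum_congr rfl hl, sum_congr rfl hr', sum_sub_distrib, ← mul_sum, ← mul_sum, ← mul_sum] at h
    exact h
  -- The two halves of the left-hand side.
  have p1 : ∑ I ∈ powersetCard r univ, ∑ i ∈ Iᶜ, pairWeight t z u I i *
      ((z i)⁻¹ * ((1 - α₁ * z i) * (1 - α₂ * z i)) * ∏ j ∈ univ.erase i, pairRatio t z i j) =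
      t ^ m * V - (α₁ + α₂) * s * Y + α₁ * α₂ * Z := by
    rw [hV, hY, hZ, subsetSum, mul_sum, mul_sum, mul_sum, ← sum_sub_distrib, ← sum_add_distrib]
    refine sum_congr rfl fun I hI => ?_
    have h1 := sum_prod_pairRatio t hz Iᶜ
    have h2 := sum_inv_mul_prod_pairRatio ht hz hz0 Iᶜ
    rw [hcard I hI] at h1 h2
    rw [Nat.add_sub_cancel] at h2
    rw [show t ^ m * (subsetWeight t z u I * ∑ i ∈ Iᶜ, (z i)⁻¹) =
      subsetWeight t z u I * (t ^ m * ∑ i ∈ Iᶜ, (z i)⁻¹) by ring, ← h2, ← h1.2, hs, ← h1.1,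
      show ∀ a b c d e : ℂ, d * a - b * c * d + α₁ * α₂ * (d * e) =
        d * (a - b * c + α₁ * α₂ * e) by intros; ring, mul_sum (a := α₁ + α₂),
        mul_sum (a := α₁ * α₂), ← sum_sub_distrib, ← sum_add_distrib, mul_sum]
    refine sum_congr rfl fun i hi => ?_
    have e : univ.erase i = I ∪ Iᶜ.erase i := by
      ext j
      by_cases hj : j = i
      · subst hj; simpa using hi
      · simp [hj, em]
    have hd : Disjoint I (Iᶜ.erase i) :=
      disjoint_of_subset_right (erase_subset _ _) disjoint_compl_right
    rw [e, prod_union hd, subsetWeight_eq_left t z u hi]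
    have := hz0 i
    field_simp
    ring
  have p2 : ∑ I ∈ powersetCard r univ, ∑ i ∈ Iᶜ, pairWeight t z u I i *
      (t ^ (r + m) * ((z i)⁻¹ * ((1 - δ * z i) * (1 - γ * z i))) *
        ∏ j ∈ univ.erase i, pairRatio t z j i) = t ^ (r + m) * (V' - δ * s' * Y') := by
    rw [sum_powersetCard_succ r fun I i => pairWeight t z u I i *
      (t ^ (r + m) * ((z i)⁻¹ * ((1 - δ * z i) * (1 - γ * z i))) *
        ∏ j ∈ univ.erase i, pairRatio t z j i)]
    rw [hV', hY', subsetSum, mul_sum, ← sum_sub_distrib, mul_sum]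
    refine sum_congr rfl fun L hL => ?_
    have h1 := sum_prod_pairRatio_swap t hz hz0 L
    rw [hcard' L hL] at h1
    rw [← h1.2, hs', ← h1.1, show ∀ a b c d : ℂ, a * (d * b - δ * c * d) = a * (d * (b - δ * c)) by
      intros; ring, mul_sum (a := δ), ← sum_sub_distrib, mul_sum, mul_sum]
    refine sum_congr rfl fun i hi => ?_
    have e : univ.erase i = Lᶜ ∪ L.erase i := by
      ext j
      by_cases hj : j = i
      · subst hj; simpa using hi
      · simp [hj, em']
    have hd : Disjoint Lᶜ (L.erase i) :=
      disjoint_of_subset_right (erase_subset _ _) disjoint_compl_left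
    rw [e, prod_union hd, subsetWeight_eq_right t z u hi]
    have := hz0 i
    simp only [hu]
    field_simp
  have hsplit : ∀ f g : Finset ι → ι → ℂ, ∑ I ∈ powersetCard r univ, ∑ i ∈ Iᶜ,
      pairWeight t z u I i * (f I i - g I i) =
      ∑ I ∈ powersetCard r univ, ∑ i ∈ Iᶜ, pairWeight t z u I i * f I i -
        ∑ I ∈ powersetCard r univ, ∑ i ∈ Iᶜ, pairWeight t z u I i * g I i := by
    intro f g
    simp only [mul_sub, sum_sub_distrib]
  rw [hsplit, p1, p2]
  have hp : t ^ (r + m) = t ^ r * t ^ m := pow_add _ _ _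
  have hp' : t ^ (r + m + m) = t ^ r * t ^ m * t ^ m := by rw [pow_add, pow_add]
  rw [hp, hp']
  clear_value Y Y' Z V V'
  linear_combination (t ^ m * γ * t ^ m) * m1 - α₁ * α₂ * m2

end Subsets

/-! ### Difference equations of the summand -/

theorem oneBody_succ {q : ℝ} (hq0 : 0 < q) (hq1 : q < 1) (a : Fin 2 → ℂ) {b : Fin 2 → ℂ}
    (hb : ∀ l, b l ≠ 0) {c x : ℂ} (hc : c ≠ 0) (hx : x ≠ 0) (k : ℤ) :
    oneBody q a b c x (k + 1) * ∏ l, (1 - q * (a l)⁻¹ * (x * (q : ℂ) ^ k)) =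
      c * (∏ l, (1 - b l * (x * (q : ℂ) ^ k))) * oneBody q a b c x k := by
  have hq : (q : ℂ) ≠ 0 := by exact_mod_cast hq0.ne'
  set z := x * (q : ℂ) ^ k with hz
  have hz0 : z ≠ 0 := mul_ne_zero hx (zpow_ne_zero _ hq)
  have e : x * (q : ℂ) ^ (k + 1) = q * z := by rw [zpow_add₀ hq, zpow_one, hz]; ring
  have key : ∀ l, qInf q (q * (a l)⁻¹ * (q * z)) * (thetaMult q (b l * x) (k + 1) *
      qInf q (q / (b l * (q * z)))) * (1 - q * (a l)⁻¹ * z) =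
      (1 - b l * z) * (qInf q (q * (a l)⁻¹ * z) * (thetaMult q (b l * x) k *
        qInf q (q / (b l * z)))) := by
    intro l
    have h1 := qInf_step hq0 hq1 (q * (a l)⁻¹ * z)
    have e2 : (q : ℂ) / (b l * (q * z)) = (b l * z)⁻¹ := by field_simp
    have h2 := qInf_step hq0 hq1 (b l * z)⁻¹
    rw [← div_eq_mul_inv] at h2
    have hbz : b l * z ≠ 0 := mul_ne_zero (hb l) hz0
    rw [thetaMult_succ hq0 (mul_ne_zero (hb l) hx), e2, h2, h1,
      show q * (a l)⁻¹ * (q * z) = q * (q * (a l)⁻¹ * z) by ring, mul_assoc (b l) x, ← hz]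
    have h3 : -(b l * z) * (1 - (b l * z)⁻¹) = 1 - b l * z := by
      rw [mul_sub, neg_mul, neg_mul, mul_inv_cancel₀ hbz]; ring
    linear_combination (qInf q (q * (q * (a l)⁻¹ * z)) * thetaMult q (b l * x) k *
      qInf q (q / (b l * z)) * (1 - q * (a l)⁻¹ * z)) * h3
  rw [oneBody, oneBody, e, ← hz, zpow_add₀ hc, zpow_one, mul_assoc, ← prod_mul_distrib,
    prod_congr rfl fun l _ => key l, prod_mul_distrib]
  ring

theorem twoBody_succ {q : ℝ} (hq0 : 0 < q) (hq1 : q < 1) {t x y : ℂ} (ht : t ≠ 0) (hx : x ≠ 0)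
    (hy : y ≠ 0) (k l : ℤ) :
    twoBody q t x (k + 1) y l * ((x * (q : ℂ) ^ k - y * (q : ℂ) ^ l) *
        (q * (x * (q : ℂ) ^ k) - t * (y * (q : ℂ) ^ l))) =
      twoBody q t x k y l * ((q * (x * (q : ℂ) ^ k) - y * (q : ℂ) ^ l) *
        (t * (x * (q : ℂ) ^ k) - y * (q : ℂ) ^ l)) := by
  have hq : (q : ℂ) ≠ 0 := by exact_mod_cast hq0.ne'
  set Z := x * (q : ℂ) ^ k with hZ
  set Y := y * (q : ℂ) ^ l with hY
  have hZ0 : Z ≠ 0 := mul_ne_zero hx (zpow_ne_zero _ hq)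
  have hY0 : Y ≠ 0 := mul_ne_zero hy (zpow_ne_zero _ hq)
  have hv : y / x * (q : ℂ) ^ (l - k) = Y / Z := by
    rw [zpow_sub₀ hq, hY, hZ]; field_simp
  have hv' : y / x * (q : ℂ) ^ (l - (k + 1)) = Y / (q * Z) := by
    rw [zpow_sub₀ hq, zpow_add₀ hq, zpow_one, hY, hZ]; field_simp
  have hm := thetaMult_succ hq0 (div_ne_zero hy hx) (l - (k + 1))
  rw [show l - (k + 1) + 1 = l - k by ring, hv'] at hm
  have h1 := qInf_step hq0 hq1 (q * t⁻¹ * (Y / (q * Z)))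
  have h2 := qInf_step hq0 hq1 (q / (t * (Y / Z)))
  have e1 : (q : ℂ) * (q * t⁻¹ * (Y / (q * Z))) = q * t⁻¹ * (Y / Z) := by field_simp
  have e2 : (q : ℂ) * (q / (t * (Y / Z))) = q / (t * (Y / (q * Z))) := by field_simp
  rw [e1] at h1
  rw [e2] at h2
  rw [twoBody, twoBody, hv, hv', hm, h1, h2]
  generalize qInf q (q * t⁻¹ * (Y / Z)) = A
  generalize qInf q (q / (t * (Y / (q * Z)))) = B
  generalize thetaMult q (y / x) (l - (k + 1)) = M
  clear_value Y Z
  field_simp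
  ring

theorem prod_erase_zero {m : ℕ} {M : Type*} [CommMonoid M] (f : Fin (m + 1) → M) :
    ∏ j ∈ univ.erase 0, f j = ∏ j : Fin m, f j.succ := by
  rw [Fin.univ_succ, erase_cons, prod_map]
  rfl

theorem term_succ {n : ℕ} {q : ℝ} (hq0 : 0 < q) (hq1 : q < 1) (a : Fin 2 → ℂ) {b : Fin 2 → ℂ}
    (hb : ∀ l, b l ≠ 0) {t : ℂ} (ht : t ≠ 0) {x : Fin n → ℂ} (hx : ∀ i, x i ≠ 0) (ν : Fin n → ℤ)
    (i : Fin n) :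
    term q a b t x (ν + Pi.single i 1) * ((∏ l, (1 - q * (a l)⁻¹ * qShift q x ν i)) *
        ∏ j ∈ univ.erase i, ((qShift q x ν i - qShift q x ν j) *
          (q * qShift q x ν i - t * qShift q x ν j))) =
      term q a b t x ν * (q * t ^ (n - 1) * (∏ l, (1 - b l * qShift q x ν i)) *
        ∏ j ∈ univ.erase i, ((q * qShift q x ν i - qShift q x ν j) *
          (t * qShift q x ν i - qShift q x ν j))) := by
  have hq : (q : ℂ) ≠ 0 := by exact_mod_cast hq0.ne'
  obtain ⟨m, rfl⟩ : ∃ m, n = m + 1 := ⟨n - 1, by have := i.pos; omega⟩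
  -- The case of the first variable.
  have first : ∀ (x : Fin (m + 1) → ℂ), (∀ i, x i ≠ 0) → ∀ ν : Fin (m + 1) → ℤ,
      term q a b t x (ν + Pi.single 0 1) * ((∏ l, (1 - q * (a l)⁻¹ * qShift q x ν 0)) *
        ∏ j ∈ univ.erase 0, ((qShift q x ν 0 - qShift q x ν j) *
          (q * qShift q x ν 0 - t * qShift q x ν j))) =
      term q a b t x ν * (q * t ^ m * (∏ l, (1 - b l * qShift q x ν 0)) *
        ∏ j ∈ univ.erase 0, ((q * qShift q x ν 0 - qShift q x ν j) *
          (t * qShift q x ν 0 - qShift q x ν j))) := by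
    intro x hx ν
    have hc : (q : ℂ) * t ^ m ≠ 0 := mul_ne_zero hq (pow_ne_zero _ ht)
    have ex : x = Fin.cons (x 0) (Fin.tail x) := (Fin.cons_self_tail x).symm
    have h1 := oneBody_succ hq0 hq1 a hb hc (hx 0) (ν 0)
    have h2 : (∏ j : Fin m, twoBody q t (x 0) (ν 0 + 1) (x j.succ) (ν j.succ)) *
          (∏ j : Fin m, ((x 0 * (q : ℂ) ^ ν 0 - x j.succ * (q : ℂ) ^ ν j.succ) *
            (q * (x 0 * (q : ℂ) ^ ν 0) - t * (x j.succ * (q : ℂ) ^ ν j.succ)))) =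
        (∏ j : Fin m, twoBody q t (x 0) (ν 0) (x j.succ) (ν j.succ)) *
          ∏ j : Fin m, ((q * (x 0 * (q : ℂ) ^ ν 0) - x j.succ * (q : ℂ) ^ ν j.succ) *
            (t * (x 0 * (q : ℂ) ^ ν 0) - x j.succ * (q : ℂ) ^ ν j.succ)) := by
      rw [← prod_mul_distrib, ← prod_mul_distrib]
      exact prod_congr rfl fun j _ => twoBody_succ hq0 hq1 ht (hx 0) (hx j.succ) (ν 0) (ν j.succ)
    rw [prod_erase_zero, prod_erase_zero, ex, term_cons, term_cons, ← ex]
    have e0 : (ν + Pi.single (0 : Fin (m + 1)) (1 : ℤ) : Fin (m + 1) → ℤ) 0 = ν 0 + 1 := by simp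
    have e1 : ∀ j : Fin m, (ν + Pi.single (0 : Fin (m + 1)) (1 : ℤ) : Fin (m + 1) → ℤ) j.succ = ν j.succ :=
      fun j => by simp [Fin.succ_ne_zero]
    simp only [e0, e1, Fin.tail, qShift]
    generalize (∏ i : Fin m, oneBody q a b (q * t ^ m) (x i.succ) (ν i.succ)) *
      ∏ i : Fin m, ∏ j ∈ Ioi i, twoBody q t (x i.succ) (ν i.succ) (x j.succ) (ν j.succ) = R
    calc _ = (oneBody q a b (q * t ^ m) (x 0) (ν 0 + 1) *
          ∏ l, (1 - q * (a l)⁻¹ * (x 0 * (q : ℂ) ^ ν 0))) *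
          ((∏ j : Fin m, twoBody q t (x 0) (ν 0 + 1) (x j.succ) (ν j.succ)) *
          ∏ j : Fin m, ((x 0 * (q : ℂ) ^ ν 0 - x j.succ * (q : ℂ) ^ ν j.succ) *
            (q * (x 0 * (q : ℂ) ^ ν 0) - t * (x j.succ * (q : ℂ) ^ ν j.succ)))) * R := by ring
      _ = _ := by rw [h1, h2]; ring
  set σ : Equiv.Perm (Fin (m + 1)) := Equiv.swap 0 i with hσ
  have hσ0 : σ 0 = i := Equiv.swap_apply_left _ _
  have h := first (x ∘ σ) (fun j => hx _) (ν ∘ σ)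
  have e1 : ν ∘ σ + Pi.single 0 1 = (ν + Pi.single i 1) ∘ σ := by
    funext j
    simp only [Pi.add_apply, Function.comp_apply, Pi.single_apply]
    have : j = 0 ↔ σ j = i := by rw [← hσ0, σ.injective.eq_iff]
    simp only [this]
  have e2 : ∀ j, qShift q (x ∘ σ) (ν ∘ σ) j = qShift q x ν (σ j) := fun j => rfl
  have e3 : ∀ f : Fin (m + 1) → ℂ, ∏ j ∈ univ.erase 0, f (σ j) = ∏ j ∈ univ.erase i, f j := by
    intro f
    refine prod_bij (fun j _ => σ j) (fun j hj => ?_) (fun j _ k _ h => σ.injective h)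
      (fun j hj => ⟨σ.symm j, ?_, by simp⟩) fun j _ => rfl
    · rw [mem_erase] at hj ⊢
      exact ⟨fun h => hj.1 (σ.injective (h.trans hσ0.symm)), mem_univ _⟩
    · rw [mem_erase] at hj ⊢
      exact ⟨fun h => hj.1 (by rw [← hσ0, ← h]; simp), mem_univ _⟩
  rw [e1, term_perm hq0 a b t hx, term_perm hq0 a b t hx] at h
  simp only [e2, hσ0] at h
  rw [e3 fun j => (qShift q x ν i - qShift q x ν j) * (q * qShift q x ν i - t * qShift q x ν j),
    e3 fun j => (q * qShift q x ν i - qShift q x ν j) * (t * qShift q x ν i - qShift q x ν j),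
    mul_assoc, mul_assoc] at h
  have hs : (((Equiv.Perm.sign σ : ℤˣ) : ℤ) : ℂ) ≠ 0 := by
    have : ((Equiv.Perm.sign σ : ℤˣ) : ℤ) ≠ 0 := by simp
    exact_mod_cast this
  exact mul_left_cancel₀ hs h

theorem qShift_injective {n : ℕ} {q : ℝ} (hq0 : 0 < q) (hq1 : q < 1) {x : Fin n → ℂ}
    (hx : ∀ i, x i ≠ 0) (hxx : ∀ i j, i ≠ j → theta q (x i / x j) ≠ 0) (ν : Fin n → ℤ) :
    Function.Injective (qShift q x ν) := by
  have hq : (q : ℂ) ≠ 0 := by exact_mod_cast hq0.ne'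
  intro i j h
  by_contra hij
  refine hxx i j hij ((theta_eq_zero_iff hq0 hq1 (div_ne_zero (hx i) (hx j))).2 ⟨ν j - ν i, ?_⟩)
  simp only [qShift] at h
  have := zpow_ne_zero (ν i) hq
  have := hx j
  rw [zpow_sub₀ hq]
  field_simp
  linear_combination h

/-- The summand times the function whose differences are to be summed, at a shifted lattice
point. -/
theorem term_succ_mul {n : ℕ} {q : ℝ} (hq0 : 0 < q) (hq1 : q < 1) {a b : Fin 2 → ℂ}
    (hb : ∀ l, b l ≠ 0) {t : ℂ} (ht : t ≠ 0) {x : Fin n → ℂ} (hx : ∀ i, x i ≠ 0)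
    (hxx : ∀ i j, i ≠ j → theta q (x i / x j) ≠ 0) (γ : ℂ) {I : Finset (Fin n)} {i : Fin n}
    (hi : i ∈ Iᶜ) (ν : Fin n → ℤ) :
    term q a b t x (ν + Pi.single i 1) *
        (pairWeight t (qShift q x (ν + Pi.single i 1))
            (fun k => 1 - γ * qShift q x (ν + Pi.single i 1) k) I i *
          ((qShift q x (ν + Pi.single i 1) i)⁻¹ *
            (∏ l, (1 - (a l)⁻¹ * qShift q x (ν + Pi.single i 1) i)) *
            ∏ j ∈ univ.erase i, pairRatio t (qShift q x (ν + Pi.single i 1)) i j)) =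
      term q a b t x ν * (pairWeight t (qShift q x ν) (fun k => 1 - γ * qShift q x ν k) I i *
        (t ^ (n - 1) * ((qShift q x ν i)⁻¹ * ∏ l, (1 - b l * qShift q x ν i)) *
          ∏ j ∈ univ.erase i, pairRatio t (qShift q x ν) j i)) := by
  have hq : (q : ℂ) ≠ 0 := by exact_mod_cast hq0.ne'
  have hinj := qShift_injective hq0 hq1 hx hxx ν
  have hinj' := qShift_injective hq0 hq1 hx hxx (ν + Pi.single i 1)
  have h := term_succ hq0 hq1 a hb ht hx ν i
  have ei : qShift q x (ν + Pi.single i 1) i = q * qShift q x ν i := by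
    simp only [qShift, Pi.add_apply, Pi.single_eq_same, zpow_add₀ hq, zpow_one]; ring
  have ej : ∀ j, j ≠ i → qShift q x (ν + Pi.single i 1) j = qShift q x ν j := by
    intro j hj
    simp [qShift, Pi.single_eq_of_ne hj]
  have hI : ∀ k ∈ I, k ≠ i := fun k hk h => (mem_compl.1 hi) (h ▸ hk)
  have ew : pairWeight t (qShift q x (ν + Pi.single i 1))
      (fun k => 1 - γ * qShift q x (ν + Pi.single i 1) k) I i =
      pairWeight t (qShift q x ν) (fun k => 1 - γ * qShift q x ν k) I i := by
    rw [pairWeight, pairWeight, prod_congr rfl fun k hk => by rw [ej k (hI k hk)]]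
    congr 1
    refine prod_congr rfl fun j hj => prod_congr rfl fun k hk => ?_
    rw [pairRatio, pairRatio, ej k (hI k hk), ej j (ne_of_mem_erase hj)]
  rw [ew]
  have hz0 : qShift q x ν i ≠ 0 := mul_ne_zero (hx i) (zpow_ne_zero _ hq)
  have ep : ∏ j ∈ univ.erase i, pairRatio t (qShift q x (ν + Pi.single i 1)) i j =
      ∏ j ∈ univ.erase i, ((q * qShift q x ν i - t * qShift q x ν j) /
        (q * qShift q x ν i - qShift q x ν j)) :=
    prod_congr rfl fun j hj => by rw [pairRatio, ei, ej j (ne_of_mem_erase hj)]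
  have ep' : ∏ j ∈ univ.erase i, pairRatio t (qShift q x ν) j i =
      ∏ j ∈ univ.erase i, ((t * qShift q x ν i - qShift q x ν j) /
        (qShift q x ν i - qShift q x ν j)) :=
    prod_congr rfl fun j _ => by rw [pairRatio, ← neg_sub, ← neg_sub (qShift q x ν i), neg_div_neg_eq]
  rw [ep, ep', ei]
  simp only [prod_mul_distrib, prod_div_distrib] at h ⊢
  have n1 : ∏ j ∈ univ.erase i, (q * qShift q x ν i - qShift q x ν j) ≠ 0 :=
    prod_ne_zero_iff.2 fun j hj => by
      rw [← ei, ← ej j (ne_of_mem_erase hj)]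
      exact sub_ne_zero.2 fun h => (ne_of_mem_erase hj) (hinj' h).symm
  have n2 : ∏ j ∈ univ.erase i, (qShift q x ν i - qShift q x ν j) ≠ 0 :=
    prod_ne_zero_iff.2 fun j hj => sub_ne_zero.2 fun h => (ne_of_mem_erase hj) (hinj h).symm
  have e4 : ∀ l, (a l)⁻¹ * (q * qShift q x ν i) = q * (a l)⁻¹ * qShift q x ν i := fun l => by ring
  simp only [e4]
  generalize ∏ j ∈ univ.erase i, (q * qShift q x ν i - qShift q x ν j) = D1 at *
  generalize ∏ j ∈ univ.erase i, (qShift q x ν i - qShift q x ν j) = D2 at *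
  generalize ∏ j ∈ univ.erase i, (q * qShift q x ν i - t * qShift q x ν j) = N1 at *
  generalize ∏ j ∈ univ.erase i, (t * qShift q x ν i - qShift q x ν j) = N2 at *
  generalize ∏ l, (1 - q * (a l)⁻¹ * qShift q x ν i) = A at *
  generalize ∏ l, (1 - b l * qShift q x ν i) = B at *
  generalize pairWeight t (qShift q x ν) (fun k => 1 - γ * qShift q x ν k) I i = W at *
  generalize term q a b t x ν = T at *
  generalize term q a b t x (ν + Pi.single i 1) = T' at *
  generalize qShift q x ν i = z at *
  field_simp
  linear_combination W * h

/-! ### Truncated sums -/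

/-- The point `(β⁻¹, β⁻¹t⁻¹, …, β⁻¹t^{-(n-1)})`. -/
def truncPoint (n : ℕ) (β t : ℂ) : Fin n → ℂ := fun k => β⁻¹ * t⁻¹ ^ (k : ℕ)

theorem truncPoint_ne_zero {n : ℕ} {β t : ℂ} (hβ : β ≠ 0) (ht : t ≠ 0) (k : Fin n) :
    truncPoint n β t k ≠ 0 := mul_ne_zero (inv_ne_zero hβ) (pow_ne_zero _ (inv_ne_zero ht))

theorem truncPoint_div {n : ℕ} {β t : ℂ} (hβ : β ≠ 0) (ht : t ≠ 0) (i j : Fin n) :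
    truncPoint n β t i / truncPoint n β t j = t ^ ((j : ℤ) - i) := by
  rw [truncPoint, truncPoint, zpow_sub₀ ht, zpow_natCast, zpow_natCast, inv_pow, inv_pow]
  field_simp

theorem theta_truncPoint_div {n : ℕ} {q : ℝ} (hq0 : 0 < q) (hq1 : q < 1) {β t : ℂ} (hβ : β ≠ 0)
    (ht : t ≠ 0) (hθ : ∀ m ∈ Icc 1 n, theta q (t ^ m) ≠ 0) (i j : Fin n) (hij : i ≠ j) :
    theta q (truncPoint n β t i / truncPoint n β t j) ≠ 0 := by
  rw [truncPoint_div hβ ht]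
  rcases lt_or_gt_of_ne (fun h => hij (Fin.ext h) : (i : ℕ) ≠ j) with h | h
  · rw [show ((j : ℕ) : ℤ) - (i : ℕ) = ((j - i : ℕ) : ℤ) by omega, zpow_natCast]
    exact hθ _ (mem_Icc.2 ⟨by omega, by omega⟩)
  · rw [show ((j : ℕ) : ℤ) - (i : ℕ) = -((i - j : ℕ) : ℤ) by omega, zpow_neg, zpow_natCast, Ne,
      theta_inv_eq_zero_iff hq0 hq1 (pow_ne_zero _ ht)]
    exact hθ _ (mem_Icc.2 ⟨by omega, by omega⟩)

theorem qInf_eq_zero_of_pos {q : ℝ} (hq0 : 0 < q) (hq1 : q < 1) {k : ℤ} (hk : 0 < k) :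
    qInf q ((q : ℂ) / (q : ℂ) ^ k) = 0 := by
  have hq : (q : ℂ) ≠ 0 := by exact_mod_cast hq0.ne'
  refine (qInf_eq_zero_iff hq0 hq1).2 ⟨(k - 1).toNat, ?_⟩
  have : (q : ℂ) ^ (k - 1).toNat = (q : ℂ) ^ (k - 1) := by
    rw [← zpow_natCast]; congr 1; omega
  rw [this, zpow_sub₀ hq, zpow_one]
  have := zpow_ne_zero k hq
  field_simp

/-- At the truncation point the summand is supported on nonpositive `ν`: the factor for the first
variable forces `ν_1 ≤ 0`, the interaction of neighbours `ν_{k+1} ≤ ν_k`. -/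
theorem le_zero_of_term_ne_zero {n : ℕ} {q : ℝ} (hq0 : 0 < q) (hq1 : q < 1) {a b : Fin 2 → ℂ}
    {t : ℂ} (hb : b 0 ≠ 0) (ht : t ≠ 0) {ν : Fin n → ℤ}
    (h : term q a b t (truncPoint n (b 0) t) ν ≠ 0) (i : Fin n) : ν i ≤ 0 := by
  have hq : (q : ℂ) ≠ 0 := by exact_mod_cast hq0.ne'
  obtain ⟨h1, h2⟩ := mul_ne_zero_iff.1 h
  have main : ∀ (k : ℕ) (hk : k < n), ν ⟨k, hk⟩ ≤ 0 := by
    intro k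
    induction k with
    | zero =>
      intro hk
      by_contra hpos
      rw [not_le] at hpos
      have h3 := prod_ne_zero_iff.1 h1 ⟨0, hk⟩ (mem_univ _)
      have h4 := prod_ne_zero_iff.1 (right_ne_zero_of_mul h3) 0 (mem_univ _)
      refine right_ne_zero_of_mul (right_ne_zero_of_mul h4) ?_
      have e : b 0 * (truncPoint n (b 0) t ⟨0, hk⟩ * (q : ℂ) ^ ν ⟨0, hk⟩) =
          (q : ℂ) ^ ν ⟨0, hk⟩ := by
        simp only [truncPoint, pow_zero]; field_simp
      rw [e]
      exact qInf_eq_zero_of_pos hq0 hq1 hpos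
    | succ k ih =>
      intro hk
      have hk' := ih (by omega)
      refine le_trans ?_ hk'
      by_contra hpos
      rw [not_le, ← sub_pos] at hpos
      have h3 := prod_ne_zero_iff.1 (prod_ne_zero_iff.1 h2 ⟨k, by omega⟩ (mem_univ _))
        ⟨k + 1, hk⟩ (mem_Ioi.2 (by simp))
      refine right_ne_zero_of_mul (right_ne_zero_of_mul h3) ?_
      have e : t * (truncPoint n (b 0) t ⟨k + 1, hk⟩ / truncPoint n (b 0) t ⟨k, by omega⟩ *
          (q : ℂ) ^ (ν ⟨k + 1, hk⟩ - ν ⟨k, by omega⟩)) =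
          (q : ℂ) ^ (ν ⟨k + 1, hk⟩ - ν ⟨k, by omega⟩) := by
        rw [truncPoint_div hb ht, ← mul_assoc]
        simp only [Nat.cast_add, Nat.cast_one, sub_add_cancel_left, zpow_neg, zpow_one]
        rw [mul_inv_cancel₀ ht, one_mul]
      rw [e]
      exact qInf_eq_zero_of_pos hq0 hq1 hpos
  exact main i i.2

/-! ### Summability of differences at the truncation point -/

/-- Functions on the lattice which for nonpositive `ν` grow at most like `∏_{i ∈ S} q^{ν_i}`. -/
def Tempered {n : ℕ} (q : ℝ) (S : Finset (Fin n)) (F : (Fin n → ℤ) → ℂ) : Prop :=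
  ∃ C, 0 ≤ C ∧ ∀ ν : Fin n → ℤ, (∀ i, ν i ≤ 0) → ‖F ν‖ ≤ C * ∏ i ∈ S, q ^ ν i

theorem one_le_zpow_nonpos {q : ℝ} (hq0 : 0 < q) (hq1 : q < 1) {k : ℤ} (hk : k ≤ 0) :
    1 ≤ q ^ k := by
  obtain ⟨m, rfl⟩ : ∃ m : ℕ, k = -(m : ℤ) := ⟨k.natAbs, by omega⟩
  rw [zpow_neg, zpow_natCast]
  exact (one_le_inv₀ (pow_pos hq0 _)).2 (pow_le_one₀ hq0.le hq1.le)

theorem Tempered.mul {n : ℕ} {q : ℝ} (hq0 : 0 < q) {S T : Finset (Fin n)} (hST : Disjoint S T)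
    {F G : (Fin n → ℤ) → ℂ} (hF : Tempered q S F) (hG : Tempered q T G) :
    Tempered q (S ∪ T) fun ν => F ν * G ν := by
  obtain ⟨C, hC, hF⟩ := hF
  obtain ⟨D, hD, hG⟩ := hG
  refine ⟨C * D, mul_nonneg hC hD, fun ν hν => ?_⟩
  rw [norm_mul, prod_union hST]
  have h1 : 0 ≤ ∏ i ∈ S, q ^ ν i := prod_nonneg fun i _ => zpow_nonneg hq0.le _
  calc _ ≤ (C * ∏ i ∈ S, q ^ ν i) * (D * ∏ i ∈ T, q ^ ν i) :=
        mul_le_mul (hF ν hν) (hG ν hν) (norm_nonneg _) (mul_nonneg hC h1)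
    _ = _ := by ring

theorem Tempered.mono {n : ℕ} {q : ℝ} (hq0 : 0 < q) (hq1 : q < 1) {S T : Finset (Fin n)}
    (hST : S ⊆ T) {F : (Fin n → ℤ) → ℂ} (hF : Tempered q S F) : Tempered q T F := by
  obtain ⟨C, hC, hF⟩ := hF
  refine ⟨C, hC, fun ν hν => (hF ν hν).trans (mul_le_mul_of_nonneg_left ?_ hC)⟩
  rw [← prod_sdiff hST]
  refine le_mul_of_one_le_left (prod_nonneg fun i _ => zpow_nonneg hq0.le _) ?_
  calc (1 : ℝ) = ∏ _i ∈ T \ S, (1 : ℝ) := by simp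
    _ ≤ _ := prod_le_prod (fun _ _ => zero_le_one) fun i _ =>
      one_le_zpow_nonpos hq0 hq1 (hν i)

theorem Tempered.add {n : ℕ} {q : ℝ} {S : Finset (Fin n)} {F G : (Fin n → ℤ) → ℂ}
    (hF : Tempered q S F) (hG : Tempered q S G) : Tempered q S fun ν => F ν + G ν := by
  obtain ⟨C, hC, hF⟩ := hF
  obtain ⟨D, hD, hG⟩ := hG
  refine ⟨C + D, add_nonneg hC hD, fun ν hν => ?_⟩
  rw [add_mul]
  exact (norm_add_le _ _).trans (add_le_add (hF ν hν) (hG ν hν))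

theorem Tempered.sum {n : ℕ} {q : ℝ} {S : Finset (Fin n)} {κ : Type*} (s : Finset κ)
    {F : κ → (Fin n → ℤ) → ℂ} (hF : ∀ k ∈ s, Tempered q S (F k)) :
    Tempered q S fun ν => ∑ k ∈ s, F k ν := by
  classical
  induction s using Finset.induction_on with
  | empty => exact ⟨0, le_rfl, by simp⟩
  | insert k s hk ih =>
    simp only [sum_insert hk]
    exact (hF k (mem_insert_self _ _)).add (ih fun l hl => hF l (mem_insert_of_mem hl))

theorem Tempered.const {n : ℕ} (q : ℝ) (c : ℂ) : Tempered q (∅ : Finset (Fin n)) fun _ => c :=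
  ⟨‖c‖, norm_nonneg _, by simp⟩

theorem Tempered.prod_bounded {n : ℕ} {q : ℝ} (hq0 : 0 < q) {κ : Type*} (s : Finset κ)
    {F : κ → (Fin n → ℤ) → ℂ} (hF : ∀ k ∈ s, Tempered q ∅ (F k)) :
    Tempered q ∅ fun ν => ∏ k ∈ s, F k ν := by
  classical
  induction s using Finset.induction_on with
  | empty => simpa using Tempered.const q 1
  | insert k s hk ih =>
    simp only [prod_insert hk]
    simpa using (hF k (mem_insert_self _ _)).mul hq0 (disjoint_empty_left _)
      (ih fun l hl => hF l (mem_insert_of_mem hl))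

theorem Tempered.prod_single {n : ℕ} {q : ℝ} (hq0 : 0 < q) (S : Finset (Fin n))
    {F : Fin n → (Fin n → ℤ) → ℂ} (hF : ∀ i ∈ S, Tempered q {i} (F i)) :
    Tempered q S fun ν => ∏ i ∈ S, F i ν := by
  induction S using Finset.induction_on with
  | empty => simpa using Tempered.const q 1
  | insert k s hk ih =>
    simp only [prod_insert hk]
    rw [insert_eq]
    exact (hF k (mem_insert_self _ _)).mul hq0 (disjoint_singleton_left.2 hk)
      (ih fun l hl => hF l (mem_insert_of_mem hl))

theorem tempered_of_norm_le {n : ℕ} {q : ℝ} {i : Fin n} {F : (Fin n → ℤ) → ℂ} (C : ℝ) (hC : 0 ≤ C)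
    (h : ∀ ν : Fin n → ℤ, ν i ≤ 0 → ‖F ν‖ ≤ C * q ^ ν i) : Tempered q {i} F :=
  ⟨C, hC, fun ν hν => by rw [prod_singleton]; exact h ν (hν i)⟩

theorem tempered_linear {n : ℕ} {q : ℝ} (hq0 : 0 < q) (hq1 : q < 1) (x : Fin n → ℂ) (γ : ℂ)
    (i : Fin n) : Tempered q {i} fun ν => 1 - γ * qShift q x ν i := by
  refine tempered_of_norm_le (1 + ‖γ * x i‖) (by positivity) fun ν hν => ?_
  have h1 := one_le_zpow_nonpos hq0 hq1 hν
  have h2 : ‖γ * qShift q x ν i‖ = ‖γ * x i‖ * q ^ ν i := by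
    rw [qShift, ← mul_assoc, norm_mul, norm_q_zpow hq0]
  calc _ ≤ ‖(1 : ℂ)‖ + ‖γ * qShift q x ν i‖ := norm_sub_le _ _
    _ ≤ q ^ ν i + ‖γ * x i‖ * q ^ ν i := by rw [h2, norm_one]; gcongr
    _ = _ := by ring

theorem tempered_inv_mul_prod {n : ℕ} {q : ℝ} (hq0 : 0 < q) (hq1 : q < 1) {x : Fin n → ℂ} {i : Fin n}
    (hx : x i ≠ 0) (c : Fin 2 → ℂ) :
    Tempered q {i} fun ν => (qShift q x ν i)⁻¹ * ∏ l, (1 - c l * qShift q x ν i) := by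
  have hq : (q : ℂ) ≠ 0 := by exact_mod_cast hq0.ne'
  refine tempered_of_norm_le (‖(x i)⁻¹‖ + ‖c 0 + c 1‖ + ‖c 0 * c 1 * x i‖) (by positivity)
    fun ν hν => ?_
  have h1 := one_le_zpow_nonpos hq0 hq1 hν
  have hz : qShift q x ν i ≠ 0 := mul_ne_zero hx (zpow_ne_zero _ hq)
  have e : (qShift q x ν i)⁻¹ * ∏ l, (1 - c l * qShift q x ν i) =
      (qShift q x ν i)⁻¹ - (c 0 + c 1) + c 0 * c 1 * qShift q x ν i := by
    rw [Fin.prod_univ_two]; field_simp; ring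
  have h2 : ‖(qShift q x ν i)⁻¹‖ ≤ ‖(x i)⁻¹‖ * q ^ ν i := by
    rw [qShift, mul_inv, norm_mul, norm_inv ((q : ℂ) ^ ν i), norm_q_zpow hq0]
    gcongr
    exact (inv_le_one_of_one_le₀ h1).trans h1
  have h3 : ‖c 0 * c 1 * qShift q x ν i‖ = ‖c 0 * c 1 * x i‖ * q ^ ν i := by
    rw [qShift, ← mul_assoc, norm_mul, norm_q_zpow hq0]
  rw [e]
  calc _ ≤ ‖(qShift q x ν i)⁻¹‖ + ‖c 0 + c 1‖ + ‖c 0 * c 1 * qShift q x ν i‖ :=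
        (norm_add_le _ _).trans (add_le_add_left (norm_sub_le _ _) _)
    _ ≤ ‖(x i)⁻¹‖ * q ^ ν i + ‖c 0 + c 1‖ * q ^ ν i + ‖c 0 * c 1 * x i‖ * q ^ ν i := by
        rw [h3]
        gcongr
        exact le_mul_of_one_le_right (norm_nonneg _) h1
    _ = _ := by ring

/-- The points of a `q`-lattice not containing `1` stay away from `1`. -/
theorem exists_norm_inv_sub_one_le {q : ℝ} (hq0 : 0 < q) (hq1 : q < 1) {u : ℂ} (hu : u ≠ 0) :
    ∃ C, 0 ≤ C ∧ ∀ m : ℤ, ‖(u * (q : ℂ) ^ m - 1)⁻¹‖ ≤ C := by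
  have hu' : 0 < ‖u‖ := norm_pos_iff.2 hu
  obtain ⟨N, hN⟩ := exists_pow_lt_of_lt_one (show 0 < min (1 / (2 * ‖u‖)) (‖u‖ / 2) by positivity) hq1
  rw [lt_min_iff] at hN
  set S := ∑ m ∈ Icc (-(N : ℤ)) N, ‖(u * (q : ℂ) ^ m - 1)⁻¹‖ with hS
  have hS0 : 0 ≤ S := sum_nonneg fun _ _ => norm_nonneg _
  refine ⟨2 + S, by positivity, fun m => ?_⟩
  have hn : ‖u * (q : ℂ) ^ m‖ = ‖u‖ * q ^ m := by rw [norm_mul, norm_q_zpow hq0]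
  have key : 1 / 2 ≤ ‖u * (q : ℂ) ^ m - 1‖ → ‖(u * (q : ℂ) ^ m - 1)⁻¹‖ ≤ 2 + S := by
    intro h
    rw [norm_inv]
    calc _ ≤ (1 / 2 : ℝ)⁻¹ := inv_anti₀ (by norm_num) h
      _ ≤ 2 + S := by norm_num; exact hS0
  rcases le_or_gt m (-(N : ℤ)) with hm | hm
  · refine key ?_
    obtain ⟨k, rfl⟩ : ∃ k : ℕ, m = -(k : ℤ) := ⟨m.natAbs, by omega⟩
    have h1 : q ^ k ≤ ‖u‖ / 2 := (pow_le_pow_of_le_one hq0.le hq1.le (by omega)).trans hN.2.le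
    have h2 : 2 ≤ ‖u‖ * q ^ (-(k : ℤ)) := by
      rw [zpow_neg, zpow_natCast, ← div_eq_mul_inv, le_div_iff₀ (pow_pos hq0 _)]
      linarith
    have := norm_sub_norm_le (u * (q : ℂ) ^ (-(k : ℤ))) 1
    rw [hn, norm_one] at this
    linarith
  rcases le_or_gt (N : ℤ) m with hm' | hm'
  · refine key ?_
    obtain ⟨k, rfl⟩ := Int.eq_ofNat_of_zero_le (show 0 ≤ m by omega)
    have h1 : q ^ k ≤ 1 / (2 * ‖u‖) :=
      (pow_le_pow_of_le_one hq0.le hq1.le (by omega)).trans hN.1.le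
    have h2 : ‖u‖ * q ^ (k : ℤ) ≤ 1 / 2 := by
      rw [zpow_natCast]
      calc _ ≤ ‖u‖ * (1 / (2 * ‖u‖)) := by gcongr
        _ = 1 / 2 := by field_simp
    have := norm_sub_norm_le 1 (u * (q : ℂ) ^ (k : ℤ))
    rw [hn, norm_one, norm_sub_rev] at this
    linarith
  · have := single_le_sum (f := fun m : ℤ => ‖(u * (q : ℂ) ^ m - 1)⁻¹‖)
      (fun _ _ => norm_nonneg _) (mem_Icc.2 ⟨hm.le, hm'.le⟩)
    linarith

theorem tempered_pairRatio {n : ℕ} {q : ℝ} (hq0 : 0 < q) (hq1 : q < 1) (t : ℂ) {x : Fin n → ℂ}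
    (hx : ∀ i, x i ≠ 0) (hxx : ∀ i j, i ≠ j → theta q (x i / x j) ≠ 0) {i j : Fin n}
    (hij : i ≠ j) : Tempered q ∅ fun ν => pairRatio t (qShift q x ν) i j := by
  have hq : (q : ℂ) ≠ 0 := by exact_mod_cast hq0.ne'
  obtain ⟨C, hC, h⟩ := exists_norm_inv_sub_one_le hq0 hq1 (div_ne_zero (hx i) (hx j))
  refine ⟨1 + ‖1 - t‖ * C, by positivity, fun ν _ => ?_⟩
  rw [prod_empty, mul_one]
  have hz : qShift q x ν j ≠ 0 := mul_ne_zero (hx j) (zpow_ne_zero _ hq)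
  have e1 : x i / x j * (q : ℂ) ^ (ν i - ν j) = qShift q x ν i / qShift q x ν j := by
    rw [zpow_sub₀ hq, qShift, qShift]; field_simp
  have hsub : qShift q x ν i - qShift q x ν j ≠ 0 :=
    sub_ne_zero.2 fun h => hij (qShift_injective hq0 hq1 hx hxx ν h)
  have e2 : pairRatio t (qShift q x ν) i j =
      1 + (1 - t) * (x i / x j * (q : ℂ) ^ (ν i - ν j) - 1)⁻¹ := by
    have e3 : qShift q x ν i / qShift q x ν j - 1 =
      (qShift q x ν i - qShift q x ν j) / qShift q x ν j := by field_simp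
    rw [e1, e3, inv_div, pairRatio]
    field_simp
    ring
  simp only [e2]
  calc _ ≤ ‖(1 : ℂ)‖ + ‖(1 - t) * (x i / x j * (q : ℂ) ^ (ν i - ν j) - 1)⁻¹‖ := norm_add_le _ _
    _ ≤ _ := by
      rw [norm_one, norm_mul]
      gcongr
      exact h _

theorem tempered_pairWeight {n : ℕ} {q : ℝ} (hq0 : 0 < q) (hq1 : q < 1) (t γ : ℂ) {x : Fin n → ℂ}
    (hx : ∀ i, x i ≠ 0) (hxx : ∀ i j, i ≠ j → theta q (x i / x j) ≠ 0) (I : Finset (Fin n))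
    (i : Fin n) : Tempered q I fun ν =>
      pairWeight t (qShift q x ν) (fun k => 1 - γ * qShift q x ν k) I i := by
  have h1 := Tempered.prod_single hq0 I fun k _ => tempered_linear hq0 hq1 x γ k
  have h2 : Tempered q ∅ fun ν => ∏ j ∈ Iᶜ.erase i, ∏ k ∈ I, pairRatio t (qShift q x ν) j k :=
    Tempered.prod_bounded hq0 _ fun j hj => Tempered.prod_bounded hq0 _ fun k hk =>
      tempered_pairRatio hq0 hq1 t hx hxx fun h => by
        subst h
        exact (mem_compl.1 (mem_of_mem_erase hj)) hk
  have := h1.mul hq0 (disjoint_empty_right _) h2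
  rwa [union_empty] at this

theorem tempered_subsetSum {n : ℕ} {q : ℝ} (hq0 : 0 < q) (hq1 : q < 1) (t γ : ℂ) {x : Fin n → ℂ}
    (hx : ∀ i, x i ≠ 0) (hxx : ∀ i j, i ≠ j → theta q (x i / x j) ≠ 0) (r : ℕ) :
    Tempered q univ fun ν => subsetSum t (qShift q x ν) (fun k => 1 - γ * qShift q x ν k) r := by
  refine Tempered.sum _ fun I _ => Tempered.mono hq0 hq1 (subset_univ I) ?_
  have h1 := Tempered.prod_single hq0 I fun k _ => tempered_linear hq0 hq1 x γ k
  have h2 : Tempered q ∅ fun ν => ∏ j ∈ Iᶜ, ∏ k ∈ I, pairRatio t (qShift q x ν) j k :=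
    Tempered.prod_bounded hq0 _ fun j hj => Tempered.prod_bounded hq0 _ fun k hk =>
      tempered_pairRatio hq0 hq1 t hx hxx fun h => by
        subst h
        exact (mem_compl.1 hj) hk
  have := h1.mul hq0 (disjoint_empty_right _) h2
  rwa [union_empty] at this

/-- The parameters `(b_1, b_2/w)`. -/
def divSnd (b : Fin 2 → ℂ) (w : ℂ) : Fin 2 → ℂ := ![b 0, b 1 / w]

@[simp] theorem divSnd_zero (b : Fin 2 → ℂ) (w : ℂ) : divSnd b w 0 = b 0 := rfl

@[simp] theorem divSnd_one (b : Fin 2 → ℂ) (w : ℂ) : divSnd b w 1 = b 1 / w := rfl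

theorem divSnd_ne_zero {b : Fin 2 → ℂ} (hb : ∀ l, b l ≠ 0) {w : ℂ} (hw : w ≠ 0) (l : Fin 2) :
    divSnd b w l ≠ 0 := by
  fin_cases l
  · exact hb 0
  · exact div_ne_zero (hb 1) hw

theorem growthInfty_divSnd {n : ℕ} {q : ℝ} (hq0 : 0 < q) (a b : Fin 2 → ℂ) (t : ℂ) :
    growthInfty n q a (divSnd b q) t = q * growthInfty n q a b t := by
  have h : ‖divSnd b q 1‖ = ‖b 1‖ / q := by
    rw [divSnd_one, norm_div, Complex.norm_real, Real.norm_of_nonneg hq0.le]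
  rw [growthInfty, growthInfty, h, divSnd_zero]
  have : q ^ 2 / (‖a 0‖ * ‖a 1‖ * ‖b 0‖ * (‖b 1‖ / q)) =
      q * (q ^ 2 / (‖a 0‖ * ‖a 1‖ * ‖b 0‖ * ‖b 1‖)) := by
    rw [← mul_div_assoc, div_div_eq_mul_div, mul_comm (q ^ 2), mul_div_assoc]
  rw [this]
  ring

theorem Admissible.divSnd {n : ℕ} {q : ℝ} {a b : Fin 2 → ℂ} {t : ℂ} (h : Admissible n q a b t) :
    Admissible n q a (divSnd b q) t where
  q_pos := h.q_pos
  q_lt_one := h.q_lt_one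
  a_ne := h.a_ne
  b_ne := divSnd_ne_zero h.b_ne (by exact_mod_cast h.q_pos.ne')
  t_ne := h.t_ne
  zero_lt := h.zero_lt
  infty_lt := by
    rw [growthInfty_divSnd h.q_pos]
    have := growthInfty_nonneg n q a b t
    nlinarith [h.infty_lt, h.q_pos, h.q_lt_one]

/-- With `b_2` replaced by `b_2/q` the sum gains enough decay to be multiplied by a tempered
function. -/
theorem Admissible.summable_term_mul {n : ℕ} {q : ℝ} {a b : Fin 2 → ℂ} {t : ℂ}
    (h : Admissible n q a b t) {F : (Fin n → ℤ) → ℂ} (hF : Tempered q univ F) :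
    Summable fun ν => term q a (QSelberg.divSnd b q) t (truncPoint n (b 0) t) ν * F ν := by
  have hq0 := h.q_pos
  have hq1 := h.q_lt_one
  obtain ⟨C, hC, hF⟩ := hF
  set x := truncPoint n (b 0) t with hx
  have hx0 : ∀ i, x i ≠ 0 := truncPoint_ne_zero (h.b_ne 0) h.t_ne
  set ρ := growthZero n q t
  set σ := growthInfty n q a b t with hσ
  have hρ0 : 0 ≤ ρ := growthZero_nonneg _ _ _
  have hσ0 : 0 ≤ σ := growthInfty_nonneg _ _ _ _ _
  have hp0 : ∀ k, 0 ≤ profile ρ σ k := profile_nonneg hρ0 hσ0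
  have hbound := fun ν => norm_term_le_profile hq0 hq1 h.a_ne h.divSnd.b_ne h.t_ne hx0
    (le_refl (size a (QSelberg.divSnd b q) t x)) (le_refl (growthZero n q t))
    (growthInfty_divSnd hq0 a b t).le ν
  set K := termConst n q (size a (QSelberg.divSnd b q) t x)
  have hK : 0 ≤ K * ∏ i : Fin n, profile ρ (q * σ) 0 := (norm_nonneg _).trans (hbound fun _ => 0)
  have hK0 : 0 ≤ K := by simpa [profile] using hK
  refine Summable.of_norm_bounded
    (g := fun ν : Fin n → ℤ => (K * C) * ∏ i, profile ρ σ (ν i))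
    ((summable_prod_fin hp0 (summable_profile hρ0 h.zero_lt hσ0 h.infty_lt)).mul_left _)
    fun ν => ?_
  by_cases h0 : term q a (QSelberg.divSnd b q) t x ν = 0
  · rw [h0, zero_mul, norm_zero]
    exact mul_nonneg (mul_nonneg hK0 hC) (prod_nonneg fun i _ => hp0 _)
  have hν := le_zero_of_term_ne_zero hq0 hq1 (b := QSelberg.divSnd b q) (h.b_ne 0) h.t_ne h0
  rw [norm_mul]
  have hprod : ∀ i, profile ρ (q * σ) (ν i) * q ^ ν i = profile ρ σ (ν i) := by
    intro i
    rcases (hν i).eq_or_lt with h1 | h1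
    · simp [h1, profile]
    · rw [profile, profile, if_neg (by omega), if_neg (by omega), mul_zpow, mul_right_comm,
        ← zpow_add₀ hq0.ne', neg_add_cancel, zpow_zero, one_mul]
  calc _ ≤ (K * ∏ i, profile ρ (q * σ) (ν i)) * (C * ∏ i, q ^ ν i) :=
        mul_le_mul (hbound ν) (hF ν hν) (norm_nonneg _) ((norm_nonneg _).trans (hbound ν))
    _ = (K * C) * ∏ i, (profile ρ (q * σ) (ν i) * q ^ ν i) := by rw [prod_mul_distrib]; ring
    _ = _ := by rw [prod_congr rfl fun i _ => hprod i]

theorem term_eq_divSnd {n : ℕ} {q : ℝ} (hq0 : 0 < q) (hq1 : q < 1) (a : Fin 2 → ℂ) {b : Fin 2 → ℂ}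
    (hb : ∀ l, b l ≠ 0) (t : ℂ) {x : Fin n → ℂ} (hx : ∀ i, x i ≠ 0) (ν : Fin n → ℤ) :
    term q a b t x ν = (∏ i, -(q / (b 1 * x i))) *
      (term q a (divSnd b q) t x ν * ∏ i, (1 - b 1 / q * qShift q x ν i)) := by
  have hq : (q : ℂ) ≠ 0 := by exact_mod_cast hq0.ne'
  have key : ∀ i, oneBody q a b (q * t ^ (n - 1)) (x i) (ν i) = -(q / (b 1 * x i)) *
      (oneBody q a (divSnd b q) (q * t ^ (n - 1)) (x i) (ν i) *
        (1 - b 1 / q * qShift q x ν i)) := by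
    intro i
    have hz : x i * (q : ℂ) ^ ν i ≠ 0 := mul_ne_zero (hx i) (zpow_ne_zero _ hq)
    have h1 := qInf_step hq0 hq1 (q / (b 1 * (x i * (q : ℂ) ^ ν i)))
    have e1 : (q : ℂ) * (q / (b 1 * (x i * (q : ℂ) ^ ν i))) =
        q / (b 1 / q * (x i * (q : ℂ) ^ ν i)) := by
      have := hb 1
      field_simp
    have h2 := thetaMult_mul q (q : ℂ) (b 1 / q * x i) (ν i)
    have e2 : (q : ℂ) * (b 1 / q * x i) = b 1 * x i := by field_simp
    rw [e2] at h2
    rw [e1] at h1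
    rw [oneBody, oneBody, Fin.prod_univ_two, Fin.prod_univ_two, divSnd_zero, divSnd_one, h1, h2,
      qShift]
    have e3 : (q : ℂ) ^ ν i * (1 - q / (b 1 * (x i * (q : ℂ) ^ ν i))) =
        -(q / (b 1 * x i)) * (1 - b 1 / q * (x i * (q : ℂ) ^ ν i)) := by
      have := hb 1
      have := hx i
      field_simp
      ring
    linear_combination ((q * t ^ (n - 1)) ^ ν i *
      (qInf q (q * (a 0)⁻¹ * (x i * (q : ℂ) ^ ν i)) *
        (thetaMult q (b 0 * x i) (ν i) * qInf q (q / (b 0 * (x i * (q : ℂ) ^ ν i)))) *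
        (qInf q (q * (a 1)⁻¹ * (x i * (q : ℂ) ^ ν i)) * (thetaMult q (b 1 / q * x i) (ν i) *
          qInf q (q / (b 1 / q * (x i * (q : ℂ) ^ ν i))))))) * e3
  rw [term, term, prod_congr rfl fun i _ => key i, prod_mul_distrib, prod_mul_distrib]
  ring

/-! ### The contiguity relation -/

/-- The sum of the summand at the truncation point, with `b_2` replaced by `b_2/q`, against the
weighted subset sum. -/
def subsetMoment {n : ℕ} (q : ℝ) (a b : Fin 2 → ℂ) (t : ℂ) (r : ℕ) : ℂ :=
  ∑' ν : Fin n → ℤ, term q a (divSnd b q) t (truncPoint n (b 0) t) ν *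
    subsetSum t (qShift q (truncPoint n (b 0) t) ν)
      (fun k => 1 - b 1 / q * qShift q (truncPoint n (b 0) t) ν k) r

/-- Summation of `subset_telescoping` over the lattice: the differences sum to zero. -/
theorem Admissible.subsetMoment_recurrence {n : ℕ} {q : ℝ} {a b : Fin 2 → ℂ} {t : ℂ}
    (h : Admissible n q a b t) (hθ : ∀ m ∈ Icc 1 n, theta q (t ^ m) ≠ 0) {r m : ℕ}
    (hrm : r + m + 1 = n) :
    (∑ k ∈ range (m + 1), t ^ k) *
        ((t ^ m * (b 1 / q) - (a 0)⁻¹) * (t ^ m * (b 1 / q) - (a 1)⁻¹)) *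
        subsetMoment (n := n) q a b t r =
      (∑ k ∈ range (r + 1), t ^ k) *
        ((a 0)⁻¹ * (a 1)⁻¹ - t ^ (r + m + m) * (b 1 / q * b 0)) *
        subsetMoment (n := n) q a b t (r + 1) := by
  have hq0 := h.q_pos
  have hq1 := h.q_lt_one
  have ht := h.t_ne
  have hc := h.divSnd.b_ne
  rw [subsetMoment, subsetMoment]
  set x := truncPoint n (b 0) t with hx
  set γ := b 1 / q with hγ
  have hx0 : ∀ i, x i ≠ 0 := truncPoint_ne_zero (h.b_ne 0) ht
  have hxx : ∀ i j, i ≠ j → theta q (x i / x j) ≠ 0 :=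
    theta_truncPoint_div hq0 hq1 (h.b_ne 0) ht hθ
  set T : (Fin n → ℤ) → ℂ := fun ν => term q a (QSelberg.divSnd b q) t x ν with hT
  set w : Finset (Fin n) → Fin n → (Fin n → ℤ) → ℂ := fun I i ν =>
    pairWeight t (qShift q x ν) (fun k => 1 - γ * qShift q x ν k) I i with hw
  set G : Finset (Fin n) → Fin n → (Fin n → ℤ) → ℂ := fun I i ν => w I i ν *
    ((qShift q x ν i)⁻¹ * (∏ l, (1 - (a l)⁻¹ * qShift q x ν i)) *
      ∏ j ∈ univ.erase i, pairRatio t (qShift q x ν) i j) with hG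
  set G' : Finset (Fin n) → Fin n → (Fin n → ℤ) → ℂ := fun I i ν => w I i ν *
    (t ^ (n - 1) * ((qShift q x ν i)⁻¹ * ∏ l, (1 - QSelberg.divSnd b q l * qShift q x ν i)) *
      ∏ j ∈ univ.erase i, pairRatio t (qShift q x ν) j i) with hG'
  -- The sum over the lattice of each difference vanishes.
  have hdiff : ∀ I : Finset (Fin n), ∀ i ∈ Iᶜ, HasSum (fun ν => T ν * G I i ν - T ν * G' I i ν) 0 := by
    intro I i hi
    have hGt : Tempered q univ (G I i) := by
      have h1 := tempered_pairWeight hq0 hq1 t γ hx0 hxx I i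
      have h2 := tempered_inv_mul_prod hq0 hq1 (hx0 i) fun l => (a l)⁻¹
      have h3 : Tempered q ∅ fun ν => ∏ j ∈ univ.erase i, pairRatio t (qShift q x ν) i j :=
        Tempered.prod_bounded hq0 _ fun j hj =>
          tempered_pairRatio hq0 hq1 t hx0 hxx (ne_of_mem_erase hj).symm
      exact (h1.mul hq0 (disjoint_singleton_right.2 (by simpa using hi))
        (h2.mul hq0 (disjoint_empty_right _) h3)).mono hq0 hq1 (subset_univ _)
    have hs := (h.summable_term_mul hGt).hasSum
    have hshift : ∀ ν, T (ν + Pi.single i 1) * G I i (ν + Pi.single i 1) = T ν * G' I i ν :=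
      fun ν => term_succ_mul hq0 hq1 hc ht hx0 hxx γ hi ν
    have hs' : HasSum (fun ν => T ν * G' I i ν) (∑' ν, T ν * G I i ν) := by
      have := (Equiv.addRight (Pi.single i (1 : ℤ))).hasSum_iff.2 hs
      refine this.congr_fun fun ν => ?_
      exact (hshift ν).symm
    have := hs.sub hs'
    rwa [sub_self] at this
  have hsum : HasSum (fun ν => ∑ I ∈ powersetCard r univ, ∑ i ∈ Iᶜ,
      (T ν * G I i ν - T ν * G' I i ν)) 0 := by
    have := hasSum_sum fun I (_ : I ∈ powersetCard r univ) => hasSum_sum (hdiff I)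
    simpa using this
  have hpt : ∀ ν, t ^ m * γ * ∑ I ∈ powersetCard r univ, ∑ i ∈ Iᶜ,
      (T ν * G I i ν - T ν * G' I i ν) =
      (∑ k ∈ range (m + 1), t ^ k) * ((t ^ m * γ - (a 0)⁻¹) * (t ^ m * γ - (a 1)⁻¹)) *
        (T ν * subsetSum t (qShift q x ν) (fun k => 1 - γ * qShift q x ν k) r) -
      (∑ k ∈ range (r + 1), t ^ k) * ((a 0)⁻¹ * (a 1)⁻¹ - t ^ (r + m + m) * (γ * b 0)) *
        (T ν * subsetSum t (qShift q x ν) (fun k => 1 - γ * qShift q x ν k) (r + 1)) := by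
    intro ν
    have hinj := qShift_injective hq0 hq1 hx0 hxx ν
    have hz0 : ∀ i, qShift q x ν i ≠ 0 := fun i =>
      mul_ne_zero (hx0 i) (zpow_ne_zero _ (by exact_mod_cast hq0.ne'))
    have key := subset_telescoping ht γ hinj hz0 (a 0)⁻¹ (a 1)⁻¹ (b 0) (r := r) (m := m)
      (by rw [Fintype.card_fin]; exact hrm)
    have e : ∑ I ∈ powersetCard r univ, ∑ i ∈ Iᶜ, (T ν * G I i ν - T ν * G' I i ν) =
        T ν * ∑ I ∈ powersetCard r univ, ∑ i ∈ Iᶜ, w I i ν * ((qShift q x ν i)⁻¹ *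
          ((1 - (a 0)⁻¹ * qShift q x ν i) * (1 - (a 1)⁻¹ * qShift q x ν i)) *
            ∏ j ∈ univ.erase i, pairRatio t (qShift q x ν) i j -
          t ^ (r + m) * ((qShift q x ν i)⁻¹ *
            ((1 - b 0 * qShift q x ν i) * (1 - γ * qShift q x ν i))) *
            ∏ j ∈ univ.erase i, pairRatio t (qShift q x ν) j i) := by
      rw [mul_sum]
      refine sum_congr rfl fun I _ => ?_
      rw [mul_sum]
      refine sum_congr rfl fun i _ => ?_
      simp only [hG, hG', Fin.prod_univ_two, divSnd_zero, divSnd_one]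
      rw [show n - 1 = r + m by omega]
      ring
    rw [e, mul_left_comm, key]
    ring
  have hY : ∀ k, HasSum (fun ν => T ν *
      subsetSum t (qShift q x ν) (fun k => 1 - γ * qShift q x ν k) k) _ := fun k =>
    (h.summable_term_mul (tempered_subsetSum hq0 hq1 t γ hx0 hxx k)).hasSum
  have h1 := (hsum.mul_left (t ^ m * γ)).congr_fun fun ν => (hpt ν).symm
  have h2 := ((hY r).mul_left ((∑ k ∈ range (m + 1), t ^ k) *
    ((t ^ m * γ - (a 0)⁻¹) * (t ^ m * γ - (a 1)⁻¹)))).sub ((hY (r + 1)).mul_left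
    ((∑ k ∈ range (r + 1), t ^ k) * ((a 0)⁻¹ * (a 1)⁻¹ - t ^ (r + m + m) * (γ * b 0))))
  have h3 := h1.unique h2
  rw [mul_zero] at h3
  exact (sub_eq_zero.1 h3.symm)

theorem prod_mul_eq_of_recurrence {R : Type*} [CommRing R] {A B S : ℕ → R} {n : ℕ}
    (h : ∀ r < n, A r * S r = B r * S (r + 1)) :
    (∏ r ∈ range n, A r) * S 0 = (∏ r ∈ range n, B r) * S n := by
  induction n with
  | zero => simp
  | succ n ih =>
    rw [prod_range_succ, prod_range_succ, mul_right_comm, ih fun r hr => h r (by omega),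
      mul_right_comm, mul_assoc, h n (by omega), mul_assoc]

theorem geom_sum_ne_zero_of_theta {q : ℝ} (hq0 : 0 < q) (hq1 : q < 1) {t : ℂ} {m : ℕ}
    (h : theta q (t ^ m) ≠ 0) : ∑ k ∈ range m, t ^ k ≠ 0 := by
  intro h0
  have h1 := mul_neg_geom_sum t m
  rw [h0, mul_zero] at h1
  rw [← sub_eq_zero.1 h1.symm, theta_one hq0 hq1] at h
  exact h rfl

/-- The contiguity relation: the effect of `b_2 → b_2/q` on the truncated sum. -/
theorem Admissible.contiguity {n : ℕ} {q : ℝ} {a b : Fin 2 → ℂ} {t : ℂ}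
    (h : Admissible n q a b t) (hθ : ∀ m ∈ Icc 1 n, theta q (t ^ m) ≠ 0) :
    altSum q a b t (truncPoint n (b 0) t) *
        ∏ m ∈ range n, (1 - q / (a 0 * a 1 * b 0 * b 1 * t ^ (n - 1 + m))) =
      (∏ m ∈ range n, ((1 - q / (a 0 * b 1 * t ^ m)) * (1 - q / (a 1 * b 1 * t ^ m)))) *
        altSum q a (QSelberg.divSnd b q) t (truncPoint n (b 0) t) := by
  have hq0 := h.q_pos
  have hq1 := h.q_lt_one
  have hq : (q : ℂ) ≠ 0 := by exact_mod_cast hq0.ne'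
  have ht := h.t_ne
  have ha0 := h.a_ne 0
  have ha1 := h.a_ne 1
  have hb0 := h.b_ne 0
  have hb1 := h.b_ne 1
  have hx0 : ∀ i, truncPoint n (b 0) t i ≠ 0 := truncPoint_ne_zero hb0 ht
  have htp : ∀ m : ℕ, t ^ m ≠ 0 := fun m => pow_ne_zero m ht
  have m0 : subsetMoment (n := n) q a b t 0 =
      altSum q a (QSelberg.divSnd b q) t (truncPoint n (b 0) t) := by
    simp [subsetMoment, subsetSum_zero, altSum]
  have mn : altSum q a b t (truncPoint n (b 0) t) =
      (∏ m ∈ range n, -(q * b 0 * t ^ m / b 1)) * subsetMoment (n := n) q a b t n := by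
    rw [altSum, tsum_congr fun ν => term_eq_divSnd hq0 hq1 a h.b_ne t hx0 ν, tsum_mul_left,
      subsetMoment]
    congr 1
    · rw [← Fin.prod_univ_eq_prod_range (fun m => -((q : ℂ) * b 0 * t ^ m / b 1))]
      refine prod_congr rfl fun i _ => ?_
      rw [truncPoint, inv_pow]
      field_simp
    · refine tsum_congr fun ν => ?_
      congr 1
      have := subsetSum_card t (qShift q (truncPoint n (b 0) t) ν)
        fun k => 1 - b 1 / q * qShift q (truncPoint n (b 0) t) ν k
      rw [Fintype.card_fin] at this
      exact this.symm
  have key := prod_mul_eq_of_recurrence (n := n)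
    (A := fun r => (∑ k ∈ range (n - 1 - r + 1), t ^ k) *
        ((t ^ (n - 1 - r) * (b 1 / q) - (a 0)⁻¹) * (t ^ (n - 1 - r) * (b 1 / q) - (a 1)⁻¹)))
    (B := fun r => (∑ k ∈ range (r + 1), t ^ k) *
        ((a 0)⁻¹ * (a 1)⁻¹ - t ^ (n - 1 + (n - 1 - r)) * (b 1 / q * b 0)))
    (S := fun r => subsetMoment (n := n) q a b t r) fun r hr => by
      have := h.subsetMoment_recurrence hθ (r := r) (m := n - 1 - r) (by omega)
      rwa [show r + (n - 1 - r) = n - 1 by omega] at this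
  rw [prod_mul_distrib, prod_mul_distrib (f := fun r => ∑ k ∈ range (r + 1), t ^ k),
    prod_range_reflect (fun m => ∑ k ∈ range (m + 1), t ^ k),
    prod_range_reflect (fun m => (t ^ m * (b 1 / q) - (a 0)⁻¹) * (t ^ m * (b 1 / q) - (a 1)⁻¹)),
    prod_range_reflect (fun m => (a 0)⁻¹ * (a 1)⁻¹ - t ^ (n - 1 + m) * (b 1 / q * b 0)),
    mul_assoc, mul_assoc, m0] at key
  have hfac : ∏ r ∈ range n, ∑ k ∈ range (r + 1), t ^ k ≠ 0 :=
    prod_ne_zero_iff.2 fun r hr => geom_sum_ne_zero_of_theta hq0 hq1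
      (hθ (r + 1) (mem_Icc.2 ⟨by omega, by have := mem_range.1 hr; omega⟩))
  have key := mul_left_cancel₀ hfac key
  have e1 : ∀ m : ℕ, (t ^ m * (b 1 / q) - (a 0)⁻¹) * (t ^ m * (b 1 / q) - (a 1)⁻¹) =
      (t ^ m * (b 1 / q)) ^ 2 *
        ((1 - q / (a 0 * b 1 * t ^ m)) * (1 - q / (a 1 * b 1 * t ^ m))) := by
    intro m
    have := htp m
    field_simp
  have e2 : ∀ m : ℕ, (a 0)⁻¹ * (a 1)⁻¹ - t ^ (n - 1 + m) * (b 1 / q * b 0) =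
      (-(t ^ (n - 1 + m) * (b 1 / q * b 0))) *
        (1 - q / (a 0 * a 1 * b 0 * b 1 * t ^ (n - 1 + m))) := by
    intro m
    have := htp (n - 1 + m)
    field_simp
    ring
  simp only [e1, e2] at key
  rw [prod_mul_distrib (f := fun m => (t ^ m * (b 1 / q)) ^ 2),
    prod_mul_distrib (f := fun m => -(t ^ (n - 1 + m) * (b 1 / q * b 0)))] at key
  have e3 : ∏ m ∈ range n, -((q : ℂ) * b 0 * t ^ m / b 1) =
      (∏ m ∈ range n, -(t ^ (n - 1 + m) * (b 1 / q * b 0))) /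
        ∏ m ∈ range n, (t ^ m * (b 1 / q)) ^ 2 := by
    rw [← prod_div_distrib, ← prod_range_reflect]
    refine prod_congr rfl fun m hm => ?_
    have hm := mem_range.1 hm
    have := htp m
    rw [show n - 1 + m = (n - 1 - m) + m + m by omega, pow_add, pow_add]
    field_simp
  have hD : ∏ m ∈ range n, (t ^ m * (b 1 / q)) ^ 2 ≠ 0 := prod_ne_zero_iff.2 fun m _ =>
    pow_ne_zero _ (mul_ne_zero (htp m) (div_ne_zero hb1 hq))
  rw [mn, e3]
  refine mul_left_cancel₀ hD ?_
  rw [← mul_assoc _ _ (altSum _ _ _ _ _), key]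
  generalize ∏ m ∈ range n, (t ^ m * (b 1 / (q : ℂ))) ^ 2 = D at *
  generalize ∏ m ∈ range n, -(t ^ (n - 1 + m) * (b 1 / q * b 0)) = E at *
  rw [← mul_assoc, ← mul_assoc, mul_div_cancel₀ _ hD]
  ring

/-! ### Evaluation of the truncated sum -/

theorem tendsto_prod_qInf {q : ℝ} (hq0 : 0 < q) (hq1 : q < 1) (u : ℂ) :
    Tendsto (fun N => ∏ i ∈ range N, (1 - (q : ℂ) ^ i * u)) atTop (𝓝 (qInf q u)) :=
  (multipliable_one_sub_pow_mul hq0 hq1 u).hasProd.tendsto_prod_nat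

theorem divSnd_divSnd (b : Fin 2 → ℂ) (w w' : ℂ) : divSnd (divSnd b w) w' = divSnd b (w * w') := by
  funext l
  fin_cases l
  · rfl
  · exact div_div _ _ _

theorem divSnd_by_one (b : Fin 2 → ℂ) : divSnd b 1 = b := by
  funext l
  fin_cases l
  · rfl
  · exact div_one _

theorem Admissible.divSnd_pow {n : ℕ} {q : ℝ} {a b : Fin 2 → ℂ} {t : ℂ} (h : Admissible n q a b t)
    (N : ℕ) : Admissible n q a (QSelberg.divSnd b ((q : ℂ) ^ N)) t := by
  induction N with
  | zero => rwa [pow_zero, divSnd_by_one]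
  | succ N ih =>
    rw [pow_succ, ← divSnd_divSnd]
    exact ih.divSnd

/-- The contiguity relation iterated `N` times. -/
theorem Admissible.contiguity_pow {n : ℕ} {q : ℝ} {a b : Fin 2 → ℂ} {t : ℂ}
    (h : Admissible n q a b t) (hθ : ∀ m ∈ Icc 1 n, theta q (t ^ m) ≠ 0) (N : ℕ) :
    altSum q a b t (truncPoint n (b 0) t) *
        ∏ m ∈ range n, ∏ i ∈ range N,
          (1 - (q : ℂ) ^ i * (q / (a 0 * a 1 * b 0 * b 1 * t ^ (n - 1 + m)))) =
      (∏ m ∈ range n, ((∏ i ∈ range N, (1 - (q : ℂ) ^ i * (q / (a 0 * b 1 * t ^ m)))) *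
        ∏ i ∈ range N, (1 - (q : ℂ) ^ i * (q / (a 1 * b 1 * t ^ m))))) *
        altSum q a (QSelberg.divSnd b ((q : ℂ) ^ N)) t (truncPoint n (b 0) t) := by
  have hq : (q : ℂ) ≠ 0 := by exact_mod_cast h.q_pos.ne'
  induction N with
  | zero => simp [divSnd_by_one]
  | succ N ih =>
    have key := (h.divSnd_pow N).contiguity hθ
    have hqN := pow_ne_zero N hq
    have e1 : ∀ m, (q : ℂ) / (a 0 * a 1 * b 0 * (b 1 / (q : ℂ) ^ N) * t ^ (n - 1 + m)) =
        (q : ℂ) ^ N * (q / (a 0 * a 1 * b 0 * b 1 * t ^ (n - 1 + m))) := fun m => by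
      field_simp
    have e2 : ∀ l m, (q : ℂ) / (a l * (b 1 / (q : ℂ) ^ N) * t ^ m) =
        (q : ℂ) ^ N * (q / (a l * b 1 * t ^ m)) := fun l m => by
      field_simp
    rw [divSnd_divSnd, ← pow_succ] at key
    simp only [divSnd_zero, divSnd_one, e1, e2] at key
    simp only [prod_range_succ _ N]
    simp only [prod_mul_distrib] at ih key ⊢
    linear_combination (∏ m ∈ range n, (1 - (q : ℂ) ^ N *
      (q / (a 0 * a 1 * b 0 * b 1 * t ^ (n - 1 + m))))) * ih + (∏ m ∈ range n,
        ∏ i ∈ range N, (1 - (q : ℂ) ^ i * (q / (a 0 * b 1 * t ^ m)))) * (∏ m ∈ range n,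
        ∏ i ∈ range N, (1 - (q : ℂ) ^ i * (q / (a 1 * b 1 * t ^ m)))) * key

theorem Admissible.norm_lt_one {n : ℕ} {q : ℝ} {a b : Fin 2 → ℂ} {t : ℂ}
    (h : Admissible n q a b t) {m : ℕ} (hm : m < n) :
    ‖(q : ℂ) / (a 0 * a 1 * b 0 * b 1 * t ^ (n - 1 + m))‖ < 1 := by
  refine lt_of_le_of_lt ?_ h.infty_lt
  have hq0 := h.q_pos
  have h1 : ‖t⁻¹‖ ^ m ≤ max 1 ‖t⁻¹‖ ^ (n - 1) :=
    (pow_le_pow_left₀ (norm_nonneg _) (le_max_right _ _) m).trans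
      (pow_le_pow_right₀ (le_max_left _ _) (by omega))
  have e : ‖(q : ℂ) / (a 0 * a 1 * b 0 * b 1 * t ^ (n - 1 + m))‖ =
      ‖q * t ^ (n - 1)‖⁻¹ * (q ^ 2 / (‖a 0‖ * ‖a 1‖ * ‖b 0‖ * ‖b 1‖)) * ‖t⁻¹‖ ^ m := by
    have ht := norm_ne_zero_iff.2 h.t_ne
    have := norm_ne_zero_iff.2 (h.a_ne 0)
    have := norm_ne_zero_iff.2 (h.a_ne 1)
    have := norm_ne_zero_iff.2 (h.b_ne 0)
    have := norm_ne_zero_iff.2 (h.b_ne 1)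
    simp only [norm_div, norm_mul, norm_pow, norm_inv, Complex.norm_real,
      Real.norm_of_nonneg hq0.le, pow_add, inv_pow]
    field_simp
  rw [e, growthInfty]
  exact mul_le_mul_of_nonneg_left h1 (by positivity)

theorem exists_norm_qInf_le {q : ℝ} (hq0 : 0 < q) (hq1 : q < 1) :
    ∃ C, 0 ≤ C ∧ ∀ u v : ℂ, ‖u‖ ≤ 1 / 2 → ‖v‖ ≤ 1 / 2 → ‖qInf q u‖ ≤ C * ‖qInf q v‖ := by
  have hc := continuous_qInf hq0 hq1
  have hne : ∀ v : ℂ, ‖v‖ ≤ 1 / 2 → qInf q v ≠ 0 := fun v hv =>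
    qInf_ne_zero_of_norm_lt_one hq0 hq1 (by linarith)
  have hK : IsCompact (Metric.closedBall (0 : ℂ) (1 / 2)) := isCompact_closedBall _ _
  obtain ⟨v₀, hv₀, hmin⟩ := hK.exists_isMinOn ⟨0, by simp⟩ hc.norm.continuousOn
  obtain ⟨u₀, hu₀, hmax⟩ := hK.exists_isMaxOn ⟨0, by simp⟩ hc.norm.continuousOn
  have hpos : 0 < ‖qInf q v₀‖ := norm_pos_iff.2 (hne _ (by simpa using hv₀))
  refine ⟨‖qInf q u₀‖ / ‖qInf q v₀‖, by positivity, fun u v hu hv => ?_⟩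
  have h1 : ‖qInf q u‖ ≤ ‖qInf q u₀‖ := hmax (by simpa using hu)
  have h2 : ‖qInf q v₀‖ ≤ ‖qInf q v‖ := hmin (by simpa using hv)
  calc _ ≤ ‖qInf q u₀‖ / ‖qInf q v₀‖ * ‖qInf q v₀‖ := by rwa [div_mul_cancel₀ _ hpos.ne']
    _ ≤ _ := by gcongr

/-- The dependence of the summand on `N` when `b_2` is replaced by `b_2 q^{-N}`. -/
theorem term_divSnd_pow {n : ℕ} {q : ℝ} (hq0 : 0 < q) (a : Fin 2 → ℂ) {b : Fin 2 → ℂ}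
    (t : ℂ) (x : Fin n → ℂ) (ν : Fin n → ℤ) (N : ℕ) :
    term q a (divSnd b ((q : ℂ) ^ N)) t x ν =
      ((∏ i, ((q * t ^ (n - 1)) ^ ν i * (qInf q (q * (a 0)⁻¹ * (x i * (q : ℂ) ^ ν i)) *
        (thetaMult q (b 0 * x i) (ν i) * qInf q (q / (b 0 * (x i * (q : ℂ) ^ ν i)))) *
        (qInf q (q * (a 1)⁻¹ * (x i * (q : ℂ) ^ ν i)) * thetaMult q (b 1 * x i) (ν i))))) *
        ∏ i, ∏ j ∈ Ioi i, twoBody q t (x i) (ν i) (x j) (ν j)) *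
      ∏ i, ((((q : ℂ) ^ (-ν i)) ^ N) * qInf q ((q : ℂ) ^ N * (q / (b 1 * (x i * (q : ℂ) ^ ν i))))) := by
  have hq : (q : ℂ) ≠ 0 := by exact_mod_cast hq0.ne'
  have hqN := pow_ne_zero N hq
  rw [term, mul_right_comm]
  refine congrArg (· * _) ?_
  rw [← prod_mul_distrib]
  refine prod_congr rfl fun i _ => ?_
  rw [oneBody, Fin.prod_univ_two, divSnd_zero, divSnd_one]
  have e1 : (q : ℂ) / (b 1 / (q : ℂ) ^ N * (x i * (q : ℂ) ^ ν i)) =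
      (q : ℂ) ^ N * (q / (b 1 * (x i * (q : ℂ) ^ ν i))) := by field_simp
  have e2 : thetaMult q (b 1 / (q : ℂ) ^ N * x i) (ν i) =
      ((q : ℂ) ^ (-ν i)) ^ N * thetaMult q (b 1 * x i) (ν i) := by
    rw [show b 1 / (q : ℂ) ^ N * x i = ((q : ℂ) ^ N)⁻¹ * (b 1 * x i) by ring, thetaMult_mul,
      inv_zpow', ← zpow_natCast, ← zpow_natCast, ← zpow_mul, ← zpow_mul, mul_comm (N : ℤ)]
  rw [e1, e2]
  ring

/-- The limit `b_2 → ∞` of the truncated sum: only the summand at the base point survives. -/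
theorem Admissible.tendsto_altSum {n : ℕ} {q : ℝ} {a b : Fin 2 → ℂ} {t : ℂ}
    (h : Admissible n q a b t) :
    Tendsto (fun N : ℕ => altSum q a (QSelberg.divSnd b ((q : ℂ) ^ N)) t (truncPoint n (b 0) t))
      atTop (𝓝 ((∏ i : Fin n, (qInf q (q / (a 0 * b 0 * t ^ (i : ℕ))) *
        qInf q (q / (a 1 * b 0 * t ^ (i : ℕ))) * qInf q (q * t ^ (i : ℕ)))) *
        ∏ i : Fin n, ∏ j ∈ Ioi i,
          twoBody q t (truncPoint n (b 0) t i) 0 (truncPoint n (b 0) t j) 0)) := by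
  have hq0 := h.q_pos
  have hq1 := h.q_lt_one
  have hq : (q : ℂ) ≠ 0 := by exact_mod_cast hq0.ne'
  set x := truncPoint n (b 0) t with hx
  have hx0 : ∀ i, x i ≠ 0 := truncPoint_ne_zero (h.b_ne 0) h.t_ne
  set L := (∏ i : Fin n, (qInf q (q / (a 0 * b 0 * t ^ (i : ℕ))) *
        qInf q (q / (a 1 * b 0 * t ^ (i : ℕ))) * qInf q (q * t ^ (i : ℕ)))) *
        ∏ i : Fin n, ∏ j ∈ Ioi i, twoBody q t (x i) 0 (x j) 0 with hL
  obtain ⟨C, hC, hCq⟩ := exists_norm_qInf_le hq0 hq1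
  -- From `N₀` on the argument of the moving factor is small.
  have hN₀ : ∃ N₀ : ℕ, ∀ i, q ^ N₀ * ‖(q : ℂ) / (b 1 * x i)‖ ≤ 1 / 2 := by
    have hev : ∀ i, ∀ᶠ N : ℕ in atTop, q ^ N * ‖(q : ℂ) / (b 1 * x i)‖ ≤ 1 / 2 := fun i => by
      have := (tendsto_pow_atTop_nhds_zero_of_lt_one hq0.le hq1).mul_const ‖(q : ℂ) / (b 1 * x i)‖
      rw [zero_mul] at this
      exact this.eventually (eventually_le_nhds (by norm_num))
    exact (eventually_all.2 hev).exists
  obtain ⟨N₀, hN₀⟩ := hN₀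
  have hsmall : ∀ (ν : Fin n → ℤ) (i : Fin n) (N : ℕ), ν i ≤ 0 → N₀ ≤ N →
      ‖(q : ℂ) ^ N * (q / (b 1 * (x i * (q : ℂ) ^ ν i)))‖ ≤ 1 / 2 := by
    intro ν i N hν hN
    have e : (q : ℂ) / (b 1 * (x i * (q : ℂ) ^ ν i)) = (q : ℂ) ^ (-ν i) * (q / (b 1 * x i)) := by
      rw [zpow_neg]
      have := zpow_ne_zero (ν i) hq
      have := h.b_ne 1
      have := hx0 i
      field_simp
    obtain ⟨k, hk⟩ : ∃ k : ℕ, -ν i = k := ⟨(-ν i).toNat, by omega⟩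
    rw [e, hk, zpow_natCast, norm_mul, norm_mul, norm_pow, norm_pow, Complex.norm_real,
      Real.norm_of_nonneg hq0.le]
    refine le_trans ?_ (hN₀ i)
    have h1 : q ^ N ≤ q ^ N₀ := pow_le_pow_of_le_one hq0.le hq1.le hN
    have h2 : q ^ k ≤ 1 := pow_le_one₀ hq0.le hq1.le
    calc _ ≤ q ^ N₀ * (1 * ‖(q : ℂ) / (b 1 * x i)‖) := by gcongr
      _ = _ := by ring
  have hsum := ((h.divSnd_pow N₀).summable_norm hx0).mul_left (C ^ n)
  have hlim : ∑' ν : Fin n → ℤ, (if ν = 0 then L else 0) = L := tsum_ite_eq 0 _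
  rw [← hlim]
  refine tendsto_tsum_of_dominated_convergence hsum (fun ν => ?_) ?_
  · by_cases hν : ∀ i, ν i ≤ 0
    · simp only [term_divSnd_pow hq0]
      have hfac : ∀ i, Tendsto (fun N : ℕ => (((q : ℂ) ^ (-ν i)) ^ N) *
          qInf q ((q : ℂ) ^ N * (q / (b 1 * (x i * (q : ℂ) ^ ν i))))) atTop
          (𝓝 ((if ν i = 0 then 1 else 0) * 1)) := by
        intro i
        refine Tendsto.mul ?_ ?_
        · split_ifs with h0
          · refine tendsto_const_nhds.congr fun N => ?_
            rw [h0, neg_zero, zpow_zero, one_pow]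
          · refine tendsto_pow_atTop_nhds_zero_of_norm_lt_one ?_
            rw [norm_q_zpow hq0]
            have := hν i
            obtain ⟨k, hk⟩ : ∃ k : ℕ, -ν i = k := ⟨(-ν i).toNat, by omega⟩
            rw [hk, zpow_natCast]
            exact pow_lt_one₀ hq0.le hq1 (by omega)
        · have h1 : Tendsto (fun N : ℕ => (q : ℂ) ^ N * (q / (b 1 * (x i * (q : ℂ) ^ ν i)))) atTop
              (𝓝 0) := by
            have := (tendsto_pow_atTop_nhds_zero_of_norm_lt_one (x := (q : ℂ)) (by
              rwa [Complex.norm_real, Real.norm_of_nonneg hq0.le])).mul_const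
                ((q : ℂ) / (b 1 * (x i * (q : ℂ) ^ ν i)))
            rwa [zero_mul] at this
          have h2 := ((continuous_qInf hq0 hq1).tendsto 0).comp h1
          rwa [qInf_zero] at h2
      have hprod := tendsto_finsetProd univ fun i (_ : i ∈ univ) => hfac i
      have := hprod.const_mul ((∏ i, ((q * t ^ (n - 1)) ^ ν i *
        (qInf q (q * (a 0)⁻¹ * (x i * (q : ℂ) ^ ν i)) *
        (thetaMult q (b 0 * x i) (ν i) * qInf q (q / (b 0 * (x i * (q : ℂ) ^ ν i)))) *
        (qInf q (q * (a 1)⁻¹ * (x i * (q : ℂ) ^ ν i)) * thetaMult q (b 1 * x i) (ν i))))) *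
        ∏ i, ∏ j ∈ Ioi i, twoBody q t (x i) (ν i) (x j) (ν j))
      convert this using 2
      split_ifs with h0
      · subst h0
        simp only [Pi.zero_apply, zpow_zero, mul_one, if_true, prod_const_one, thetaMult_zero,
          one_mul]
        rw [hL]
        congr 1
        refine prod_congr rfl fun i _ => ?_
        have ht := pow_ne_zero (i : ℕ) h.t_ne
        have e1 : ∀ l, (q : ℂ) * (a l)⁻¹ * x i = q / (a l * b 0 * t ^ (i : ℕ)) := fun l => by
          rw [hx, truncPoint, inv_pow, div_eq_mul_inv, mul_inv, mul_inv]; ring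
        have e2 : (q : ℂ) / (b 0 * x i) = q * t ^ (i : ℕ) := by
          have := h.b_ne 0
          rw [hx, truncPoint, inv_pow]; field_simp
        rw [e1, e1, e2]
        ring
      · obtain ⟨i, hi⟩ : ∃ i, ν i ≠ 0 := by
          by_contra hcon
          push Not at hcon
          exact h0 (funext hcon)
        have hz : ∏ i, ((if ν i = 0 then (1 : ℂ) else 0) * 1) = 0 :=
          prod_eq_zero (mem_univ i) (by simp [hi])
        rw [hz, mul_zero]
    · have h0 : ν ≠ 0 := by
        rintro rfl
        simp at hν
      rw [if_neg h0]
      refine tendsto_const_nhds.congr fun N => ?_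
      by_contra hne
      exact hν (le_zero_of_term_ne_zero hq0 hq1
        (b := QSelberg.divSnd b ((q : ℂ) ^ N)) (h.b_ne 0) h.t_ne (Ne.symm hne))
  · filter_upwards [eventually_ge_atTop N₀] with N hN ν
    by_cases hν : ∀ i, ν i ≤ 0
    · simp only [term_divSnd_pow hq0]
      rw [norm_mul, norm_mul (_ * _) (∏ i, _), mul_left_comm]
      refine mul_le_mul_of_nonneg_left ?_ (norm_nonneg _)
      rw [norm_prod, norm_prod]
      calc _ ≤ ∏ i, (C * ‖(((q : ℂ) ^ (-ν i)) ^ N₀) *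
            qInf q ((q : ℂ) ^ N₀ * (q / (b 1 * (x i * (q : ℂ) ^ ν i))))‖) := by
            refine prod_le_prod (fun _ _ => norm_nonneg _) fun i _ => ?_
            rw [norm_mul, norm_mul, norm_pow, norm_pow, mul_left_comm C]
            refine mul_le_mul (pow_le_pow_of_le_one (norm_nonneg _) ?_ hN)
              (hCq _ _ (hsmall ν i N (hν i) hN) (hsmall ν i N₀ (hν i) le_rfl)) (norm_nonneg _)
              (by positivity)
            rw [norm_q_zpow hq0]
            obtain ⟨k, hk⟩ : ∃ k : ℕ, -ν i = k := ⟨(-ν i).toNat, by have := hν i; omega⟩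
            rw [hk, zpow_natCast]
            exact pow_le_one₀ hq0.le hq1.le
        _ = _ := by
            rw [prod_mul_distrib, prod_const, card_univ, Fintype.card_fin]
    · have h0 : term q a (QSelberg.divSnd b ((q : ℂ) ^ N)) t x ν = 0 := by
        by_contra hne
        exact hν (le_zero_of_term_ne_zero hq0 hq1
          (b := QSelberg.divSnd b ((q : ℂ) ^ N)) (h.b_ne 0) h.t_ne hne)
      rw [h0, norm_zero]
      positivity

theorem prod_Ioi_sub {M : Type*} [CommMonoid M] (f : ℕ → M) (n : ℕ) :
    ∏ i : Fin n, ∏ j ∈ Ioi i, f (j - i) = ∏ k ∈ range n, ∏ d ∈ range k, f (d + 1) := by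
  induction n with
  | zero => simp
  | succ n ih =>
    rw [Fin.prod_univ_succ, Fin.prod_Ioi_zero, prod_range_succ, mul_comm, ← ih]
    congr 1
    · refine prod_congr rfl fun i _ => ?_
      rw [Fin.prod_Ioi_succ]
      refine prod_congr rfl fun j _ => ?_
      simp
    · rw [← Fin.prod_univ_eq_prod_range (fun d => f (d + 1))]
      simp

theorem qInf_div_pow_ne_zero {q : ℝ} (hq0 : 0 < q) (hq1 : q < 1) {u : ℂ} (h : theta q u ≠ 0) :
    qInf q (q / u) ≠ 0 ∧ qInf q (q * u) ≠ 0 := by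
  rw [theta, qInf_step hq0 hq1 u] at h
  exact ⟨right_ne_zero_of_mul h, right_ne_zero_of_mul (left_ne_zero_of_mul h)⟩

/-- The two-body factors at the truncation point, relative to the theta Vandermonde product. -/
theorem prod_twoBody_truncPoint {n : ℕ} {q : ℝ} (hq0 : 0 < q) (hq1 : q < 1) {β t : ℂ} (hβ : β ≠ 0)
    (ht : t ≠ 0) (hθ : ∀ m ∈ Icc 1 n, theta q (t ^ m) ≠ 0) :
    (∏ i : Fin n, qInf q (q * t ^ (i : ℕ))) * ((∏ i : Fin n, ∏ j ∈ Ioi i,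
        twoBody q t (truncPoint n β t i) 0 (truncPoint n β t j) 0) /
        thetaVand q (truncPoint n β t)) =
      ∏ k ∈ range n, (qInf q q * qInf q (q / t ^ (k + 1)) / qInf q (q / t)) := by
  have hq : (q : ℂ) ≠ 0 := by exact_mod_cast hq0.ne'
  have hne : ∀ d, 0 < d → d ≤ n → qInf q (q / t ^ d) ≠ 0 ∧ qInf q (q * t ^ d) ≠ 0 :=
    fun d hd hdn => qInf_div_pow_ne_zero hq0 hq1 (hθ d (mem_Icc.2 ⟨hd, hdn⟩))
  have hqq : qInf q (q * t ^ 0) ≠ 0 := by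
    refine qInf_ne_zero_of_norm_lt_one hq0 hq1 ?_
    rwa [pow_zero, mul_one, Complex.norm_real, Real.norm_of_nonneg hq0.le]
  have hx0 : ∀ i, truncPoint n β t i ≠ 0 := truncPoint_ne_zero hβ ht
  have hpair : ∀ i : Fin n, ∀ j ∈ Ioi i,
      twoBody q t (truncPoint n β t i) 0 (truncPoint n β t j) 0 /
        (truncPoint n β t i * theta q (truncPoint n β t j / truncPoint n β t i)) =
      qInf q (q / t ^ ((j : ℕ) - i + 1)) * qInf q (q * t ^ ((j : ℕ) - i - 1)) /
        (qInf q (q / t ^ ((j : ℕ) - i)) * qInf q (q * t ^ ((j : ℕ) - i))) := by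
    intro i j hj
    have hij : (i : ℕ) < j := Fin.lt_def.1 (mem_Ioi.1 hj)
    have hv : truncPoint n β t j / truncPoint n β t i = (t ^ ((j : ℕ) - i))⁻¹ := by
      rw [truncPoint_div hβ ht, ← zpow_natCast, ← zpow_neg]
      congr 1; omega
    have hθv := theta_truncPoint_div hq0 hq1 hβ ht hθ j i (fun h => by subst h; omega)
    rw [hv, theta, qInf_step hq0 hq1] at hθv
    have h1 := left_ne_zero_of_mul (left_ne_zero_of_mul hθv)
    have hx := hx0 i
    obtain ⟨d, hd⟩ : ∃ d, (j : ℕ) - i = d + 1 := ⟨(j : ℕ) - i - 1, by omega⟩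
    have htd := pow_ne_zero d ht
    rw [twoBody, hv, sub_zero, zpow_zero, mul_one, thetaMult_zero, mul_one, theta,
      qInf_step hq0 hq1 (t ^ ((j : ℕ) - i))⁻¹, hd, Nat.add_sub_cancel]
    have e1 : (q : ℂ) * t⁻¹ * (t ^ (d + 1))⁻¹ = q / t ^ (d + 1 + 1) := by
      rw [pow_succ t (d + 1)]; field_simp
    have e2 : (q : ℂ) / (t * (t ^ (d + 1))⁻¹) = q * t ^ d := by
      rw [pow_succ]; field_simp
    have e3 : (q : ℂ) / (t ^ (d + 1))⁻¹ = q * t ^ (d + 1) := div_inv_eq_mul _ _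
    rw [e1, e2, e3, ← div_eq_mul_inv]
    rw [hd] at h1
    rw [mul_assoc, mul_div_mul_left _ _ hx, mul_assoc (1 - (t ^ (d + 1))⁻¹), mul_div_mul_left _ _ h1]
  rw [thetaVand, ← prod_div_distrib]
  simp only [← prod_div_distrib]
  rw [prod_congr rfl fun i _ => prod_congr rfl (hpair i),
    prod_Ioi_sub (fun d => qInf q (q / t ^ (d + 1)) * qInf q (q * t ^ (d - 1)) /
        (qInf q (q / t ^ d) * qInf q (q * t ^ d))),
    Fin.prod_univ_eq_prod_range (fun i => qInf q (q * t ^ i)), ← prod_mul_distrib]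
  refine prod_congr rfl fun k hk => ?_
  have hk := mem_range.1 hk
  have tele : ∀ k < n, ∏ d ∈ range k, (qInf q (q / t ^ (d + 1 + 1)) * qInf q (q * t ^ (d + 1 - 1)) /
        (qInf q (q / t ^ (d + 1)) * qInf q (q * t ^ (d + 1)))) =
      qInf q (q / t ^ (k + 1)) * qInf q (q * t ^ 0) / (qInf q (q / t ^ 1) * qInf q (q * t ^ k)) := by
    intro k
    induction k with
    | zero =>
      intro hn
      have h1 := (hne 1 one_pos (by omega)).1
      rw [range_zero, prod_empty, div_self]
      exact mul_ne_zero (by simpa using h1) hqq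
    | succ k ih =>
      intro hkn
      rw [prod_range_succ, ih (by omega), Nat.add_sub_cancel]
      have h1 := (hne 1 one_pos (by omega)).1
      have h2 := (hne (k + 1) (by omega) (by omega)).1
      have h3 := (hne (k + 1) (by omega) (by omega)).2
      have h4 : qInf q (q * t ^ k) ≠ 0 := by
        rcases Nat.eq_zero_or_pos k with rfl | hk
        · exact hqq
        · exact (hne k hk (by omega)).2
      generalize qInf q (q / t ^ (k + 1)) = A1 at *
      generalize qInf q (q / t ^ (k + 1 + 1)) = A2 at *
      generalize qInf q (q * t ^ (k + 1)) = A3 at *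
      generalize qInf q (q * t ^ k) = A4 at *
      field_simp
  have h4 : qInf q (q * t ^ k) ≠ 0 := by
    rcases Nat.eq_zero_or_pos k with rfl | hk'
    · exact hqq
    · exact (hne k hk' hk.le).2
  rw [tele k hk, pow_zero, mul_one, pow_one]
  field_simp

/-- The product formula, without the factor `(1-q)^n`. -/
def prodValue (q : ℝ) (a b : Fin 2 → ℂ) (t : ℂ) (n : ℕ) : ℂ :=
  ∏ k ∈ Icc 1 n,
    (qInf q q * qInf q ((q : ℂ) * t ^ (-(k : ℤ))) *
      ∏ i : Fin 2, ∏ j : Fin 2,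
        qInf q ((q : ℂ) * (a i)⁻¹ * (b j)⁻¹ * t ^ (-((k : ℤ) - 1)))) /
    (qInf q ((q : ℂ) * t⁻¹) *
      qInf q ((q : ℂ) * (a 0)⁻¹ * (a 1)⁻¹ * (b 0)⁻¹ * (b 1)⁻¹ * t ^ (-((n : ℤ) + k - 2))))

/-- The value of the symmetric sum at the truncation point. -/
theorem Admissible.symSum_truncPoint {n : ℕ} {q : ℝ} {a b : Fin 2 → ℂ} {t : ℂ}
    (h : Admissible n q a b t) (hθ : ∀ m ∈ Icc 1 n, theta q (t ^ m) ≠ 0) :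
    symSum q a b t (truncPoint n (b 0) t) = prodValue q a b t n := by
  have hq0 := h.q_pos
  have hq1 := h.q_lt_one
  have ht := h.t_ne
  have hl := (tendsto_finsetProd (range n) fun m _ => tendsto_prod_qInf hq0 hq1
    (q / (a 0 * a 1 * b 0 * b 1 * t ^ (n - 1 + m)))).const_mul
    (altSum q a b t (truncPoint n (b 0) t))
  have hr := (tendsto_finsetProd (range n) fun m _ =>
    (tendsto_prod_qInf hq0 hq1 (q / (a 0 * b 1 * t ^ m))).mul
      (tendsto_prod_qInf hq0 hq1 (q / (a 1 * b 1 * t ^ m)))).mul h.tendsto_altSum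
  have key := tendsto_nhds_unique (hl.congr fun N => h.contiguity_pow hθ N) hr
  have hD : ∏ m ∈ range n, qInf q (q / (a 0 * a 1 * b 0 * b 1 * t ^ (n - 1 + m))) ≠ 0 :=
    prod_ne_zero_iff.2 fun m hm => qInf_ne_zero_of_norm_lt_one hq0 hq1
      (h.norm_lt_one (mem_range.1 hm))
  rw [← eq_div_iff hD] at key
  have hp := prod_twoBody_truncPoint hq0 hq1 (h.b_ne 0) ht hθ
  rw [symSum, key]
  have e : ∀ E A B Q T V D : ℂ, E * (A * B * Q * T) / D / V = E * (A * B) * (Q * (T / V)) / D :=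
    fun E A B Q T V D => by ring
  rw [prod_mul_distrib (f := fun i : Fin n => qInf q (q / (a 0 * b 0 * t ^ (i : ℕ))) *
        qInf q (q / (a 1 * b 0 * t ^ (i : ℕ)))), prod_mul_distrib (f := fun i : Fin n =>
        qInf q (q / (a 0 * b 0 * t ^ (i : ℕ)))), e, hp,
    Fin.prod_univ_eq_prod_range (fun i => qInf q (q / (a 0 * b 0 * t ^ i))),
    Fin.prod_univ_eq_prod_range (fun i => qInf q (q / (a 1 * b 0 * t ^ i))),
    ← prod_mul_distrib, ← prod_mul_distrib, ← prod_mul_distrib, ← prod_div_distrib, prodValue,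
    prod_Icc_one]
  refine prod_congr rfl fun k hk => ?_
  have hk := mem_range.1 hk
  have e1 : ∀ u v : ℂ, (q : ℂ) * u⁻¹ * v⁻¹ * t ^ (-(((k + 1 : ℕ) : ℤ) - 1)) = q / (u * v * t ^ k) := by
    intro u v
    rw [zpow_neg, show ((k + 1 : ℕ) : ℤ) - 1 = k by push_cast; ring, zpow_natCast, div_eq_mul_inv,
      mul_inv, mul_inv]
    ring
  have e2 : (q : ℂ) * (a 0)⁻¹ * (a 1)⁻¹ * (b 0)⁻¹ * (b 1)⁻¹ *
      t ^ (-((n : ℤ) + (k + 1 : ℕ) - 2)) = q / (a 0 * a 1 * b 0 * b 1 * t ^ (n - 1 + k)) := by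
    rw [zpow_neg, show (n : ℤ) + (k + 1 : ℕ) - 2 = (n - 1 + k : ℕ) by omega, zpow_natCast,
      div_eq_mul_inv, mul_inv, mul_inv, mul_inv, mul_inv]
    ring
  have e3 : (q : ℂ) * t ^ (-((k + 1 : ℕ) : ℤ)) = q / t ^ (k + 1) := by
    rw [zpow_neg, zpow_natCast, div_eq_mul_inv]
  simp only [Fin.prod_univ_two, e1]
  rw [e2, e3, ← div_eq_mul_inv]
  ring

/-! ### The sum at two interlaced truncation points -/

/-- The point `(x₁, x₁ r, …, x₁ r^{i-1}, x₂, x₂ r, …, x₂ r^{n-i-1})`. -/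
def pairPoint (n i : ℕ) (x₁ x₂ r : ℂ) : Fin n → ℂ := fun k =>
  if (k : ℕ) < i then x₁ * r ^ (k : ℕ) else x₂ * r ^ ((k : ℕ) - i)

theorem pairPoint_ne_zero {n i : ℕ} {x₁ x₂ r : ℂ} (hx₁ : x₁ ≠ 0) (hx₂ : x₂ ≠ 0) (hr : r ≠ 0)
    (k : Fin n) : pairPoint n i x₁ x₂ r k ≠ 0 := by
  rw [pairPoint]
  split_ifs
  · exact mul_ne_zero hx₁ (pow_ne_zero _ hr)
  · exact mul_ne_zero hx₂ (pow_ne_zero _ hr)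

theorem pairPoint_inv (n i : ℕ) (x₁ x₂ r : ℂ) (k : Fin n) :
    pairPoint n i x₁⁻¹ x₂⁻¹ r⁻¹ k = (pairPoint n i x₁ x₂ r k)⁻¹ := by
  rw [pairPoint, pairPoint]
  split_ifs <;> rw [mul_inv, inv_pow]

theorem symSum_pairPoint {n i : ℕ} (q : ℝ) (a b : Fin 2 → ℂ) (t x₁ x₂ r : ℂ) (hi : i ≤ n) :
    symSum q a b t (pairPoint n i x₁ x₂ r) =
      symList q a b t (geomList x₁ r i ++ geomList x₂ r (n - i)) := by
  have hl : (geomList x₁ r i ++ geomList x₂ r (n - i)).length = n := by simp; omega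
  refine symSum_eq_symList q a b t hl fun k => ?_
  rw [pairPoint]
  split_ifs with hk
  · rw [List.get_eq_getElem, List.getElem_append_left (by rw [length_geomList]; exact hk)]
    simp only [geomList, List.getElem_map, List.getElem_range]
    rfl
  · rw [List.get_eq_getElem, List.getElem_append_right (by
      rw [length_geomList]; exact Nat.le_of_not_lt hk)]
    simp only [geomList, List.getElem_map, List.getElem_range, List.length_map, List.length_range]
    rfl

theorem symList_geomList_inv {n : ℕ} (q : ℝ) (a b : Fin 2 → ℂ) (t β : ℂ) :
    symList q a b t (geomList β⁻¹ t⁻¹ n) = symSum q a b t (truncPoint n β t) :=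
  (symSum_eq_symList q a b t (length_geomList _ _ _) fun k => by
    rw [List.get_eq_getElem]
    simp only [geomList, truncPoint, List.getElem_map, List.getElem_range]
    rfl).symm

theorem regular_pair {q : ℝ} (hq0 : 0 < q) (hq1 : q < 1) {t : ℂ} {b : Fin 2 → ℂ} {n i : ℕ}
    (ht : t ≠ 0) (hb : ∀ l, b l ≠ 0) (h1 : ∀ m ∈ Icc 1 n, theta q (t ^ m) ≠ 0)
    (h2 : ∀ m : ℤ, |m| < (n : ℤ) → theta q (b 0 / b 1 * t ^ m) ≠ 0) (hi : i ≤ n) :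
    Regular q (geomList (b 0)⁻¹ t⁻¹ i ++ geomList (b 1)⁻¹ t⁻¹ (n - i)) := by
  have hpow : ∀ k, 0 < k → k ≤ n → theta q (t⁻¹ ^ k) ≠ 0 := fun k hk hkn => by
    rw [inv_pow, Ne, theta_inv_eq_zero_iff hq0 hq1 (pow_ne_zero _ ht)]
    exact h1 k (mem_Icc.2 ⟨hk, hkn⟩)
  refine Regular.append hq0 hq1
    (regular_geomList hq0 hq1 (inv_ne_zero (hb 0)) (inv_ne_zero ht) fun k hk hkm =>
      hpow k hk (by omega))
    (regular_geomList hq0 hq1 (inv_ne_zero (hb 1)) (inv_ne_zero ht) fun k hk hkm =>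
      hpow k hk (by omega)) fun x hx y hy => ?_
  obtain ⟨k, hk, rfl⟩ := mem_geomList.1 hx
  obtain ⟨l, hl, rfl⟩ := mem_geomList.1 hy
  have e : (b 1)⁻¹ * t⁻¹ ^ l / ((b 0)⁻¹ * t⁻¹ ^ k) = b 0 / b 1 * t ^ ((k : ℤ) - l) := by
    rw [zpow_sub₀ ht, zpow_natCast, zpow_natCast, inv_pow, inv_pow]; field_simp
  rw [e]
  exact h2 _ (by rw [abs_lt]; constructor <;> omega)

/-- For generic parameters the sum at the interlaced truncation points does not depend on `i`: as a
function of one variable `y` it is invariant under `y ↦ 1/(b₁b₂t^{n-1}y)`, which exchanges the last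
point of the first progression with the next point of the second one. -/
theorem Admissible.symList_pair_of_theta_ne_zero {n : ℕ} {q : ℝ} {a b : Fin 2 → ℂ} {t : ℂ}
    (h : Admissible n q a b t) (h1 : ∀ m ∈ Icc 1 n, theta q (t ^ m) ≠ 0)
    (h2 : ∀ m : ℤ, |m| < (n : ℤ) → theta q (b 0 / b 1 * t ^ m) ≠ 0) {i : ℕ} (hi : i ≤ n) :
    symList q a b t (geomList (b 0)⁻¹ t⁻¹ i ++ geomList (b 1)⁻¹ t⁻¹ (n - i)) =
      prodValue q a b t n := by
  have hq0 := h.q_pos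
  have hq1 := h.q_lt_one
  have ht := h.t_ne
  have hreg : ∀ i ≤ n, _ := fun i hi => regular_pair (i := i) hq0 hq1 ht h.b_ne h1 h2 hi
  refine Nat.decreasingInduction' (P := fun i => symList q a b t
    (geomList (b 0)⁻¹ t⁻¹ i ++ geomList (b 1)⁻¹ t⁻¹ (n - i)) = prodValue q a b t n)
    (fun i hin _ ih => ?_) hi ?_
  · obtain ⟨m, rfl⟩ : ∃ m, n = m + 1 := ⟨n - 1, by omega⟩
    rw [← ih]
    set p := geomList (b 0)⁻¹ t⁻¹ i ++ geomList (b 1)⁻¹ t⁻¹ (m - i) with hp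
    have p1 : (geomList (b 0)⁻¹ t⁻¹ (i + 1) ++ geomList (b 1)⁻¹ t⁻¹ (m + 1 - (i + 1))).Perm
        ((b 0)⁻¹ * t⁻¹ ^ i :: p) := by
      rw [geomList_succ, List.append_assoc, List.singleton_append, Nat.add_sub_add_right]
      exact List.perm_middle
    have p2 : (geomList (b 0)⁻¹ t⁻¹ i ++ geomList (b 1)⁻¹ t⁻¹ (m + 1 - i)).Perm
        ((b 1)⁻¹ * t⁻¹ ^ (m - i) :: p) := by
      rw [Nat.succ_sub (Nat.lt_succ_iff.1 hin), geomList_succ, ← List.append_assoc]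
      exact List.perm_append_singleton _ _
    have r1 := (hreg (i + 1) hin).perm p1
    have r2 := (hreg i hin.le).perm p2
    obtain ⟨f, hf, hfs⟩ := h.exists_slice_list (p := p) (by
      simp only [hp, List.length_append, length_geomList]; omega) r1.of_cons
    rw [symList_perm hq0 hq1 a b t (hreg i hin.le).ne_zero p2,
      symList_perm hq0 hq1 a b t (hreg (i + 1) hin).ne_zero p1, hfs _ r1, hfs _ r2]
    have hc : b 0 * b 1 * t ^ m ≠ 0 :=
      mul_ne_zero (mul_ne_zero (h.b_ne 0) (h.b_ne 1)) (pow_ne_zero _ ht)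
    rw [← hf.even hq0 hq1 hc (r1.ne_zero _ List.mem_cons_self)]
    congr 1
    have h0 := h.b_ne 0
    have h1 := h.b_ne 1
    rw [inv_pow, inv_pow, show t ^ m = t ^ (m - i) * t ^ i by rw [← pow_add]; congr 1; omega]
    field_simp
  · rw [Nat.sub_self, show geomList (b 1)⁻¹ t⁻¹ 0 = [] from rfl, List.append_nil,
      symList_geomList_inv, h.symSum_truncPoint h1]

/-! ### Continuity in the parameters -/

theorem continuousAt_growthZero (n : ℕ) (q : ℝ) {t : ℂ} (ht : t ≠ 0) :
    ContinuousAt (growthZero n q) t := by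
  unfold growthZero
  have : ContinuousAt (fun t : ℂ => t⁻¹) t := continuousAt_inv₀ ht
  fun_prop

theorem continuousAt_growthInfty (n : ℕ) {q : ℝ} (hq0 : 0 < q) (a : Fin 2 → ℂ)
    {p : (Fin 2 → ℂ) × ℂ} (ha : ∀ l, a l ≠ 0) (hb : ∀ l, p.1 l ≠ 0) (ht : p.2 ≠ 0) :
    ContinuousAt (fun p : (Fin 2 → ℂ) × ℂ => growthInfty n q a p.1 p.2) p := by
  have hq : (q : ℂ) ≠ 0 := by exact_mod_cast hq0.ne'
  unfold growthInfty
  have h1 : ContinuousAt (fun p : (Fin 2 → ℂ) × ℂ => p.2⁻¹) p := continuousAt_snd.inv₀ ht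
  have h2 : ContinuousAt (fun p : (Fin 2 → ℂ) × ℂ => ‖q * p.2 ^ (n - 1)‖⁻¹) p := by
    refine ContinuousAt.inv₀ (by fun_prop) ?_
    exact norm_ne_zero_iff.2 (mul_ne_zero hq (pow_ne_zero _ ht))
  have h3 : ContinuousAt (fun p : (Fin 2 → ℂ) × ℂ =>
      q ^ 2 / (‖a 0‖ * ‖a 1‖ * ‖p.1 0‖ * ‖p.1 1‖)) p := by
    refine ContinuousAt.div₀ (by fun_prop) (by fun_prop) ?_
    have := norm_ne_zero_iff.2 (ha 0)
    have := norm_ne_zero_iff.2 (ha 1)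
    have := norm_ne_zero_iff.2 (hb 0)
    have := norm_ne_zero_iff.2 (hb 1)
    positivity
  fun_prop

theorem Admissible.eventually {n : ℕ} {q : ℝ} {a b : Fin 2 → ℂ} {t : ℂ} (h : Admissible n q a b t) :
    ∀ᶠ p : (Fin 2 → ℂ) × ℂ in 𝓝 (b, t), Admissible n q a p.1 p.2 := by
  have h1 : ∀ᶠ p : (Fin 2 → ℂ) × ℂ in 𝓝 (b, t), growthZero n q p.2 < 1 :=
    ((continuousAt_growthZero n q h.t_ne).comp (f := Prod.snd) (x := (b, t))
      continuousAt_snd).eventually_lt_const h.zero_lt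
  have h2 : ∀ᶠ p : (Fin 2 → ℂ) × ℂ in 𝓝 (b, t), growthInfty n q a p.1 p.2 < 1 :=
    (continuousAt_growthInfty n h.q_pos a (p := (b, t)) h.a_ne h.b_ne h.t_ne).eventually_lt_const
      h.infty_lt
  have h3 : ∀ᶠ p : (Fin 2 → ℂ) × ℂ in 𝓝 (b, t), p.2 ≠ 0 :=
    continuousAt_snd.eventually_ne h.t_ne
  have h4 : ∀ᶠ p : (Fin 2 → ℂ) × ℂ in 𝓝 (b, t), ∀ l, p.1 l ≠ 0 := eventually_all.2 fun l => by
    have : ContinuousAt (fun p : (Fin 2 → ℂ) × ℂ => p.1 l) (b, t) := by fun_prop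
    exact this.eventually_ne (h.b_ne l)
  filter_upwards [h1, h2, h3, h4] with p h1 h2 h3 h4
  exact ⟨h.q_pos, h.q_lt_one, h.a_ne, h4, h3, h1, h2⟩

theorem continuousAt_thetaMult (q : ℝ) {u : ℂ} (hu : u ≠ 0) (k : ℤ) :
    ContinuousAt (fun u => thetaMult q u k) u := by
  unfold thetaMult
  exact (continuousAt_id.neg.zpow₀ k (Or.inl (neg_ne_zero.2 hu))).mul continuousAt_const

theorem continuousAt_term {n : ℕ} {q : ℝ} (hq0 : 0 < q) (hq1 : q < 1) (a : Fin 2 → ℂ)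
    {p : (Fin 2 → ℂ) × ℂ × (Fin n → ℂ)} (hb : ∀ l, p.1 l ≠ 0) (ht : p.2.1 ≠ 0)
    (hx : ∀ i, p.2.2 i ≠ 0) (ν : Fin n → ℤ) :
    ContinuousAt (fun p : (Fin 2 → ℂ) × ℂ × (Fin n → ℂ) => term q a p.1 p.2.1 p.2.2 ν) p := by
  have hq : (q : ℂ) ≠ 0 := by exact_mod_cast hq0.ne'
  have hQ : ∀ {g : (Fin 2 → ℂ) × ℂ × (Fin n → ℂ) → ℂ}, ContinuousAt g p →
      ContinuousAt (fun p => qInf q (g p)) p := fun hg =>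
    (continuous_qInf hq0 hq1).continuousAt.comp hg
  have hT : ∀ {g : (Fin 2 → ℂ) × ℂ × (Fin n → ℂ) → ℂ} (k : ℤ), ContinuousAt g p → g p ≠ 0 →
      ContinuousAt (fun p => thetaMult q (g p) k) p := fun {g} k hg h0 =>
    ContinuousAt.comp (g := fun u => thetaMult q u k) (continuousAt_thetaMult q h0 k) hg
  unfold term
  refine ContinuousAt.mul ?_ ?_
  · refine tendsto_finsetProd _ fun i _ => ?_
    unfold oneBody
    have hqk := zpow_ne_zero (ν i) hq
    refine ContinuousAt.mul (ContinuousAt.zpow₀ (by fun_prop) _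
      (Or.inl (mul_ne_zero hq (pow_ne_zero _ ht)))) (tendsto_finsetProd _ fun l _ => ?_)
    refine (hQ (by fun_prop)).mul ((hT _ (by fun_prop) (mul_ne_zero (hb l) (hx i))).mul (hQ ?_))
    exact ContinuousAt.div₀ (by fun_prop) (by fun_prop)
      (mul_ne_zero (hb l) (mul_ne_zero (hx i) hqk))
  · refine tendsto_finsetProd _ fun i _ => tendsto_finsetProd _ fun j _ => ?_
    unfold twoBody
    have hqk := zpow_ne_zero (ν j - ν i) hq
    have hd : ContinuousAt (fun p : (Fin 2 → ℂ) × ℂ × (Fin n → ℂ) => p.2.2 j / p.2.2 i) p :=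
      ContinuousAt.div₀ (by fun_prop) (by fun_prop) (hx i)
    have hti : ContinuousAt (fun p : (Fin 2 → ℂ) × ℂ × (Fin n → ℂ) => p.2.1⁻¹) p :=
      ContinuousAt.inv₀ (by fun_prop) ht
    have hd0 : p.2.2 j / p.2.2 i ≠ 0 := div_ne_zero (hx j) (hx i)
    refine ContinuousAt.mul (ContinuousAt.mul (by fun_prop) (hT _ hd hd0))
      (ContinuousAt.mul (hQ (by fun_prop)) (hQ ?_))
    exact ContinuousAt.div₀ (by fun_prop) (by fun_prop) (mul_ne_zero ht (mul_ne_zero hd0 hqk))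

theorem Admissible.continuousAt_altSum {n : ℕ} {q : ℝ} {a b : Fin 2 → ℂ} {t : ℂ}
    (h : Admissible n q a b t) {x : Fin n → ℂ} (hx : ∀ i, x i ≠ 0) :
    ContinuousAt (fun p : (Fin 2 → ℂ) × ℂ × (Fin n → ℂ) => altSum q a p.1 p.2.1 p.2.2)
      (b, t, x) := by
  have hq0 := h.q_pos
  have hq1 := h.q_lt_one
  obtain ⟨ρ, hρ, hρ1⟩ := exists_between h.zero_lt
  obtain ⟨σ, hσ, hσ1⟩ := exists_between h.infty_lt
  have hbt : ContinuousAt (fun p : (Fin 2 → ℂ) × ℂ × (Fin n → ℂ) => (p.1, p.2.1)) (b, t, x) := by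
    fun_prop
  have e1 : ∀ᶠ p : (Fin 2 → ℂ) × ℂ × (Fin n → ℂ) in 𝓝 (b, t, x), growthZero n q p.2.1 < ρ :=
    (ContinuousAt.comp (g := growthZero n q)
      (f := fun p : (Fin 2 → ℂ) × ℂ × (Fin n → ℂ) => p.2.1) (x := (b, t, x))
      (continuousAt_growthZero n q h.t_ne) (by fun_prop)).eventually_lt_const hρ
  have e2 : ∀ᶠ p : (Fin 2 → ℂ) × ℂ × (Fin n → ℂ) in 𝓝 (b, t, x),
      growthInfty n q a p.1 p.2.1 < σ :=
    (ContinuousAt.comp (g := fun p : (Fin 2 → ℂ) × ℂ => growthInfty n q a p.1 p.2)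
      (f := fun p : (Fin 2 → ℂ) × ℂ × (Fin n → ℂ) => (p.1, p.2.1)) (x := (b, t, x))
      (continuousAt_growthInfty n hq0 a h.a_ne h.b_ne h.t_ne) hbt).eventually_lt_const hσ
  have e3 : ∀ᶠ p : (Fin 2 → ℂ) × ℂ × (Fin n → ℂ) in 𝓝 (b, t, x), Admissible n q a p.1 p.2.1 :=
    hbt.eventually h.eventually
  have e4 : ∀ᶠ p : (Fin 2 → ℂ) × ℂ × (Fin n → ℂ) in 𝓝 (b, t, x), ∀ i, p.2.2 i ≠ 0 :=
    eventually_all.2 fun i => by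
      have : ContinuousAt (fun p : (Fin 2 → ℂ) × ℂ × (Fin n → ℂ) => p.2.2 i) (b, t, x) := by
        fun_prop
      exact this.eventually_ne (hx i)
  have e5 : ∀ᶠ p : (Fin 2 → ℂ) × ℂ × (Fin n → ℂ) in 𝓝 (b, t, x),
      size a p.1 p.2.1 p.2.2 < size a b t x + 1 := by
    have hc : ContinuousAt (fun p : (Fin 2 → ℂ) × ℂ × (Fin n → ℂ) => size a p.1 p.2.1 p.2.2)
        (b, t, x) := by
      unfold size
      have ht : ContinuousAt (fun p : (Fin 2 → ℂ) × ℂ × (Fin n → ℂ) => p.2.1⁻¹) (b, t, x) :=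
        ContinuousAt.inv₀ (by fun_prop) h.t_ne
      have hb : ∀ l, ContinuousAt (fun p : (Fin 2 → ℂ) × ℂ × (Fin n → ℂ) => (p.1 l)⁻¹)
          (b, t, x) := fun l => ContinuousAt.inv₀ (by fun_prop) (h.b_ne l)
      have hx' : ∀ i, ContinuousAt (fun p : (Fin 2 → ℂ) × ℂ × (Fin n → ℂ) => (p.2.2 i)⁻¹)
          (b, t, x) := fun i => ContinuousAt.inv₀ (by fun_prop) (hx i)
      refine ContinuousAt.add (ContinuousAt.add (by fun_prop) (tendsto_finsetSum _ fun l _ => ?_))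
        (tendsto_finsetSum _ fun i _ => ?_)
      · have := hb l
        exact ContinuousAt.add (by fun_prop) (by fun_prop)
      · have := hx' i
        exact ContinuousAt.add (by fun_prop) (by fun_prop)
    exact hc.eventually_lt_const (lt_add_one _)
  have hsum : Summable fun ν : Fin n → ℤ => termConst n q (size a b t x + 1) *
      ∏ i, profile ρ σ (ν i) :=
    (summable_prod_fin (fun k => profile_nonneg ((growthZero_nonneg _ _ _).trans hρ.le)
      ((growthInfty_nonneg _ _ _ _ _).trans hσ.le) k) (summable_profile
        ((growthZero_nonneg _ _ _).trans hρ.le) hρ1 ((growthInfty_nonneg _ _ _ _ _).trans hσ.le)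
        hσ1)).mul_left _
  refine tendsto_tsum_of_dominated_convergence hsum
    (fun ν => continuousAt_term hq0 hq1 a (p := (b, t, x)) h.b_ne h.t_ne hx ν) ?_
  filter_upwards [e1, e2, e3, e4, e5] with p e1 e2 e3 e4 e5 ν
  exact norm_term_le_profile hq0 hq1 e3.a_ne e3.b_ne e3.t_ne e4 e5.le e1.le e2.le ν

theorem continuousAt_thetaVand {n : ℕ} {q : ℝ} (hq0 : 0 < q) (hq1 : q < 1) {x : Fin n → ℂ}
    (hx : ∀ i, x i ≠ 0) : ContinuousAt (thetaVand q) x := by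
  unfold thetaVand
  refine tendsto_finsetProd _ fun i _ => tendsto_finsetProd _ fun j _ => ?_
  have hc : ∀ k, ContinuousAt (fun x : Fin n → ℂ => x k) x := fun k => continuousAt_apply k x
  have hd : ContinuousAt (fun x : Fin n → ℂ => x j / x i) x := (hc j).div₀ (hc i) (hx i)
  exact (hc i).mul (ContinuousAt.comp (g := theta q)
    (differentiableAt_theta hq0 hq1 (div_ne_zero (hx j) (hx i))).continuousAt hd)

theorem Admissible.continuousAt_prodValue {n : ℕ} {q : ℝ} {a b : Fin 2 → ℂ} {t : ℂ}
    (h : Admissible n q a b t) (ht : ∀ m : ℕ, 0 < m → t ≠ (q : ℂ) ^ m) :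
    ContinuousAt (fun p : (Fin 2 → ℂ) × ℂ => prodValue q a p.1 p.2 n) (b, t) := by
  have hq0 := h.q_pos
  have hq1 := h.q_lt_one
  have hQ : ∀ {g : (Fin 2 → ℂ) × ℂ → ℂ}, ContinuousAt g (b, t) →
      ContinuousAt (fun p => qInf q (g p)) (b, t) := fun hg =>
    (continuous_qInf hq0 hq1).continuousAt.comp hg
  have hz : ∀ k : ℤ, ContinuousAt (fun p : (Fin 2 → ℂ) × ℂ => p.2 ^ k) (b, t) := fun k =>
    ContinuousAt.zpow₀ (by fun_prop) _ (Or.inl h.t_ne)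
  have hb : ∀ l, ContinuousAt (fun p : (Fin 2 → ℂ) × ℂ => (p.1 l)⁻¹) (b, t) := fun l =>
    ContinuousAt.inv₀ (by fun_prop) (h.b_ne l)
  have hti : ContinuousAt (fun p : (Fin 2 → ℂ) × ℂ => p.2⁻¹) (b, t) :=
    ContinuousAt.inv₀ (by fun_prop) h.t_ne
  unfold prodValue
  refine tendsto_finsetProd _ fun k hk => ContinuousAt.div₀ ?_ ?_ (mul_ne_zero ?_ ?_)
  · have := hz (-k)
    refine ContinuousAt.mul (ContinuousAt.mul (by fun_prop) (hQ (by fun_prop)))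
      (tendsto_finsetProd _ fun i _ => tendsto_finsetProd _ fun j _ => hQ ?_)
    have := hz (-((k : ℤ) - 1))
    have := hb j
    fun_prop
  · have := hz (-((n : ℤ) + k - 2))
    have := hb 0
    have := hb 1
    exact ContinuousAt.mul (hQ (by fun_prop)) (hQ (by fun_prop))
  · rw [Ne, qInf_eq_zero_iff hq0 hq1]
    rintro ⟨m, hm⟩
    refine ht (m + 1) (Nat.succ_pos m) ?_
    have := h.t_ne
    field_simp at hm
    rw [pow_succ]
    exact hm.symm
  · obtain ⟨k, rfl⟩ : ∃ j, k = j + 1 := ⟨k - 1, by have := (mem_Icc.1 hk).1; omega⟩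
    have hkn := (mem_Icc.1 hk).2
    have e : (q : ℂ) * (a 0)⁻¹ * (a 1)⁻¹ * (b 0)⁻¹ * (b 1)⁻¹ *
        t ^ (-((n : ℤ) + (k + 1 : ℕ) - 2)) = q / (a 0 * a 1 * b 0 * b 1 * t ^ (n - 1 + k)) := by
      rw [zpow_neg, show (n : ℤ) + (k + 1 : ℕ) - 2 = (n - 1 + k : ℕ) by omega, zpow_natCast,
        div_eq_mul_inv, mul_inv, mul_inv, mul_inv, mul_inv]
      ring
    change qInf q ((q : ℂ) * (a 0)⁻¹ * (a 1)⁻¹ * (b 0)⁻¹ * (b 1)⁻¹ *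
        t ^ (-((n : ℤ) + (k + 1 : ℕ) - 2))) ≠ 0
    rw [e]
    exact qInf_ne_zero_of_norm_lt_one hq0 hq1 (h.norm_lt_one hkn)

/-! ### Removal of the genericity assumption -/

theorem countable_norm_eq {c s : ℝ} (hc : c ≠ 0) (hs : s ≠ 0) (q : ℝ) :
    {r : ℝ | 0 < r ∧ ∃ (m : ℤ) (N : ℕ) (k : ℤ), N ≠ 0 ∧ c * s ^ m * r ^ N = q ^ k}.Countable := by
  have e : {r : ℝ | 0 < r ∧ ∃ (m : ℤ) (N : ℕ) (k : ℤ), N ≠ 0 ∧ c * s ^ m * r ^ N = q ^ k} =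
      ⋃ m : ℤ, ⋃ N : ℕ, ⋃ k : ℤ, {r | 0 < r ∧ N ≠ 0 ∧ c * s ^ m * r ^ N = q ^ k} := by
    ext r
    simp only [Set.mem_ofPred_eq, Set.mem_iUnion]
    constructor
    · rintro ⟨h0, m, N, k, hN, h⟩
      exact ⟨m, N, k, h0, hN, h⟩
    · rintro ⟨m, N, k, h0, hN, h⟩
      exact ⟨h0, m, N, k, hN, h⟩
  rw [e]
  refine Set.countable_iUnion fun m => Set.countable_iUnion fun N => Set.countable_iUnion fun k =>
    Set.Subsingleton.countable ?_
  rintro r ⟨hr, hN, h⟩ r' ⟨hr', _, h'⟩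
  exact (pow_left_inj₀ hr.le hr'.le hN).1
    (mul_left_cancel₀ (mul_ne_zero hc (zpow_ne_zero m hs)) (h.trans h'.symm))

/-- The value of the sum at the interlaced truncation points. The parameters are replaced by
`t r` and `b₂ / r^n` with a real `r` close to `1`; for all but countably many `r` these
are generic, and both sides are continuous at `r = 1`. -/
theorem Admissible.symSum_pairPoint {n : ℕ} {q : ℝ} {a b : Fin 2 → ℂ} {t : ℂ}
    (h : Admissible n q a b t) (ht : ∀ m : ℕ, 0 < m → t ≠ (q : ℂ) ^ m) {i : ℕ} (hi : i ≤ n)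
    (hV : thetaVand q (pairPoint n i (b 0)⁻¹ (b 1)⁻¹ t⁻¹) ≠ 0) :
    symSum q a b t (pairPoint n i (b 0)⁻¹ (b 1)⁻¹ t⁻¹) = prodValue q a b t n := by
  have hq0 := h.q_pos
  have hq1 := h.q_lt_one
  have hq : (q : ℂ) ≠ 0 := by exact_mod_cast hq0.ne'
  set B : ℝ → Fin 2 → ℂ := fun r => QSelberg.divSnd b ((r : ℂ) ^ n) with hB
  set T : ℝ → ℂ := fun r => t * r with hT
  set X : ℝ → Fin n → ℂ := fun r => pairPoint n i (B r 0)⁻¹ (B r 1)⁻¹ (T r)⁻¹ with hX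
  have hB1 : B 1 = b := by simp [hB, divSnd_by_one]
  have hT1 : T 1 = t := by simp [hT]
  have hX1 : X 1 = pairPoint n i (b 0)⁻¹ (b 1)⁻¹ t⁻¹ := by rw [hX]; simp only [hB1, hT1]
  have hx0 : ∀ k, pairPoint n i (b 0)⁻¹ (b 1)⁻¹ t⁻¹ k ≠ 0 :=
    pairPoint_ne_zero (inv_ne_zero (h.b_ne 0)) (inv_ne_zero (h.b_ne 1)) (inv_ne_zero h.t_ne)
  have cT : ContinuousAt T 1 := by
    have : Continuous T := by fun_prop
    exact this.continuousAt
  have cB : ContinuousAt B 1 := by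
    refine continuousAt_pi.2 fun l => ?_
    fin_cases l
    · exact continuousAt_const
    · exact ContinuousAt.div₀ continuousAt_const (by fun_prop) (by simp)
  have cX : ContinuousAt X 1 := by
    have hb : ∀ l, ContinuousAt (fun r => (B r l)⁻¹) 1 := fun l =>
      ContinuousAt.inv₀ (continuousAt_pi.1 cB l) (by rw [hB1]; exact h.b_ne l)
    have hti : ContinuousAt (fun r => (T r)⁻¹) 1 :=
      ContinuousAt.inv₀ cT (by rw [hT1]; exact h.t_ne)
    refine continuousAt_pi.2 fun k => ?_
    simp only [hX, pairPoint]
    split_ifs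
    · exact (hb 0).mul (hti.pow _)
    · exact (hb 1).mul (hti.pow _)
  have cA : ContinuousAt (fun r => altSum q a (B r) (T r) (X r)) 1 := by
    have h1 := h.continuousAt_altSum hx0
    rw [← hX1, ← hB1, ← hT1] at h1
    exact ContinuousAt.comp (f := fun r => (B r, T r, X r)) h1 (cB.prodMk (cT.prodMk cX))
  have cV : ContinuousAt (fun r => thetaVand q (X r)) 1 :=
    ContinuousAt.comp (g := thetaVand q) (continuousAt_thetaVand hq0 hq1 (by rwa [hX1])) cX
  have cS : ContinuousAt (fun r => symSum q a (B r) (T r) (X r)) 1 :=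
    cA.div₀ cV (by rwa [hX1])
  have cP : ContinuousAt (fun r => prodValue q a (B r) (T r) n) 1 := by
    have h1 := h.continuousAt_prodValue ht
    rw [← hB1, ← hT1] at h1
    exact ContinuousAt.comp (f := fun r => (B r, T r)) h1 (cB.prodMk cT)
  have hadm : ∀ᶠ r in 𝓝 (1 : ℝ), Admissible n q a (B r) (T r) := by
    have h1 := h.eventually
    rw [← hB1, ← hT1] at h1
    exact (cB.prodMk cT).eventually h1
  -- The exceptional values of `r`, at which some theta function could vanish.
  set E : Set ℝ := {r | 0 < r ∧ ∃ (m : ℤ) (N : ℕ) (k : ℤ), N ≠ 0 ∧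
      1 * ‖t‖ ^ m * r ^ N = q ^ k} ∪ {r | 0 < r ∧ ∃ (m : ℤ) (N : ℕ) (k : ℤ), N ≠ 0 ∧
      (‖b 0‖ / ‖b 1‖) * ‖t‖ ^ m * r ^ N = q ^ k} with hE
  have htn := norm_ne_zero_iff.2 h.t_ne
  have hEc : E.Countable := (countable_norm_eq one_ne_zero htn q).union
    (countable_norm_eq (div_ne_zero (norm_ne_zero_iff.2 (h.b_ne 0))
      (norm_ne_zero_iff.2 (h.b_ne 1))) htn q)
  have hne : (𝓝[Eᶜ] (1 : ℝ)).NeBot :=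
    mem_closure_iff_nhdsWithin_neBot.1 ((hEc.dense_compl ℝ) 1)
  have heq : (fun r => symSum q a (B r) (T r) (X r)) =ᶠ[𝓝[Eᶜ] 1]
      fun r => prodValue q a (B r) (T r) n := by
    filter_upwards [nhdsWithin_le_nhds hadm, nhdsWithin_le_nhds (lt_mem_nhds one_pos),
      self_mem_nhdsWithin] with r hr hr0 hrE
    have hr0' : (r : ℂ) ≠ 0 := by exact_mod_cast hr0.ne'
    have hnr : ‖(r : ℂ)‖ = r := by rw [Complex.norm_real, Real.norm_of_nonneg hr0.le]
    rw [hX, QSelberg.symSum_pairPoint q a (B r) (T r) _ _ _ hi]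
    refine hr.symList_pair_of_theta_ne_zero (fun m hm hz => hrE (Or.inl ⟨hr0, ?_⟩))
      (fun m hm hz => hrE (Or.inr ⟨hr0, ?_⟩)) hi
    · obtain ⟨k, hk⟩ := (theta_eq_zero_iff hq0 hq1 (pow_ne_zero m hr.t_ne)).1 hz
      refine ⟨m, m, k, by have := (mem_Icc.1 hm).1; omega, ?_⟩
      have := congrArg norm hk
      rw [norm_q_zpow hq0, hT, norm_pow, norm_mul, hnr, mul_pow] at this
      rw [one_mul, zpow_natCast, this]
    · obtain ⟨k, hk⟩ := (theta_eq_zero_iff hq0 hq1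
        (mul_ne_zero (div_ne_zero (hr.b_ne 0) (hr.b_ne 1)) (zpow_ne_zero m hr.t_ne))).1 hz
      rw [abs_lt] at hm
      obtain ⟨N, hN⟩ : ∃ N : ℕ, (n : ℤ) + m = N := ⟨((n : ℤ) + m).toNat, by omega⟩
      refine ⟨m, N, k, by omega, ?_⟩
      have e : B r 0 / B r 1 * T r ^ m = b 0 / b 1 * t ^ m * (r : ℂ) ^ N := by
        rw [← zpow_natCast, ← hN, zpow_add₀ hr0', zpow_natCast]
        simp only [hB, hT, divSnd_zero, divSnd_one, mul_zpow]
        have := h.b_ne 1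
        field_simp
      have := congrArg norm (e.symm.trans hk)
      rw [norm_q_zpow hq0, norm_mul, norm_mul, norm_pow, hnr, norm_div, norm_zpow] at this
      exact this
  have hl := (cS.mono_left (nhdsWithin_le_nhds (s := Eᶜ))).congr' heq
  have := tendsto_nhds_unique hl (cP.mono_left nhdsWithin_le_nhds)
  simpa only [hX1, hB1, hT1] using this

/-! ### The Jackson integrals in terms of the regularised sum -/

theorem mul_zpow_cpow {q : ℝ} (hq0 : 0 < q) {x : ℂ} (hx : x ≠ 0) (k : ℤ) (s : ℂ) :
    (x * (q : ℂ) ^ k) ^ s = x ^ s * ((q : ℂ) ^ s) ^ k := by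
  have hq : (q : ℂ) ≠ 0 := by exact_mod_cast hq0.ne'
  have hl : Complex.log (x * (q : ℂ) ^ k) = k * Complex.log q + Complex.log x := by
    have := Complex.log_mul_ofReal (q ^ k) (zpow_pos hq0 k) x hx
    rw [Real.log_zpow] at this
    push_cast at this
    rw [this, Complex.ofReal_log hq0.le]
  rw [Complex.cpow_def_of_ne_zero (mul_ne_zero hx (zpow_ne_zero k hq)),
    Complex.cpow_def_of_ne_zero hx, Complex.cpow_def_of_ne_zero hq, hl, ← Complex.exp_int_mul,
    ← Complex.exp_add]
  congr 1
  ring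

/-- On a lattice `u q^k` avoiding the zeros of theta, the poles of `1/(u q^k)_∞` are traded for zeros
of `(q/(u q^k))_∞`. -/
theorem inv_qInf_mul_zpow {q : ℝ} (hq0 : 0 < q) (hq1 : q < 1) {u : ℂ} (hu : u ≠ 0)
    (h : theta q u ≠ 0) (k : ℤ) :
    (qInf q (u * (q : ℂ) ^ k))⁻¹ =
      thetaMult q u k * qInf q (q / (u * (q : ℂ) ^ k)) * (theta q u)⁻¹ := by
  have e := theta_mul_thetaMult hq0 hq1 hu k
  have h0 := h
  rw [← e, theta] at h
  have h1 := left_ne_zero_of_mul (left_ne_zero_of_mul h)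
  rw [theta] at e
  rw [inv_eq_iff_eq_inv, mul_inv, inv_inv, ← e]
  have h2 := right_ne_zero_of_mul (left_ne_zero_of_mul h)
  have h3 := right_ne_zero_of_mul h
  field_simp

theorem pair_summand_eq {q : ℝ} (hq0 : 0 < q) (hq1 : q < 1) (τ : ℂ) {x y : ℂ} (hx : x ≠ 0)
    (hy : y ≠ 0) (h1 : theta q (y / x) ≠ 0) (h2 : theta q ((q : ℂ) ^ τ * (y / x)) ≠ 0) (k l : ℤ) :
    (x * (q : ℂ) ^ k) ^ (2 * τ - 1) *
        (qInf q (q * ((q : ℂ) ^ τ)⁻¹ * (y * (q : ℂ) ^ l / (x * (q : ℂ) ^ k))) /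
          qInf q ((q : ℂ) ^ τ * (y * (q : ℂ) ^ l / (x * (q : ℂ) ^ k)))) *
        (x * (q : ℂ) ^ k - y * (q : ℂ) ^ l) =
      x ^ (2 * τ) * (theta q (y / x) / theta q ((q : ℂ) ^ τ * (y / x))) *
        (((q : ℂ) ^ τ) ^ k * ((q : ℂ) ^ τ) ^ l) *
        (twoBody q ((q : ℂ) ^ τ) x k y l / (x * theta q (y / x))) := by
  have hq : (q : ℂ) ≠ 0 := by exact_mod_cast hq0.ne'
  have ht : (q : ℂ) ^ τ ≠ 0 := by simp [Complex.cpow_eq_zero_iff, hq]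
  have hz : x * (q : ℂ) ^ k ≠ 0 := mul_ne_zero hx (zpow_ne_zero k hq)
  have hu : y / x ≠ 0 := div_ne_zero hy hx
  have e1 : y * (q : ℂ) ^ l / (x * (q : ℂ) ^ k) = y / x * (q : ℂ) ^ (l - k) := by
    rw [zpow_sub₀ hq]; field_simp
  have e2 : (x * (q : ℂ) ^ k) ^ (2 * τ - 1) * (x * (q : ℂ) ^ k) =
      x ^ (2 * τ) * (((q : ℂ) ^ τ) ^ k * ((q : ℂ) ^ τ) ^ k) := by
    rw [Complex.cpow_sub _ _ hz, Complex.cpow_one, div_mul_cancel₀ _ hz, mul_zpow_cpow hq0 hx,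
      two_mul τ, Complex.cpow_add _ _ hq, mul_zpow]
  have e3 : x * (q : ℂ) ^ k - y * (q : ℂ) ^ l =
      x * (q : ℂ) ^ k * (1 - y / x * (q : ℂ) ^ (l - k)) := by
    rw [← e1, mul_sub, mul_one, mul_div_cancel₀ _ hz]
  have e4 := inv_qInf_mul_zpow hq0 hq1 (mul_ne_zero ht hu) h2 (l - k)
  rw [thetaMult_mul, mul_assoc _ (y / x)] at e4
  have e5 : ((q : ℂ) ^ τ) ^ l = ((q : ℂ) ^ τ) ^ (l - k) * ((q : ℂ) ^ τ) ^ k := by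
    rw [← zpow_add₀ ht, sub_add_cancel]
  rw [e1, e3, div_eq_mul_inv, e4, twoBody, e5]
  clear e4
  generalize qInf q _ = A at *
  generalize qInf q _ = B at *
  generalize theta q ((q : ℂ) ^ τ * (y / x)) = C at *
  generalize theta q (y / x) = D at *
  generalize thetaMult q (y / x) (l - k) = F at *
  generalize ((q : ℂ) ^ τ) ^ (l - k) = S at *
  generalize y / x * (q : ℂ) ^ (l - k) = V at *
  have e6 : D / C * (x * (1 - V) * F * (A * B) / (x * D)) = (1 - V) * F * (A * B) * C⁻¹ := by
    field_simp
  linear_combination (A * (S * F * B * C⁻¹) * (1 - V)) * e2 -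
    x ^ (2 * τ) * (S * ((q : ℂ) ^ τ) ^ k * ((q : ℂ) ^ τ) ^ k) * e6

/-- The summand of a Jackson integral of Selberg type is the quasi-constant prefactor times the
regularised summand. The one-variable power is left open as a function `g` with `g(xq) = G g(x)`. -/
theorem summand_eq {n : ℕ} {q : ℝ} (hq0 : 0 < q) (hq1 : q < 1) (a : Fin 2 → ℂ) {b : Fin 2 → ℂ}
    (hb : ∀ l, b l ≠ 0) (τ : ℂ) {g : ℂ → ℂ} {G : ℂ}
    (hg : ∀ x ≠ 0, ∀ k : ℤ, g (x * (q : ℂ) ^ k) = g x * G ^ k) {x : Fin n → ℂ}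
    (hx : ∀ i, x i ≠ 0) (h1 : ∀ i l, theta q (b l * x i) ≠ 0)
    (h2 : ∀ i j, i < j →
      theta q (x j / x i) ≠ 0 ∧ theta q ((q : ℂ) ^ τ * (x j / x i)) ≠ 0) (ν : Fin n → ℤ) :
    (∏ i, g (qShift q x ν i) * ∏ l, qInf q (q * (a l)⁻¹ * qShift q x ν i) /
        qInf q (b l * qShift q x ν i)) *
      (∏ i, ∏ j ∈ Ioi i, qShift q x ν i ^ (2 * τ - 1) *
        (qInf q (q * ((q : ℂ) ^ τ)⁻¹ * (qShift q x ν j / qShift q x ν i)) /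
          qInf q ((q : ℂ) ^ τ * (qShift q x ν j / qShift q x ν i)))) *
      Delta (qShift q x ν) =
    ((∏ i, g (x i) / ∏ l, theta q (b l * x i)) * ∏ i, ∏ j ∈ Ioi i, x i ^ (2 * τ) *
      (theta q (x j / x i) / theta q ((q : ℂ) ^ τ * (x j / x i)))) *
      ((∏ i, oneBody q a b (G * ((q : ℂ) ^ τ) ^ (n - 1)) (x i) (ν i)) *
        (∏ i, ∏ j ∈ Ioi i, twoBody q ((q : ℂ) ^ τ) (x i) (ν i) (x j) (ν j)) / thetaVand q x) := by
  have hq : (q : ℂ) ≠ 0 := by exact_mod_cast hq0.ne'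
  set t := (q : ℂ) ^ τ with ht
  have pair : (∏ i, ∏ j ∈ Ioi i, qShift q x ν i ^ (2 * τ - 1) *
        (qInf q (q * t⁻¹ * (qShift q x ν j / qShift q x ν i)) /
          qInf q (t * (qShift q x ν j / qShift q x ν i)))) * Delta (qShift q x ν) =
      (∏ i, ∏ j ∈ Ioi i, x i ^ (2 * τ) * (theta q (x j / x i) / theta q (t * (x j / x i)))) *
        (∏ i, (t ^ ν i) ^ (n - 1)) *
        ((∏ i, ∏ j ∈ Ioi i, twoBody q t (x i) (ν i) (x j) (ν j)) / thetaVand q x) := by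
    rw [Delta, thetaVand, ← prod_pairs, ← prod_mul_distrib, ← prod_mul_distrib, ← prod_div_distrib,
      ← prod_mul_distrib]
    refine prod_congr rfl fun i _ => ?_
    rw [← prod_mul_distrib, ← prod_mul_distrib, ← prod_div_distrib, ← prod_mul_distrib]
    refine prod_congr rfl fun j hj => ?_
    obtain ⟨hh1, hh2⟩ := h2 i j (mem_Ioi.1 hj)
    exact pair_summand_eq hq0 hq1 τ (hx i) (hx j) hh1 hh2 (ν i) (ν j)
  have single : ∀ i, g (qShift q x ν i) * ∏ l, qInf q (q * (a l)⁻¹ * qShift q x ν i) /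
        qInf q (b l * qShift q x ν i) * 1 = g (x i) / (∏ l, theta q (b l * x i)) *
        (G ^ ν i * ∏ l, (qInf q (q * (a l)⁻¹ * (x i * (q : ℂ) ^ ν i)) *
          (thetaMult q (b l * x i) (ν i) * qInf q (q / (b l * (x i * (q : ℂ) ^ ν i)))))) := by
    intro i
    have key : ∀ l, qInf q (q * (a l)⁻¹ * (x i * (q : ℂ) ^ ν i)) /
        qInf q (b l * (x i * (q : ℂ) ^ ν i)) * 1 =
        qInf q (q * (a l)⁻¹ * (x i * (q : ℂ) ^ ν i)) * (thetaMult q (b l * x i) (ν i) *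
          qInf q (q / (b l * (x i * (q : ℂ) ^ ν i)))) * (theta q (b l * x i))⁻¹ := fun l => by
      have := inv_qInf_mul_zpow hq0 hq1 (mul_ne_zero (hb l) (hx i)) (h1 i l) (ν i)
      rw [mul_assoc (b l)] at this
      rw [div_eq_mul_inv, this]
      ring
    rw [qShift, hg _ (hx i), prod_congr rfl fun l _ => key l, prod_mul_distrib, prod_inv_distrib]
    ring
  simp only [mul_one] at single
  rw [mul_assoc, pair, prod_congr rfl fun i _ => single i, prod_mul_distrib]
  have e : (∏ i, oneBody q a b (G * t ^ (n - 1)) (x i) (ν i)) =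
      (∏ i, (G ^ ν i * ∏ l, (qInf q (q * (a l)⁻¹ * (x i * (q : ℂ) ^ ν i)) *
          (thetaMult q (b l * x i) (ν i) * qInf q (q / (b l * (x i * (q : ℂ) ^ ν i))))))) *
        ∏ i, (t ^ ν i) ^ (n - 1) := by
    rw [← prod_mul_distrib]
    refine prod_congr rfl fun i _ => ?_
    rw [oneBody, mul_zpow, ← zpow_natCast (t ^ ν i), ← zpow_mul, mul_comm (ν i), zpow_mul,
      zpow_natCast]
    ring
  rw [e]
  ring

theorem oneBody_inv {q : ℝ} (hq0 : 0 < q) {a b : Fin 2 → ℂ}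
    (hb : ∀ l, b l ≠ 0) {c c' x : ℂ} (hx : x ≠ 0)
    (hc : c * (a 0 * a 1 * b 0 * b 1) * c' = q ^ 2) (k : ℤ) :
    oneBody q b a c x k = oneBody q a b c' x⁻¹ (-k) := by
  have hq : (q : ℂ) ≠ 0 := by exact_mod_cast hq0.ne'
  have hc' : c' ≠ 0 := right_ne_zero_of_mul (hc ▸ pow_ne_zero 2 hq)
  have hm : ∀ l, thetaMult q (a l * x) k =
      (a l * b l / q) ^ k * thetaMult q (b l * x⁻¹) (-k) := by
    intro l
    have e : (-k) * (-k - 1) / 2 = k * (k - 1) / 2 + k := by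
      rw [← tri_succ]; congr 1; ring
    have e1 : -(b l * x⁻¹) = (-(x / b l))⁻¹ := by
      rw [← neg_inv, inv_div, div_eq_mul_inv]
    rw [thetaMult, thetaMult, e, zpow_add₀ hq, e1, inv_zpow', neg_neg]
    have e2 : -(a l * x) = a l * b l / q * -(x / b l) * q := by
      have := hb l
      field_simp
    rw [e2, mul_zpow, mul_zpow]
    ring
  have hz : x⁻¹ * (q : ℂ) ^ (-k) = (x * (q : ℂ) ^ k)⁻¹ := by rw [zpow_neg, mul_inv]
  rw [oneBody, oneBody, hz]
  simp only [Fin.prod_univ_two, hm]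
  have e1 : ∀ u z : ℂ, (q : ℂ) * u⁻¹ * z⁻¹ = q / (u * z) := fun u z => by
    rw [div_eq_mul_inv, mul_inv, mul_assoc]
  have e2 : ∀ u z : ℂ, (q : ℂ) / (u * z⁻¹) = q * u⁻¹ * z := fun u z => by
    rw [div_eq_mul_inv, mul_inv, inv_inv, mul_assoc]
  rw [e1, e1, e2, e2]
  have e3 : c ^ k * ((a 0 * b 0 / q) ^ k * (a 1 * b 1 / q) ^ k) = c' ^ (-k) := by
    rw [← mul_zpow, ← mul_zpow, ← inv_zpow']
    congr 1
    field_simp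
    linear_combination hc
  rw [← e3]
  ring

theorem twoBody_inv {q : ℝ} (hq0 : 0 < q) (hq1 : q < 1) (t : ℂ) {x y : ℂ} (hx : x ≠ 0) (hy : y ≠ 0)
    (k l : ℤ) :
    twoBody q t x k y l / (x * theta q (y / x)) =
      twoBody q t x⁻¹ (-k) y⁻¹ (-l) / (x⁻¹ * theta q (y⁻¹ / x⁻¹)) := by
  have e1 : y⁻¹ / x⁻¹ = x / y := by field_simp
  have e2 : x * theta q (y / x) = -(y * theta q (x / y)) := by
    rw [← inv_div x y, theta_inv hq0 hq1 (div_ne_zero hx hy)]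
    field_simp
  have e3 : -l - -k = k - l := by ring
  rw [twoBody_antisymm hq0 hx hy, e2, neg_div_neg_eq, twoBody, twoBody, e1, e3]
  have hx' := inv_ne_zero hx
  simp only [mul_assoc]
  rw [mul_div_mul_left _ _ hy, mul_div_mul_left _ _ hx']

/-- The dual summand is the summand at the inverse point. -/
theorem term_inv {n : ℕ} {q : ℝ} (hq0 : 0 < q) (hq1 : q < 1) {a b : Fin 2 → ℂ}
    (hb : ∀ l, b l ≠ 0) (t : ℂ) {c : ℂ} {x : Fin n → ℂ} (hx : ∀ i, x i ≠ 0)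
    (hc : 0 < n → c * (a 0 * a 1 * b 0 * b 1) * (q * t ^ (n - 1)) = q ^ 2) (ν : Fin n → ℤ) :
    (∏ i, oneBody q b a c (x i) (ν i)) *
        (∏ i, ∏ j ∈ Ioi i, twoBody q t (x i) (ν i) (x j) (ν j)) / thetaVand q x =
      term q a b t (fun i => (x i)⁻¹) (-ν) / thetaVand q fun i => (x i)⁻¹ := by
  rw [term, mul_div_assoc, mul_div_assoc, thetaVand, thetaVand, ← prod_div_distrib,
    ← prod_div_distrib]
  congr 1
  · exact prod_congr rfl fun i _ => oneBody_inv hq0 hb (hx i) (hc i.pos) _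
  · refine prod_congr rfl fun i _ => ?_
    rw [← prod_div_distrib, ← prod_div_distrib]
    exact prod_congr rfl fun j _ => twoBody_inv hq0 hq1 t (hx i) (hx j) _ _

theorem thetaVand_inv_ne_zero {n : ℕ} {q : ℝ} (hq0 : 0 < q) (hq1 : q < 1) {x : Fin n → ℂ}
    (hx : ∀ i, x i ≠ 0) (h : ∀ i j, i < j → theta q (x j / x i) ≠ 0) :
    thetaVand q (fun i => (x i)⁻¹) ≠ 0 := by
  refine prod_ne_zero_iff.2 fun i _ => prod_ne_zero_iff.2 fun j hj =>
    mul_ne_zero (inv_ne_zero (hx i)) ?_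
  rw [show (x j)⁻¹ / (x i)⁻¹ = (x j / x i)⁻¹ by rw [inv_div_inv, inv_div], Ne,
    theta_inv_eq_zero_iff hq0 hq1 (div_ne_zero (hx j) (hx i))]
  exact h i j (mem_Ioi.1 hj)

namespace Params

variable {P : Params} {n : ℕ}

theorem a_ne_zero (hq0 : 0 < P.q) (l : Fin 2) : P.a l ≠ 0 := by
  have hq : (P.q : ℂ) ≠ 0 := by exact_mod_cast hq0.ne'
  simp [a, Complex.cpow_eq_zero_iff, hq]

theorem b_ne_zero (hq0 : 0 < P.q) (l : Fin 2) : P.b l ≠ 0 := by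
  have hq : (P.q : ℂ) ≠ 0 := by exact_mod_cast hq0.ne'
  simp [b, Complex.cpow_eq_zero_iff, hq]

theorem t_ne_zero (hq0 : 0 < P.q) : P.t ≠ 0 := by
  have hq : (P.q : ℂ) ≠ 0 := by exact_mod_cast hq0.ne'
  simp [t, Complex.cpow_eq_zero_iff, hq]

theorem zeta_eq_pairPoint (n i : ℕ) (x₁ x₂ : ℂ) : P.zeta n i x₁ x₂ = pairPoint n i x₁ x₂ P.t := rfl

/-- The extreme cases `i = 1` and `i = n` of the convergence hypotheses suffice, since the
intermediate bounds lie between them. -/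
theorem admissible (hq0 : 0 < P.q) (hq1 : P.q < 1) (hn : 0 < n)
    (hconv₀ : ∀ i ∈ Icc 1 n, ‖(P.q : ℂ) * P.t ^ (2 * (i : ℤ) - 2)‖ < 1)
    (hconv₁ : ∀ i ∈ Icc 1 n,
      P.q < ‖P.a 0 * P.a 1 * P.b 0 * P.b 1 * P.t ^ (2 * (i : ℤ) - 2)‖) :
    Admissible n P.q P.a P.b P.t := by
  have hA := norm_ne_zero_iff.2 (P.a_ne_zero hq0 0)
  have hA' := norm_ne_zero_iff.2 (P.a_ne_zero hq0 1)
  have hB := norm_ne_zero_iff.2 (P.b_ne_zero hq0 0)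
  have hB' := norm_ne_zero_iff.2 (P.b_ne_zero hq0 1)
  have ht0 := norm_pos_iff.2 (P.t_ne_zero hq0)
  obtain ⟨m, rfl⟩ : ∃ m, n = m + 1 := ⟨n - 1, by omega⟩
  have ez : (2 * ((m + 1 : ℕ) : ℤ) - 2) = ((m + m : ℕ) : ℤ) := by push_cast; ring
  have e1 : (2 * ((1 : ℕ) : ℤ) - 2) = 0 := by norm_num
  have z1 := hconv₀ (m + 1) (mem_Icc.2 ⟨by omega, le_rfl⟩)
  have i0 := hconv₁ 1 (mem_Icc.2 ⟨le_rfl, by omega⟩)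
  have i1 := hconv₁ (m + 1) (mem_Icc.2 ⟨by omega, le_rfl⟩)
  rw [ez, zpow_natCast, norm_mul, Complex.norm_real, Real.norm_of_nonneg hq0.le, norm_pow,
    pow_add] at z1
  rw [ez, zpow_natCast] at i1
  rw [e1, zpow_zero, mul_one] at i0
  simp only [norm_mul, norm_pow, pow_add] at i0 i1
  have hAB : 0 < ‖P.a 0‖ * ‖P.a 1‖ * ‖P.b 0‖ * ‖P.b 1‖ := by positivity
  set A := ‖P.a 0‖ * ‖P.a 1‖ * ‖P.b 0‖ * ‖P.b 1‖ with hAdef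
  set r := ‖P.t‖ with hr
  refine ⟨hq0, hq1, P.a_ne_zero hq0, P.b_ne_zero hq0, P.t_ne_zero hq0, ?_, ?_⟩
  · rw [growthZero, norm_mul, norm_pow, Complex.norm_real, Real.norm_of_nonneg hq0.le, norm_inv,
      ← hr, Nat.add_sub_cancel]
    rcases le_or_gt r 1 with h | h
    · rw [max_eq_right ((one_le_inv₀ ht0).2 h), inv_pow, mul_assoc,
        mul_inv_cancel₀ (pow_ne_zero m ht0.ne'), mul_one]
      exact hq1
    · rw [max_eq_left (inv_le_one_of_one_le₀ h.le), one_pow, mul_one]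
      refine lt_of_le_of_lt ?_ z1
      gcongr
      exact le_mul_of_one_le_left (by positivity) (one_le_pow₀ h.le)
  · rw [growthInfty, norm_mul, norm_pow, Complex.norm_real, Real.norm_of_nonneg hq0.le, norm_inv,
      ← hr, Nat.add_sub_cancel, ← hAdef]
    have hrm : 0 < r ^ m := pow_pos ht0 m
    rcases le_or_gt r 1 with h | h
    · rw [max_eq_right ((one_le_inv₀ ht0).2 h), inv_pow]
      have e : (P.q * r ^ m)⁻¹ * (P.q ^ 2 / A) * (r ^ m)⁻¹ = P.q / (A * (r ^ m * r ^ m)) := by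
        field_simp
      rw [e, div_lt_one (by positivity)]
      exact i1
    · rw [max_eq_left (inv_le_one_of_one_le₀ h.le), one_pow, mul_one]
      have e : (P.q * r ^ m)⁻¹ * (P.q ^ 2 / A) = P.q / (A * r ^ m) := by
        field_simp
      rw [e, div_lt_one (by positivity)]
      exact i0.trans_le (le_mul_of_one_le_right hAB.le (one_le_pow₀ h.le))

theorem Phi_mul_Delta (hq0 : 0 < P.q) (hq1 : P.q < 1) {x : Fin n → ℂ} (hx : ∀ i, x i ≠ 0)
    (h1 : ∀ i l, theta P.q (P.b l * x i) ≠ 0)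
    (h2 : ∀ i j, i < j → theta P.q (x j / x i) ≠ 0 ∧ theta P.q (P.t * (x j / x i)) ≠ 0)
    (ν : Fin n → ℤ) :
    P.Phi (qShift P.q x ν) * Delta (qShift P.q x ν) =
      P.h x * (term P.q P.a P.b P.t x ν / thetaVand P.q x) :=
  summand_eq hq0 hq1 P.a (P.b_ne_zero hq0) P.τ (g := id) (G := P.q) (fun _ _ _ => rfl) hx h1 h2 ν

theorem cpow_barExponent (hq0 : 0 < P.q) (hn : 0 < n) :
    (P.q : ℂ) ^ P.barExponent n * P.t ^ (n - 1) * (P.a 0 * P.a 1 * P.b 0 * P.b 1) *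
      (P.q * P.t ^ (n - 1)) = (P.q : ℂ) ^ 2 := by
  have hq : (P.q : ℂ) ≠ 0 := by exact_mod_cast hq0.ne'
  have e : (P.q : ℂ) ^ P.barExponent n * (P.t ^ (n - 1) * P.t ^ (n - 1)) *
      (P.a 0 * P.a 1 * P.b 0 * P.b 1) = P.q := by
    rw [t, a, a, b, b, ← Complex.cpow_nat_mul, ← Complex.cpow_add _ _ hq, ← Complex.cpow_add _ _ hq,
      ← Complex.cpow_add _ _ hq, ← Complex.cpow_add _ _ hq, ← Complex.cpow_add _ _ hq,
      ← Complex.cpow_add _ _ hq, barExponent, Nat.cast_sub hn]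
    conv_rhs => rw [← Complex.cpow_one (P.q : ℂ)]
    congr 1
    push_cast
    ring
  linear_combination (P.q : ℂ) * e

theorem barPhi_mul_Delta (hq0 : 0 < P.q) (hq1 : P.q < 1) {x : Fin n → ℂ} (hx : ∀ i, x i ≠ 0)
    (h : P.BarRegular x) (ν : Fin n → ℤ) :
    P.barPhi (qShift P.q x ν) * Delta (qShift P.q x ν) =
      P.barh x * (term P.q P.a P.b P.t (fun i => (x i)⁻¹) (-ν) /
        thetaVand P.q fun i => (x i)⁻¹) := by
  rw [← term_inv hq0 hq1 (P.b_ne_zero hq0) P.t hx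
    (c := (P.q : ℂ) ^ P.barExponent n * P.t ^ (n - 1)) (fun hn => P.cpow_barExponent hq0 hn)]
  exact summand_eq hq0 hq1 P.b (P.a_ne_zero hq0) P.τ (g := fun z => z ^ P.barExponent n)
    (fun x hx k => mul_zpow_cpow hq0 hx k _) hx h.1 h.2 ν

theorem h_ne_zero {x : Fin n → ℂ} (hx : ∀ i, x i ≠ 0)
    (h1 : ∀ i l, theta P.q (P.b l * x i) ≠ 0)
    (h2 : ∀ i j, i < j → theta P.q (x j / x i) ≠ 0 ∧ theta P.q (P.t * (x j / x i)) ≠ 0) :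
    P.h x ≠ 0 :=
  mul_ne_zero (prod_ne_zero_iff.2 fun i _ => div_ne_zero (hx i)
      (prod_ne_zero_iff.2 fun l _ => h1 i l))
    (prod_ne_zero_iff.2 fun i _ => prod_ne_zero_iff.2 fun j hj =>
      mul_ne_zero (by simp [Complex.cpow_eq_zero_iff, hx i])
        (div_ne_zero (h2 i j (mem_Ioi.1 hj)).1 (h2 i j (mem_Ioi.1 hj)).2))

theorem barh_ne_zero {x : Fin n → ℂ} (hx : ∀ i, x i ≠ 0) (h : P.BarRegular x) : P.barh x ≠ 0 :=
  mul_ne_zero (prod_ne_zero_iff.2 fun i _ => div_ne_zero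
      (by simp [Complex.cpow_eq_zero_iff, hx i]) (prod_ne_zero_iff.2 fun l _ => h.1 i l))
    (prod_ne_zero_iff.2 fun i _ => prod_ne_zero_iff.2 fun j hj =>
      mul_ne_zero (by simp [Complex.cpow_eq_zero_iff, hx i])
        (div_ne_zero (h.2 i j (mem_Ioi.1 hj)).1 (h.2 i j (mem_Ioi.1 hj)).2))

theorem calJ_eq_symSum (hq0 : 0 < P.q) (hq1 : P.q < 1) {x : Fin n → ℂ} (hx : ∀ i, x i ≠ 0)
    (h1 : ∀ i l, theta P.q (P.b l * x i) ≠ 0)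
    (h2 : ∀ i j, i < j → theta P.q (x j / x i) ≠ 0 ∧ theta P.q (P.t * (x j / x i)) ≠ 0) :
    P.calJ x = (1 - (P.q : ℂ)) ^ n * symSum P.q P.a P.b P.t x := by
  rw [calJ, J, jackson, tsum_congr fun ν => P.Phi_mul_Delta hq0 hq1 hx h1 h2 ν, tsum_mul_left,
    tsum_div_const, mul_left_comm, mul_div_cancel_left₀ _ (P.h_ne_zero hx h1 h2), symSum, altSum]

theorem barCalJ_eq_symSum (hq0 : 0 < P.q) (hq1 : P.q < 1) {x : Fin n → ℂ} (hx : ∀ i, x i ≠ 0)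
    (h : P.BarRegular x) :
    P.barCalJ x = (1 - (P.q : ℂ)) ^ n * symSum P.q P.a P.b P.t fun i => (x i)⁻¹ := by
  rw [barCalJ, barJ, jackson, tsum_congr fun ν => P.barPhi_mul_Delta hq0 hq1 hx h ν, tsum_mul_left,
    tsum_div_const, mul_left_comm, mul_div_cancel_left₀ _ (P.barh_ne_zero hx h), symSum, altSum]
  congr 2
  exact (Equiv.neg (Fin n → ℤ)).tsum_eq fun ν => term P.q P.a P.b P.t (fun i => (x i)⁻¹) ν

/-- The genericity conditions of the connection formula keep the points `ζ_i(x₁,x₂)` away from the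
poles of the summand. -/
theorem theta_zeta_ne_zero (hq0 : 0 < P.q) {x₁ x₂ : ℂ}
    (hx₁ : x₁ ≠ 0) (hx₂ : x₂ ≠ 0) (h1 : ∀ m ∈ Icc 1 n, theta P.q (P.t ^ m) ≠ 0)
    (h2 : ∀ m : ℤ, |m| < (n : ℤ) → theta P.q (x₂ * x₁⁻¹ * P.t ^ m) ≠ 0)
    (h3 : ∀ l : Fin 2, ∀ m < n, theta P.q (x₁ * P.b l * P.t ^ m) ≠ 0 ∧
      theta P.q (x₂ * P.b l * P.t ^ m) ≠ 0) (i : ℕ) :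
    (∀ k l, theta P.q (P.b l * P.zeta n i x₁ x₂ k) ≠ 0) ∧
      ∀ j k, j < k → theta P.q (P.zeta n i x₁ x₂ k / P.zeta n i x₁ x₂ j) ≠ 0 ∧
        theta P.q (P.t * (P.zeta n i x₁ x₂ k / P.zeta n i x₁ x₂ j)) ≠ 0 := by
  have ht := P.t_ne_zero hq0
  have block : ∀ x : ℂ, x ≠ 0 → ∀ c d, c < d → d < n →
      theta P.q (x * P.t ^ d / (x * P.t ^ c)) ≠ 0 ∧
        theta P.q (P.t * (x * P.t ^ d / (x * P.t ^ c))) ≠ 0 := by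
    intro x hx c d hcd hdn
    have e : x * P.t ^ d / (x * P.t ^ c) = P.t ^ (d - c) := by
      rw [mul_div_mul_left _ _ hx, pow_sub₀ _ ht hcd.le, div_eq_mul_inv]
    rw [e, ← pow_succ']
    exact ⟨h1 _ (mem_Icc.2 ⟨by omega, by omega⟩), h1 _ (mem_Icc.2 ⟨by omega, by omega⟩)⟩
  constructor
  · intro k l
    have hk := k.2
    rw [zeta]
    split_ifs with h
    · rw [← mul_assoc, mul_comm (P.b l)]
      exact (h3 l _ hk).1
    · rw [← mul_assoc, mul_comm (P.b l)]
      exact (h3 l _ (by omega)).2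
  · intro j k hjk
    have hk := k.2
    have hjk' : (j : ℕ) < k := hjk
    rw [zeta, zeta]
    split_ifs with h h' h'
    · exact block _ hx₁ _ _ hjk' hk
    · omega
    · have e : x₂ * P.t ^ ((k : ℕ) - i) / (x₁ * P.t ^ (j : ℕ)) =
          x₂ * x₁⁻¹ * P.t ^ ((k : ℤ) - i - j) := by
        rw [zpow_sub₀ ht, show (k : ℤ) - i = ((k - i : ℕ) : ℤ) by omega, zpow_natCast, zpow_natCast]
        field_simp
      have e' : P.t * (x₂ * x₁⁻¹ * P.t ^ ((k : ℤ) - i - j)) =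
          x₂ * x₁⁻¹ * P.t ^ ((k : ℤ) - i - j + 1) := by
        rw [zpow_add₀ ht, zpow_one]; ring
      rw [e, e']
      exact ⟨h2 _ (by rw [abs_lt]; constructor <;> omega),
        h2 _ (by rw [abs_lt]; constructor <;> omega)⟩
    · exact block _ hx₂ _ _ (by omega) (by omega)

theorem barCalJ_zeta (hq0 : 0 < P.q) (hq1 : P.q < 1)
    (hconv₀ : ∀ i ∈ Icc 1 n, ‖(P.q : ℂ) * P.t ^ (2 * (i : ℤ) - 2)‖ < 1)
    (hconv₁ : ∀ i ∈ Icc 1 n,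
      P.q < ‖P.a 0 * P.a 1 * P.b 0 * P.b 1 * P.t ^ (2 * (i : ℤ) - 2)‖)
    (ht : ∀ m : ℕ, 0 < m → P.t ≠ (P.q : ℂ) ^ m) {i : ℕ} (hi : i ≤ n)
    (h : P.BarRegular (P.zeta n i (P.b 0) (P.b 1))) :
    JacksonConverges P.q (fun z => P.barPhi z * Delta z) (P.zeta n i (P.b 0) (P.b 1)) ∧
      P.barCalJ (P.zeta n i (P.b 0) (P.b 1)) = P.productValue n := by
  have hx : ∀ k, P.zeta n i (P.b 0) (P.b 1) k ≠ 0 :=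
    pairPoint_ne_zero (P.b_ne_zero hq0 0) (P.b_ne_zero hq0 1) (P.t_ne_zero hq0)
  rw [P.barCalJ_eq_symSum hq0 hq1 hx h]
  rcases Nat.eq_zero_or_pos n with rfl | hn
  · refine ⟨Summable.of_finite, ?_⟩
    simp [symSum, altSum, term, thetaVand, productValue]
  · have hadm := P.admissible hq0 hq1 hn hconv₀ hconv₁
    constructor
    · refine Summable.congr ?_ fun ν => (P.barPhi_mul_Delta hq0 hq1 hx h ν).symm
      have h1 := (hadm.summable_norm (x := fun i_1 => (P.zeta n i (P.b 0) (P.b 1) i_1)⁻¹)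
        fun k => inv_ne_zero (hx k)).of_norm
      exact (((Equiv.neg (Fin n → ℤ)).summable_iff.2 h1).div_const _).mul_left _
    · have e : (fun k => (P.zeta n i (P.b 0) (P.b 1) k)⁻¹) =
          pairPoint n i (P.b 0)⁻¹ (P.b 1)⁻¹ P.t⁻¹ :=
        funext fun k => (pairPoint_inv n i _ _ _ k).symm
      have hV := thetaVand_inv_ne_zero hq0 hq1 hx fun j k hjk => (h.2 j k hjk).1
      rw [e] at hV
      rw [e, hadm.symSum_pairPoint ht hi hV]
      rfl

theorem sum_calJ_zeta_mul_H (hq0 : 0 < P.q) (hq1 : P.q < 1)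
    (hconv₀ : ∀ i ∈ Icc 1 n, ‖(P.q : ℂ) * P.t ^ (2 * (i : ℤ) - 2)‖ < 1)
    (hconv₁ : ∀ i ∈ Icc 1 n,
      P.q < ‖P.a 0 * P.a 1 * P.b 0 * P.b 1 * P.t ^ (2 * (i : ℤ) - 2)‖)
    {x₁ x₂ : ℂ} (hx₁ : x₁ ≠ 0) (hx₂ : x₂ ≠ 0) (h1 : ∀ m ∈ Icc 1 n, theta P.q (P.t ^ m) ≠ 0)
    (h2 : ∀ m : ℤ, |m| < (n : ℤ) → theta P.q (x₂ * x₁⁻¹ * P.t ^ m) ≠ 0)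
    (h3 : ∀ l : Fin 2, ∀ m < n, theta P.q (x₁ * P.b l * P.t ^ m) ≠ 0 ∧
      theta P.q (x₂ * P.b l * P.t ^ m) ≠ 0)
    (h4 : ∀ l ∈ Icc 1 n,
      theta P.q (x₁ * x₂ * P.b 0 * P.b 1 * P.t ^ ((n : ℤ) + l - 2)) ≠ 0) :
    (∀ i ≤ n, JacksonConverges P.q (fun z => P.Phi z * Delta z) (P.zeta n i x₁ x₂)) ∧
      ∑ i ∈ range (n + 1), P.calJ (P.zeta n i x₁ x₂) * P.H n i x₁ x₂ = P.productValue n := by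
  have hx : ∀ i k, P.zeta n i x₁ x₂ k ≠ 0 := fun i =>
    pairPoint_ne_zero hx₁ hx₂ (P.t_ne_zero hq0)
  have hθ := fun i => theta_zeta_ne_zero (P := P) hq0 hx₁ hx₂ h1 h2 h3 i
  rw [sum_congr rfl fun i _ => by rw [P.calJ_eq_symSum hq0 hq1 (hx i) (hθ i).1 (hθ i).2]]
  rcases Nat.eq_zero_or_pos n with rfl | hn
  · refine ⟨fun i _ => Summable.of_finite, ?_⟩
    simp [symSum, altSum, term, thetaVand, productValue, H]
  · have hadm := P.admissible hq0 hq1 hn hconv₀ hconv₁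
    constructor
    · intro i _
      refine Summable.congr ?_ fun ν => (P.Phi_mul_Delta hq0 hq1 (hx i) (hθ i).1 (hθ i).2 ν).symm
      exact ((hadm.summable_norm (hx i)).of_norm.div_const _).mul_left _
    · have key := hadm.connection hx₁ hx₂ h1 h2 h3 h4
      rw [symList_geomList_inv, hadm.symSum_truncPoint h1] at key
      have e : P.productValue n = (1 - (P.q : ℂ)) ^ n * prodValue P.q P.a P.b P.t n := rfl
      rw [e, ← key, mul_sum]
      refine sum_congr rfl fun i hi => ?_
      rw [zeta_eq_pairPoint, symSum_pairPoint _ _ _ _ _ _ _ (Nat.lt_succ_iff.1 (mem_range.1 hi)),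
        mul_assoc]
      rfl

end Params

end QSelberg

end

theorem theorem3 (P : QSelberg.Params) (hq0 : 0 < P.q) (hq1 : P.q < 1) (n : ℕ)
    (hconv₀ : ∀ i ∈ Finset.Icc 1 n, ‖(P.q : ℂ) * P.t ^ (2 * (i : ℤ) - 2)‖ < 1)
    (hconv₁ : ∀ i ∈ Finset.Icc 1 n,
      P.q < ‖P.a 0 * P.a 1 * P.b 0 * P.b 1 * P.t ^ (2 * (i : ℤ) - 2)‖)
    (ht : ∀ m : ℕ, 0 < m → P.t ≠ (P.q : ℂ) ^ m) :
    (∀ i ≤ n, P.BarRegular (P.zeta n i (P.b 0) (P.b 1)) →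
      QSelberg.JacksonConverges P.q (fun z => P.barPhi z * QSelberg.Delta z)
        (P.zeta n i (P.b 0) (P.b 1)) ∧
      P.barCalJ (P.zeta n i (P.b 0) (P.b 1)) = P.productValue n) ∧
    (∀ x₁ x₂ : ℂ, x₁ ≠ 0 → x₂ ≠ 0 →
      (∀ m ∈ Finset.Icc 1 n, QSelberg.theta P.q (P.t ^ m) ≠ 0) →
      (∀ m : ℤ, |m| < (n : ℤ) → QSelberg.theta P.q (x₂ * x₁⁻¹ * P.t ^ m) ≠ 0) →
      (∀ l : Fin 2, ∀ m < n, QSelberg.theta P.q (x₁ * P.b l * P.t ^ m) ≠ 0 ∧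
        QSelberg.theta P.q (x₂ * P.b l * P.t ^ m) ≠ 0) →
      (∀ l ∈ Finset.Icc 1 n,
        QSelberg.theta P.q (x₁ * x₂ * P.b 0 * P.b 1 * P.t ^ ((n : ℤ) + l - 2)) ≠ 0) →
      (∀ i ≤ n, QSelberg.JacksonConverges P.q (fun z => P.Phi z * QSelberg.Delta z)
        (P.zeta n i x₁ x₂)) ∧
      ∑ i ∈ Finset.range (n + 1), P.calJ (P.zeta n i x₁ x₂) * P.H n i x₁ x₂ =
        P.productValue n) := by
  exact ⟨fun i hi h => QSelberg.Params.barCalJ_zeta hq0 hq1 hconv₀ hconv₁ ht hi h,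
    fun x₁ x₂ hx₁ hx₂ h1 h2 h3 h4 =>
      QSelberg.Params.sum_calJ_zeta_mul_H hq0 hq1 hconv₀ hconv₁ hx₁ hx₂ h1 h2 h3 h4⟩
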